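/- Let $p\ge 7$ be a prime, $G=\mathrm{GL}_2(\mathbb{Q}_p)$, $K=\mathrm{GL}_2(\mathbb{Z}_p)$, and $Z$ the centre of $G$. Let $\nu$ be the valuation of $\bar{\mathbb{Q}}_p$ with $\nu(p)=1$, and let $\bar{\mathbb{Z}}_p$ and $\bar{\mathbb{F}}_p$ be the ring of integers and the residue field of $\bar{\mathbb{Q}}_p$. For a $\bar{\mathbb{Z}}_p$-algebra $R$, let $KZ$ act on $\mathrm{Sym}^r R^2$ (homogeneous polynomials of degree $r$ in $x,y$) through the natural action of $K$, with $p\in Z$ acting trivially; let $\mathrm{ind}_{KZ}^G$ denote compact induction and let $T$ be the Hecke operator on $\mathrm{ind}_{KZ}^G(\mathrm{Sym}^r R^2)$ attached to the double coset $KZ\begin{pmatrix}1&0\\0&p\end{pmatrix}KZ$. For $0\ne a_p\in\bar{\mathbb{Q}}_p$ let $\Theta_{r+2,a_p}$ be the image of $\mathrm{ind}_{KZ}^G(\mathrm{Sym}^r\bar{\mathbb{Z}}_p^2)$ in $\mathrm{ind}_{KZ}^G(\mathrm{Sym}^r\bar{\mathbb{Q}}_p^2)/(T-a_p)$, let $\bar\Theta_{r+2,a_p}=\Theta_{r+2,a_p}\otimes_{\bar{\mathbb{Z}}_p}\bar{\mathbb{F}}_p$,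 let $V_r=\mathrm{Sym}^r\bar{\mathbb{F}}_p^2$, and let $P:\mathrm{ind}_{KZ}^G V_r\to\bar\Theta_{r+2,a_p}$ be the natural surjection. For $m\ge 0$ let $V_r^{(m)}\subseteq V_r$ be the subrepresentation of polynomials divisible by $\theta^m$, where $\theta=x^py-xy^p$. We say that $P$ factors through $\mathrm{ind}_{KZ}^G(V_r^{(n)}/V_r^{(n+1)})$ if the restriction of $P$ to $\mathrm{ind}_{KZ}^G V_r^{(n)}$ is induced by a surjective homomorphism of $G$-representations $\mathrm{ind}_{KZ}^G(V_r^{(n)}/V_r^{(n+1)})\to\bar\Theta_{r+2,a_p}$. Let $b,c,t,d$ be non-negative integers with $2\le b\le p$, $0\le c\le p-2$ and $p\nmid d$, and let $s=b+c(p-1)$ and $r=s+p^t(p-1)d$. Put $\epsilon=0$ if $2c-1\le b\le p$, $\epsilon=1$ if $2(c-1)-p\le b\le 2(c-1)$, and $\epsilon=2$ if $2\le b\le 2(c-1)-(p+1)$. Let $0\ne a_p\in\bar{\mathbb{Q}}_p$ be such that $$s>2\nu(a_p)\quad\text{and}\quad c<\nu(a_p)<\min\left\{\tfrac p2+c-\epsilon,\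 p-1\right\}.$$ Assume further that $t\ge 2\nu(a_p)$ if $b\ge 2c-1$, and that $t>2\nu(a_p)+\epsilon-1$ if $b\le 2c-2$. (I) If $(b,c)\ne(p,0)$, then $P$ factors through $\mathrm{ind}_{KZ}^G\left(V_r^{(c-\epsilon)}/V_r^{(c+1-\epsilon)}\right)$; in particular there is a surjection of this representation onto $\bar\Theta_{r+2,a_p}$. (II) If $(b,c)=(p,0)$ and $\nu(a_p)>1$, then $P$ factors through $\mathrm{ind}_{KZ}^G\left(V_r^{(1)}/V_r^{(2)}\right)$; in particular there is a surjection of this representation onto $\bar\Theta_{r+2,a_p}$. -/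

import Mathlib

open scoped TensorProduct

noncomputable section

/-! ### Compact induction -/

section CompactInduction

variable {R G H V : Type*} [CommRing R] [Group G] [Group H] [AddCommGroup V] [Module R V]

/-- Compact induction to `G` of a representation `ρ` of an (open) subgroup, the subgroup being given
as the image of a homomorphism `φ : H →* G`: the functions `f : G → V` with `f (h g) = ρ(h) f(g)`
whose support is contained in finitely many cosets `φ(H) s` (that is, compact modulo `φ(H)`). -/
def cInd (φ : H →* G) (ρ : Representation R H V) : Submodule R (G → V) where
  carrier := {f | (∀ h g, f (φ h * g) = ρ h (f g)) ∧
    ∃ S : Finset G, ∀ g, f g ≠ 0 → ∃ h, ∃ s ∈ S, g = φ h * s}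
  zero_mem' := ⟨fun h g => by simp, ∅, fun g hg => absurd rfl hg⟩
  add_mem' := by
    classical
    rintro f₁ f₂ ⟨e₁, S₁, h₁⟩ ⟨e₂, S₂, h₂⟩
    refine ⟨fun h g => by simp [e₁, e₂], S₁ ∪ S₂, fun g hg => ?_⟩
    by_cases h0 : f₁ g = 0
    · have : f₂ g ≠ 0 := fun h' => hg (by simp [h0, h'])
      obtain ⟨h, s, hs, rfl⟩ := h₂ g this
      exact ⟨h, s, Finset.mem_union_right _ hs, rfl⟩
    · obtain ⟨h, s, hs, rfl⟩ := h₁ g h0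
      exact ⟨h, s, Finset.mem_union_left _ hs, rfl⟩
  smul_mem' := by
    rintro a f ⟨e, S, hS⟩
    refine ⟨fun h g => by simp [e], S, fun g hg => hS g fun h' => hg (by simp [h'])⟩

/-- `G` acts on the compact induction by right translation. -/
def cIndRep (φ : H →* G) (ρ : Representation R H V) : Representation R G (cInd φ ρ) where
  toFun x :=
    { toFun := fun f => ⟨fun g => f.1 (g * x), fun h g => by
        change f.1 (φ h * g * x) = _
        rw [mul_assoc]; exact f.2.1 h _, by
        classical
        obtain ⟨S, hS⟩ := f.2.2
        refine ⟨S.image (· * x⁻¹), fun g hg => ?_⟩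
        obtain ⟨h, s, hs, e⟩ := hS _ hg
        exact ⟨h, s * x⁻¹, Finset.mem_image_of_mem _ hs, by rw [← mul_assoc, ← e]; group⟩⟩
      map_add' := fun _ _ => rfl
      map_smul' := fun _ _ => rfl }
  map_one' := by ext f g; simp
  map_mul' x y := by ext f g; simp [mul_assoc]

/-- Functoriality of compact induction, for a map `u` which commutes with the actions. The target
may have a larger ring of coefficients. -/
def cIndMap {S W : Type*} [CommRing S] [Algebra R S] [AddCommGroup W] [Module S W] [Module R W]
    [IsScalarTower R S W] (φ : H →* G) (ρ : Representation R H V) (τ : Representation S H W)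
    (u : V →ₗ[R] W) (hu : ∀ h v, u (ρ h v) = τ h (u v)) : cInd φ ρ →ₗ[R] cInd φ τ where
  toFun f := ⟨fun g => u (f.1 g), fun h g => by
    change u (f.1 (φ h * g)) = _
    rw [f.2.1, hu], by
    obtain ⟨S, hS⟩ := f.2.2
    exact ⟨S, fun g hg => hS g fun h' => hg (by
      change u (f.1 g) = 0
      rw [h', map_zero])⟩⟩
  map_add' f₁ f₂ := by ext g; simp
  map_smul' a f := by ext g; simp

theorem cIndMap_surjective {S W : Type*} [CommRing S] [Algebra R S] [AddCommGroup W] [Module S W]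
    [Module R W] [IsScalarTower R S W] (φ : H →* G) (hφ : Function.Injective φ)
    (ρ : Representation R H V) (τ : Representation S H W)
    (u : V →ₗ[R] W) (hu : ∀ h v, u (ρ h v) = τ h (u v)) (hs : Function.Surjective u) :
    Function.Surjective (cIndMap φ ρ τ u hu) := by
  classical
  intro f
  have hl : ∀ w, ∃ v, u v = w ∧ (w = 0 → v = 0) := fun w => by
    by_cases hw : w = 0
    · exact ⟨0, by simp [hw], fun _ => rfl⟩
    · obtain ⟨v, hv⟩ := hs w
      exact ⟨v, hv, fun h => absurd h hw⟩
  choose l hl hl0 using hl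
  let q : G → G := fun g => Quotient.out (Quotient.mk (QuotientGroup.rightRel φ.range) g)
  have hq : ∀ g, ∃ h, g = φ h * q g := fun g => by
    have h1 : (QuotientGroup.rightRel φ.range) (q g) g := Quotient.exact (Quotient.out_eq _)
    rw [QuotientGroup.rightRel_apply] at h1
    obtain ⟨h, hh⟩ := h1
    exact ⟨h, by rw [hh]; group⟩
  choose k hk using hq
  have hq' : ∀ h g, q (φ h * g) = q g := fun h g => by
    have : Quotient.mk (QuotientGroup.rightRel φ.range) (φ h * g) = Quotient.mk _ g := by
      apply Quotient.sound
      change (QuotientGroup.rightRel φ.range) _ _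
      rw [QuotientGroup.rightRel_apply]
      exact ⟨h⁻¹, by simp⟩
    simp only [q, this]
  have hk' : ∀ h g, k (φ h * g) = h * k g := fun h g => by
    apply hφ
    have h1 := hk (φ h * g)
    rw [hq'] at h1
    nth_rewrite 1 [hk g] at h1
    rw [← mul_assoc] at h1
    rw [map_mul]
    exact (mul_right_cancel h1).symm
  refine ⟨⟨fun g => ρ (k g) (l (f.1 (q g))), fun h g => ?_, ?_⟩, ?_⟩
  · change ρ (k (φ h * g)) (l (f.1 (q (φ h * g)))) = _
    rw [hk', hq', map_mul]; rfl
  · obtain ⟨S, hS⟩ := f.2.2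
    refine ⟨S, fun g hg => hS g fun h' => hg ?_⟩
    have : f.1 (q g) = 0 := by
      have h1 := f.2.1 (k g)⁻¹ g
      rw [h', map_zero] at h1
      rw [← h1]
      rw [map_inv]
      nth_rewrite 3 [hk g]
      group
    change ρ (k g) (l (f.1 (q g))) = 0
    rw [hl0 _ this, map_zero]
  · ext g
    change u _ = f.1 g
    rw [hu, hl, ← f.2.1, ← hk]

end CompactInduction

/-! ### Symmetric powers -/

section Sym

/-- `Sym^r R²`, modelled on homogeneous polynomials of degree `r` in `x = X 0`, `y = X 1`. -/
def SymPow (R : Type*) [CommRing R] (r : ℕ) : Type _ :=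
  MvPolynomial.homogeneousSubmodule (Fin 2) R r

instance symPowAddCommGroup (R : Type*) [CommRing R] (r : ℕ) : AddCommGroup (SymPow R r) :=
  inferInstanceAs (AddCommGroup (MvPolynomial.homogeneousSubmodule (Fin 2) R r))

instance symPowModule (S R : Type*) [CommRing S] [CommRing R] [Algebra S R] (r : ℕ) :
    Module S (SymPow R r) :=
  inferInstanceAs (Module S (MvPolynomial.homogeneousSubmodule (Fin 2) R r))

instance symPowTower (S R : Type*) [CommRing S] [CommRing R] [Algebra S R] (r : ℕ) :
    IsScalarTower S R (SymPow R r) :=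
  inferInstanceAs (IsScalarTower S R (MvPolynomial.homogeneousSubmodule (Fin 2) R r))

/-- The polynomial underlying an element of `Sym^r R²`. -/
def SymPow.poly {R : Type*} [CommRing R] {r : ℕ} : SymPow R r →ₗ[R] MvPolynomial (Fin 2) R :=
  (MvPolynomial.homogeneousSubmodule (Fin 2) R r).subtype

/-- A homogeneous polynomial of degree `r` as an element of `Sym^r R²`. -/
def SymPow.mk {R : Type*} [CommRing R] {r : ℕ} (q : MvPolynomial (Fin 2) R)
    (hq : q.IsHomogeneous r) : SymPow R r :=
  (⟨q, hq⟩ : MvPolynomial.homogeneousSubmodule (Fin 2) R r)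

@[simp]
theorem SymPow.poly_mk {R : Type*} [CommRing R] {r : ℕ} (q : MvPolynomial (Fin 2) R)
    (hq : q.IsHomogeneous r) : (SymPow.mk q hq).poly = q := rfl

theorem SymPow.isHomogeneous {R : Type*} [CommRing R] {r : ℕ} (f : SymPow R r) :
    f.poly.IsHomogeneous r :=
  (f : MvPolynomial.homogeneousSubmodule (Fin 2) R r).2

@[ext]
theorem SymPow.ext {R : Type*} [CommRing R] {r : ℕ} {f g : SymPow R r} (h : f.poly = g.poly) :
    f = g :=
  Subtype.ext h

theorem SymPow.poly_smul {S R : Type*} [CommRing S] [CommRing R] [Algebra S R] {r : ℕ} (a : S)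
    (f : SymPow R r) : (a • f).poly = a • f.poly := rfl

variable {R : Type*} [CommRing R]

/-- The action of a matrix `(a b; c d)` on polynomials: `v(x, y) ↦ v(a x + c y, b x + d y)`. -/
def polyAct (M : Matrix (Fin 2) (Fin 2) R) : MvPolynomial (Fin 2) R →ₐ[R] MvPolynomial (Fin 2) R :=
  MvPolynomial.aeval M.transpose.toMvPolynomial

theorem polyAct_one : polyAct (1 : Matrix (Fin 2) (Fin 2) R) = AlgHom.id R _ := by
  ext i : 1
  simp [polyAct]

theorem polyAct_mul (M N : Matrix (Fin 2) (Fin 2) R) :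
    polyAct (M * N) = (polyAct M).comp (polyAct N) := by
  ext i : 1
  simp only [polyAct, Matrix.transpose_mul, MvPolynomial.aeval_X, AlgHom.comp_apply,
    Matrix.toMvPolynomial_mul, MvPolynomial.bind₁]

theorem polyAct_X0 (a b c d : R) : polyAct !![a, b; c, d] (MvPolynomial.X 0) =
    MvPolynomial.C a * MvPolynomial.X 0 + MvPolynomial.C c * MvPolynomial.X 1 := by
  simp [polyAct, Matrix.toMvPolynomial, MvPolynomial.C_mul_X_eq_monomial]

theorem polyAct_X1 (a b c d : R) : polyAct !![a, b; c, d] (MvPolynomial.X 1) =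
    MvPolynomial.C b * MvPolynomial.X 0 + MvPolynomial.C d * MvPolynomial.X 1 := by
  simp [polyAct, Matrix.toMvPolynomial, MvPolynomial.C_mul_X_eq_monomial]

theorem polyAct_isHomogeneous (M : Matrix (Fin 2) (Fin 2) R) {r : ℕ} {q : MvPolynomial (Fin 2) R}
    (hq : q.IsHomogeneous r) : (polyAct M q).IsHomogeneous r := by
  have h := MvPolynomial.IsHomogeneous.aeval (R := R) (S := R) (n := 1) hq
    M.transpose.toMvPolynomial (fun i => Matrix.toMvPolynomial_isHomogeneous _ _)
  rw [one_mul] at h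
  exact h

/-- The action of the monoid of matrices over `R` on `Sym^r R²`. -/
def symAct (R : Type*) [CommRing R] (r : ℕ) :
    Matrix (Fin 2) (Fin 2) R →* Module.End R (SymPow R r) where
  toFun M :=
    { toFun := fun f => SymPow.mk (polyAct M f.poly) (polyAct_isHomogeneous M f.isHomogeneous)
      map_add' := fun f g => by ext1; simp
      map_smul' := fun a f => by ext1; simp }
  map_one' := by ext1 f; ext1; simp [polyAct_one]
  map_mul' M N := by ext1 f; ext1; simp [polyAct_mul]

theorem symAct_poly (r : ℕ) (M : Matrix (Fin 2) (Fin 2) R) (f : SymPow R r) :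
    (symAct R r M f).poly = polyAct M f.poly := rfl

/-- Change of coefficients `Sym^r R² → Sym^r S²`. -/
def symMap (R S : Type*) [CommRing R] [CommRing S] [Algebra R S] (r : ℕ) :
    SymPow R r →ₗ[R] SymPow S r where
  toFun f := SymPow.mk (MvPolynomial.map (algebraMap R S) f.poly) (f.isHomogeneous.map _)
  map_add' f g := by ext1; simp
  map_smul' a f := by
    ext1
    change MvPolynomial.map (algebraMap R S) (a • f.poly) =
      a • MvPolynomial.map (algebraMap R S) f.poly
    rw [MvPolynomial.smul_eq_C_mul, map_mul, MvPolynomial.map_C, algebra_compatible_smul S a,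
      MvPolynomial.smul_eq_C_mul]

theorem symMap_symAct {R S : Type*} [CommRing R] [CommRing S] [Algebra R S] (r : ℕ)
    (M : Matrix (Fin 2) (Fin 2) R) (f : SymPow R r) :
    symMap R S r (symAct R r M f) = symAct S r (M.map (algebraMap R S)) (symMap R S r f) := by
  ext1
  change MvPolynomial.map _ (polyAct M f.poly) = polyAct _ (MvPolynomial.map _ f.poly)
  generalize f.poly = q
  induction q using MvPolynomial.induction_on with
  | C a => simp [polyAct]
  | add p q hp hq => simp [hp, hq]
  | mul_X p i hp =>
    simp only [map_mul, hp, MvPolynomial.map_X]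
    congr 1
    simp only [polyAct, MvPolynomial.aeval_X, ← Matrix.toMvPolynomial_map, Matrix.transpose_map]

theorem symMap_surjective {R S : Type*} [CommRing R] [CommRing S] [Algebra R S] (r : ℕ)
    (h : Function.Surjective (algebraMap R S)) : Function.Surjective (symMap R S r) := by
  intro f
  obtain ⟨q, hq⟩ := MvPolynomial.map_surjective (algebraMap R S) h f.poly
  refine ⟨SymPow.mk (MvPolynomial.homogeneousComponent r q)
    (MvPolynomial.homogeneousComponent_isHomogeneous r q), ?_⟩
  ext1
  change MvPolynomial.map _ (MvPolynomial.homogeneousComponent r q) = _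
  ext d
  rw [MvPolynomial.coeff_map, MvPolynomial.coeff_homogeneousComponent]
  split_ifs with hd
  · rw [← MvPolynomial.coeff_map, hq]
  · rw [map_zero]
    by_contra hne
    refine hd ?_
    have := f.isHomogeneous (Ne.symm hne)
    rw [← this, Finsupp.degree_eq_weight_one]
    rfl

end Sym

/-! ### The group `KZ` and the Hecke operator -/

section Hecke

variable (p : ℕ) [Fact p.Prime]

/-- The inclusion of `K = GL₂(ℤ_p)` into `G = GL₂(ℚ_p)`. -/
def inclK : GL (Fin 2) ℤ_[p] →* GL (Fin 2) ℚ_[p] :=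
  Matrix.GeneralLinearGroup.map PadicInt.Coe.ringHom

/-- The scalar matrix `p` in `G = GL₂(ℚ_p)`. -/
def scalarP : GL (Fin 2) ℚ_[p] :=
  Matrix.GeneralLinearGroup.scalar (Fin 2)
    (Units.mk0 (p : ℚ_[p]) (Nat.cast_ne_zero.2 (Fact.out : p.Prime).ne_zero))

theorem commute_scalarP (g : GL (Fin 2) ℚ_[p]) : Commute g (scalarP p) :=
  (Matrix.GeneralLinearGroup.scalar_commute _ g).symm

/-- The subgroup `KZ` of `G`, parametrized by `K × p^ℤ ≃ KZ`, `(k, n) ↦ k pⁿ`. -/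
def kzHom : GL (Fin 2) ℤ_[p] × Multiplicative ℤ →* GL (Fin 2) ℚ_[p] :=
  MonoidHom.noncommCoprod (inclK p) (zpowersHom _ (scalarP p)) fun k n => by
    rw [zpowersHom_apply]
    exact (commute_scalarP p _).zpow_right _

theorem kzHom_apply (k : GL (Fin 2) ℤ_[p]) (n : Multiplicative ℤ) :
    kzHom p (k, n) = inclK p k * scalarP p ^ n.toAdd := rfl

theorem inclK_injective : Function.Injective (inclK p) := by
  intro a b h
  ext i j
  have := congrArg (fun g : GL (Fin 2) ℚ_[p] => (g : Matrix (Fin 2) (Fin 2) ℚ_[p]) i j) h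
  exact Subtype.ext this

theorem norm_det_kzHom (k : GL (Fin 2) ℤ_[p]) (n : Multiplicative ℤ) :
    ‖((kzHom p (k, n)).det : ℚ_[p])‖ = (p : ℝ) ^ (-2 * n.toAdd) := by
  rw [kzHom_apply, map_mul, map_zpow, scalarP, Matrix.GeneralLinearGroup.det_scalar, inclK,
    Matrix.GeneralLinearGroup.map_det]
  simp only [Units.val_mul, norm_mul, Units.coe_map, Units.val_zpow_eq_zpow_val, Units.val_pow_eq_pow_val,
    norm_zpow, norm_pow, Units.val_mk0, Padic.norm_p, Fintype.card_fin]
  have h1 : ‖(PadicInt.Coe.ringHom (k.det : ℤ_[p]) : ℚ_[p])‖ = 1 :=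
    PadicInt.norm_units k.det
  change ‖(PadicInt.Coe.ringHom (k.det : ℤ_[p]) : ℚ_[p])‖ * _ = _
  rw [h1, one_mul, ← zpow_natCast, inv_zpow', ← zpow_mul]
  norm_num

theorem kzHom_injective : Function.Injective (kzHom p) := by
  rw [injective_iff_map_eq_one]
  rintro ⟨k, n⟩ h
  have h1 := norm_det_kzHom p k n
  rw [h] at h1
  have hp : (1 : ℝ) < p := by exact_mod_cast (Fact.out : p.Prime).one_lt
  have hn : n.toAdd = 0 := by
    simp only [map_one, Units.val_one, norm_one] at h1
    have := (zpow_eq_one_iff_right₀ (by positivity) hp.ne').1 h1.symm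
    omega
  rw [kzHom_apply, hn, zpow_zero, mul_one] at h
  have hk : k = 1 := inclK_injective p (by rw [h, map_one])
  rw [hk]
  exact Prod.ext rfl hn

theorem range_kzHom : (kzHom p).range = (inclK p).range ⊔ Subgroup.center (GL (Fin 2) ℚ_[p]) := by
  apply le_antisymm
  · rintro _ ⟨⟨k, n⟩, rfl⟩
    rw [kzHom_apply]
    refine mul_mem (Subgroup.mem_sup_left ⟨k, rfl⟩) (Subgroup.mem_sup_right ?_)
    exact Subgroup.zpow_mem _ (Subgroup.mem_center_iff.2 fun g => commute_scalarP p g) _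
  · rw [sup_le_iff]
    constructor
    · rintro _ ⟨k, rfl⟩
      exact ⟨(k, 1), by rw [kzHom_apply]; simp⟩
    · intro g hg
      rw [Matrix.GeneralLinearGroup.center_eq_range_scalar] at hg
      obtain ⟨u, rfl⟩ := hg
      obtain ⟨n, v, hv⟩ : ∃ (n : ℤ) (v : ℤ_[p]ˣ), (u : ℚ_[p]) = (p : ℚ_[p]) ^ n * v := by
        have hp0 : (p : ℚ_[p]) ≠ 0 := Nat.cast_ne_zero.2 (Fact.out : p.Prime).ne_zero
        have hnorm : ‖(u : ℚ_[p]) * (p : ℚ_[p]) ^ (-(u : ℚ_[p]).valuation)‖ = 1 := by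
          rw [norm_mul, Padic.norm_eq_zpow_neg_valuation u.ne_zero, norm_zpow, Padic.norm_p,
            inv_zpow', ← zpow_add₀ (Nat.cast_ne_zero.2 (Fact.out : p.Prime).ne_zero)]
          simp
        refine ⟨(u : ℚ_[p]).valuation, PadicInt.mkUnits hnorm, ?_⟩
        rw [PadicInt.mkUnits_eq]
        rw [mul_comm, mul_assoc, ← zpow_add₀ hp0]
        simp
      refine ⟨(Matrix.GeneralLinearGroup.scalar (Fin 2) v, Multiplicative.ofAdd n), ?_⟩
      rw [kzHom_apply, inclK, Matrix.GeneralLinearGroup.map_scalar, scalarP, ← map_zpow, ← map_mul]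
      congr 1
      ext
      rw [hv, mul_comm]
      simp
      exact Or.inl rfl

/-- The Teichmüller representative `[a] ∈ ℤ_p` of `a ∈ 𝔽_p`. -/
def teich (a : ZMod p) : ℤ_[p] := WittVector.equiv p (WittVector.teichmuller p a)

theorem toZMod_eq_zero_iff (z : ℤ_[p]) : PadicInt.toZMod z = 0 ↔ (p : ℤ_[p]) ∣ z := by
  rw [← RingHom.mem_ker, PadicInt.ker_toZMod, PadicInt.maximalIdeal_eq_span_p,
    Ideal.mem_span_singleton]

theorem isUnit_of_toZMod_ne_zero {z : ℤ_[p]} (h : PadicInt.toZMod z ≠ 0) : IsUnit z := by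
  by_contra hz
  apply h
  rw [← RingHom.mem_ker, PadicInt.ker_toZMod]
  exact (IsLocalRing.mem_maximalIdeal _).2 hz

theorem toZMod_teich (a : ZMod p) : PadicInt.toZMod (teich p a) = a := by
  set w : WittVector p (ZMod p) := WittVector.teichmuller p a - (a.val : WittVector p (ZMod p))
    with hw
  have h0 : WittVector.constantCoeff w = 0 := by
    rw [hw, map_sub, map_natCast, ZMod.natCast_zmod_val, WittVector.constantCoeff_apply,
      WittVector.teichmuller_coeff_zero, sub_self]
  have h1 : ¬ IsUnit w := fun hu => by
    have := hu.map WittVector.constantCoeff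
    rw [h0] at this
    exact not_isUnit_zero this
  have h2 : ¬ IsUnit (WittVector.equiv p w) := fun hu => h1 ((MulEquiv.isUnit_map _).1 hu)
  have h3 : PadicInt.toZMod (WittVector.equiv p w) = 0 := by
    by_contra h
    exact h2 (isUnit_of_toZMod_ne_zero p h)
  rw [hw, map_sub, map_sub, map_natCast, map_natCast, ZMod.natCast_zmod_val, sub_eq_zero] at h3
  exact h3

/-- The matrices `(p [a]; 0 1)` for `a ∈ 𝔽_p`, and `α = (1 0; 0 p)`: representatives of the left
cosets of `K` in the double coset `K α K`. -/
def heckeMat : Option (ZMod p) → Matrix (Fin 2) (Fin 2) ℤ_[p]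
  | none => !![1, 0; 0, p]
  | some a => !![p, teich p a; 0, 1]

theorem det_heckeMat (i : Option (ZMod p)) : (heckeMat p i).det = p := by
  cases i <;> simp [heckeMat, Matrix.det_fin_two]

/-- The same matrices as elements of `G`. -/
def heckeElt (i : Option (ZMod p)) : GL (Fin 2) ℚ_[p] :=
  Matrix.GeneralLinearGroup.mkOfDetNeZero ((heckeMat p i).map PadicInt.Coe.ringHom) <| by
    have h := RingHom.map_det (PadicInt.Coe.ringHom (p := p)) (heckeMat p i)
    rw [RingHom.mapMatrix_apply] at h
    rw [← h, det_heckeMat, map_natCast]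
    exact Nat.cast_ne_zero.2 (Fact.out : p.Prime).ne_zero

theorem exists_dvd_sub (x e : ℤ_[p]) (he : PadicInt.toZMod e ≠ 0) :
    ∃ m : ZMod p, (p : ℤ_[p]) ∣ x - teich p m * e := by
  refine ⟨PadicInt.toZMod x / PadicInt.toZMod e, ?_⟩
  rw [← toZMod_eq_zero_iff, map_sub, map_mul, toZMod_teich, div_mul_cancel₀ _ he, sub_self]

theorem exists_GL_of_det (M : Matrix (Fin 2) (Fin 2) ℤ_[p]) (h : IsUnit M.det) :
    ∃ k : GL (Fin 2) ℤ_[p], (k : Matrix (Fin 2) (Fin 2) ℤ_[p]) = M :=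
  ⟨((Matrix.isUnit_iff_isUnit_det M).2 h).unit, rfl⟩

theorem hecke_coset (κ : GL (Fin 2) ℤ_[p]) (i : Option (ZMod p)) :
    ∃ j, ∃ k : GL (Fin 2) ℤ_[p], (κ : Matrix (Fin 2) (Fin 2) ℤ_[p]) * heckeMat p i =
      heckeMat p j * (k : Matrix (Fin 2) (Fin 2) ℤ_[p]) := by
  have hu : IsUnit (κ : Matrix (Fin 2) (Fin 2) ℤ_[p]).det :=
    (Matrix.isUnit_iff_isUnit_det _).1 κ.isUnit
  generalize (κ : Matrix (Fin 2) (Fin 2) ℤ_[p]) = M at hu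
  obtain ⟨a, b, c, d, rfl⟩ : ∃ a b c d, M = !![a, b; c, d] :=
    ⟨_, _, _, _, Matrix.eta_fin_two M⟩
  rw [Matrix.det_fin_two_of] at hu
  have key : ∀ j (N : Matrix (Fin 2) (Fin 2) ℤ_[p]), N.det = a * d - b * c →
      !![a, b; c, d] * heckeMat p i = heckeMat p j * N → ∃ j, ∃ k : GL (Fin 2) ℤ_[p],
        !![a, b; c, d] * heckeMat p i =
          heckeMat p j * (k : Matrix (Fin 2) (Fin 2) ℤ_[p]) := by
    intro j N hN h
    obtain ⟨k, hk⟩ := exists_GL_of_det p N (by rw [hN]; exact hu)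
    exact ⟨j, k, by rw [hk]; exact h⟩
  have hp0 : (p : ℤ_[p]) ≠ 0 := Nat.cast_ne_zero.2 (Fact.out : p.Prime).ne_zero
  cases i with
  | none =>
    by_cases hc : PadicInt.toZMod c = 0
    · obtain ⟨c', rfl⟩ := (toZMod_eq_zero_iff p c).1 hc
      refine key none !![a, p * b; c', d] ?_ ?_
      · rw [Matrix.det_fin_two_of]; ring
      · ext i j; fin_cases i <;> fin_cases j <;> simp [heckeMat, Matrix.mul_apply] <;> ring
    · obtain ⟨m, z, hz⟩ := exists_dvd_sub p a c hc
      refine key (some m) !![z, b - teich p m * d; c, p * d] ?_ ?_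
      · rw [Matrix.det_fin_two_of]; linear_combination (-d) * hz
      · ext i j; fin_cases i <;> fin_cases j <;> simp [heckeMat, Matrix.mul_apply] <;>
          first | ring1 | linear_combination hz
  | some l =>
    by_cases hc : PadicInt.toZMod (c * teich p l + d) = 0
    · obtain ⟨e, he⟩ := (toZMod_eq_zero_iff p _).1 hc
      refine key none !![p * a, a * teich p l + b; c, e] ?_ ?_
      · rw [Matrix.det_fin_two_of]; linear_combination (-a) * he
      · ext i j; fin_cases i <;> fin_cases j <;> simp [heckeMat, Matrix.mul_apply] <;>
          first | ring1 | linear_combination he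
    · obtain ⟨m, z, hz⟩ := exists_dvd_sub p (a * teich p l + b) _ hc
      refine key (some m) !![a - teich p m * c, z; p * c, c * teich p l + d] ?_ ?_
      · rw [Matrix.det_fin_two_of]; linear_combination c * hz
      · ext i j; fin_cases i <;> fin_cases j <;> simp [heckeMat, Matrix.mul_apply] <;>
          first | ring1 | linear_combination hz

theorem heckeMat_unique (i j : Option (ZMod p)) (k : GL (Fin 2) ℤ_[p])
    (h : heckeMat p i = heckeMat p j * (k : Matrix (Fin 2) (Fin 2) ℤ_[p])) : i = j := by
  generalize (k : Matrix (Fin 2) (Fin 2) ℤ_[p]) = M at h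
  have hp : PadicInt.toZMod (p : ℤ_[p]) = 0 := by simp
  have h00 := congrArg (fun N => PadicInt.toZMod (N 0 0)) h
  have h01 := congrArg (fun N => PadicInt.toZMod (N 0 1)) h
  have h10 := congrArg (fun N => PadicInt.toZMod (N 1 0)) h
  have h11 := congrArg (fun N => PadicInt.toZMod (N 1 1)) h
  cases i <;> cases j <;>
    simp [heckeMat, Matrix.mul_apply, toZMod_teich] at h00 h01 h10 h11
  · rfl
  · rw [← h10] at h00; simp at h00
  · rw [h01, ← h11]; simp

theorem exists_hecke_perm (κ : GL (Fin 2) ℤ_[p]) : ∃ σ : Equiv.Perm (Option (ZMod p)),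
    ∃ k : Option (ZMod p) → GL (Fin 2) ℤ_[p], ∀ i,
      (κ : Matrix (Fin 2) (Fin 2) ℤ_[p]) * heckeMat p i =
        heckeMat p (σ i) * (k i : Matrix (Fin 2) (Fin 2) ℤ_[p]) := by
  choose σ k h using hecke_coset p κ
  have hinj : Function.Injective σ := fun i j hij => by
    have hj := h j
    rw [← hij] at hj
    apply heckeMat_unique p i j ((k j)⁻¹ * k i)
    have h1 : (κ : Matrix (Fin 2) (Fin 2) ℤ_[p]) * (heckeMat p i) = (κ : Matrix (Fin 2) (Fin 2) ℤ_[p]) *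
        (heckeMat p j * (((k j)⁻¹ * k i : GL (Fin 2) ℤ_[p]) : Matrix (Fin 2) (Fin 2) ℤ_[p])) := by
      rw [h i, ← mul_assoc, hj, mul_assoc, ← Units.val_mul, mul_inv_cancel_left]
    exact (Units.mul_right_inj κ).1 h1
  exact ⟨Equiv.ofBijective σ (Finite.injective_iff_bijective.1 hinj), k, h⟩

theorem exists_hecke_perm' (κ : GL (Fin 2) ℤ_[p]) : ∃ σ : Equiv.Perm (Option (ZMod p)),
    ∃ k : Option (ZMod p) → GL (Fin 2) ℤ_[p], ∀ i,
      (κ : Matrix (Fin 2) (Fin 2) ℤ_[p]) * heckeMat p i =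
        heckeMat p (σ i) * (k i : Matrix (Fin 2) (Fin 2) ℤ_[p]) ∧
      inclK p κ * heckeElt p i = heckeElt p (σ i) * inclK p (k i) := by
  obtain ⟨σ, k, h⟩ := exists_hecke_perm p κ
  refine ⟨σ, k, fun i => ⟨h i, ?_⟩⟩
  apply Units.ext
  have := congrArg (RingHom.mapMatrix (PadicInt.Coe.ringHom (p := p))) (h i)
  rw [map_mul, map_mul] at this
  exact this

/-- `h_i = k p α⁻¹ k'` with `k, k' ∈ K`. -/
theorem heckeElt_eq (i : Option (ZMod p)) : ∃ k k' : GL (Fin 2) ℤ_[p],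
    heckeElt p i = inclK p k * scalarP p * (heckeElt p none)⁻¹ * inclK p k' := by
  obtain ⟨w, hw⟩ := exists_GL_of_det p !![0, 1; 1, 0] (by simp [Matrix.det_fin_two])
  have hinv : ∀ k k' : GL (Fin 2) ℤ_[p],
      heckeMat p i * (k' : Matrix (Fin 2) (Fin 2) ℤ_[p]) * heckeMat p none =
        (p : ℤ_[p]) • (k : Matrix (Fin 2) (Fin 2) ℤ_[p]) →
      heckeElt p i = inclK p k * scalarP p * (heckeElt p none)⁻¹ * inclK p k'⁻¹ := by
    intro k k' h
    have h2 : heckeElt p i * inclK p k' * heckeElt p none = inclK p k * scalarP p := by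
      apply Units.ext
      have := congrArg (RingHom.mapMatrix (PadicInt.Coe.ringHom (p := p))) h
      rw [map_mul, map_mul] at this
      refine this.trans ?_
      ext a b
      change _ = (((k : Matrix (Fin 2) (Fin 2) ℤ_[p]).map PadicInt.Coe.ringHom) *
        Matrix.scalar (Fin 2) (p : ℚ_[p])) a b
      rw [Matrix.scalar_apply, Matrix.mul_diagonal]
      simp [Matrix.smul_apply, mul_comm]
    rw [← h2, map_inv]
    group
  cases i with
  | none =>
    refine ⟨w, w⁻¹, hinv w w ?_⟩
    rw [hw]
    ext i j; fin_cases i <;> fin_cases j <;> simp [heckeMat, Matrix.mul_apply]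
  | some l =>
    obtain ⟨u, hu⟩ := exists_GL_of_det p !![1, teich p l; 0, 1] (by simp [Matrix.det_fin_two])
    refine ⟨u, 1⁻¹, hinv u 1 ?_⟩
    rw [hu]
    ext i j; fin_cases i <;> fin_cases j <;> simp [heckeMat, Matrix.mul_apply]
    ring

variable {R : Type*} [CommRing R] (φ : ℤ_[p] →+* R) (r : ℕ)

/-- The representation `Sym^r R²` of `KZ`, for a ring `R` over `ℤ_p`: the group `K` acts through its
image in `GL₂(R)`, and `p ∈ Z` acts trivially. -/
def symRep : Representation R (GL (Fin 2) ℤ_[p] × Multiplicative ℤ) (SymPow R r) where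
  toFun h := symAct R r ((h.1 : Matrix (Fin 2) (Fin 2) ℤ_[p]).map φ)
  map_one' := by
    have : (1 : Matrix (Fin 2) (Fin 2) ℤ_[p]).map φ = 1 := Matrix.map_one _ (map_zero φ) (map_one φ)
    simp [this]
  map_mul' a b := by
    rw [← map_mul, ← Matrix.map_mul]
    rfl

theorem symRep_apply (k : GL (Fin 2) ℤ_[p]) (n : Multiplicative ℤ) (v : SymPow R r) :
    symRep p φ r (k, n) v = symAct R r ((k : Matrix (Fin 2) (Fin 2) ℤ_[p]).map φ) v := rfl

theorem symAct_symAct (M N : Matrix (Fin 2) (Fin 2) ℤ_[p]) (v : SymPow R r) :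
    symAct R r (M.map φ) (symAct R r (N.map φ) v) = symAct R r ((M * N).map φ) v := by
  rw [Matrix.map_mul, map_mul, Module.End.mul_apply]

/-- The value `(T f)(g) = ∑_h h · f(h⁻¹ g)` of the Hecke operator, `h` running over representatives
of `K α K / K`. On the function `[1, v]` supported on `KZ` with value `v` at `1`, this is the usual
`T [1, v] = ∑_{a ∈ 𝔽_p} [(p [a]; 0 1), v(x, -[a] x + p y)] + [α, v(p x, y)]`. -/
def heckeFun (f : GL (Fin 2) ℚ_[p] → SymPow R r) (g : GL (Fin 2) ℚ_[p]) : SymPow R r :=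
  ∑ i : Option (ZMod p), symAct R r ((heckeMat p i).map φ) (f ((heckeElt p i)⁻¹ * g))

theorem group_aux {G : Type*} [Group G] (k z h₀ k' κ zn s hσ : G) (hz : ∀ x, z * x = x * z)
    (hn : ∀ x, zn * x = x * zn) : k * z * h₀⁻¹ * k' * (κ * zn * s) =
      k * (hσ⁻¹ * ((k' * κ)⁻¹ * h₀))⁻¹ * (zn * z) * (hσ⁻¹ * s) := by
  simp only [mul_inv_rev, inv_inv, mul_assoc]
  rw [hn s, hz (h₀⁻¹ * _), hz (hσ⁻¹ * s), hn (hσ⁻¹ * s * z)]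
  simp only [mul_assoc, mul_inv_cancel_left]
  rw [hz zn]

theorem heckeFun_mem (f : cInd (kzHom p) (symRep p φ r)) :
    heckeFun p φ r f.1 ∈ cInd (kzHom p) (symRep p φ r) := by
  classical
  constructor
  · rintro ⟨κ, n⟩ g
    obtain ⟨σ, k, h⟩ := exists_hecke_perm' p κ⁻¹
    simp only [heckeFun, map_sum]
    conv_rhs => rw [← Equiv.sum_comp σ]
    refine Finset.sum_congr rfl fun i _ => ?_
    have e1 : (heckeElt p i)⁻¹ * (kzHom p (κ, n) * g) =
        kzHom p ((k i)⁻¹, n) * ((heckeElt p (σ i))⁻¹ * g) := by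
      have e2 : heckeElt p i = inclK p κ * (heckeElt p (σ i) * inclK p (k i)) := by
        rw [← (h i).2, map_inv, mul_inv_cancel_left]
      have e3 : Commute (heckeElt p (σ i))⁻¹ (scalarP p ^ n.toAdd) :=
        (commute_scalarP p _).zpow_right _
      have e4 : Commute (inclK p κ) (scalarP p ^ n.toAdd) :=
        (commute_scalarP p _).zpow_right _
      rw [kzHom_apply, kzHom_apply, e2, map_inv, mul_assoc (inclK p (k i))⁻¹,
        ← mul_assoc (scalarP p ^ _), ← e3.eq]
      group
    rw [e1, f.2.1]
    have e5 : heckeMat p i * (((k i)⁻¹ : GL (Fin 2) ℤ_[p]) : Matrix (Fin 2) (Fin 2) ℤ_[p]) =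
        (κ : Matrix (Fin 2) (Fin 2) ℤ_[p]) * heckeMat p (σ i) := by
      apply (Units.mul_right_inj κ⁻¹).1
      rw [← mul_assoc, (h i).1, ← mul_assoc, mul_assoc, Units.mul_inv, mul_one, Units.inv_mul,
        one_mul]
    rw [symRep_apply, symRep_apply, symAct_symAct, symAct_symAct, e5]
  · obtain ⟨S, hS⟩ := f.2.2
    refine ⟨(Finset.univ ×ˢ S).image fun x => (heckeElt p x.1)⁻¹ * x.2, fun g hg => ?_⟩
    obtain ⟨i, -, hi⟩ := Finset.exists_ne_zero_of_sum_ne_zero hg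
    have hi' : f.1 ((heckeElt p i)⁻¹ * g) ≠ 0 := fun h' => hi (by rw [h', map_zero])
    obtain ⟨⟨κ, n⟩, s, hs, e⟩ := hS _ hi'
    obtain ⟨k, k', hk⟩ := heckeElt_eq p i
    obtain ⟨σ, l, h⟩ := exists_hecke_perm' p (k' * κ)⁻¹
    refine ⟨(k * (l none)⁻¹, Multiplicative.ofAdd (n.toAdd + 1)),
      (heckeElt p (σ none))⁻¹ * s, ?_, ?_⟩
    · exact Finset.mem_image.2 ⟨(σ none, s), by simp [hs], rfl⟩
    · have e1 : g = heckeElt p i * (kzHom p (κ, n) * s) := by rw [← e]; group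
      have e2 : inclK p (l none) = (heckeElt p (σ none))⁻¹ * (inclK p (k' * κ)⁻¹ *
          heckeElt p none) := by
        rw [(h none).2]; group
      rw [e1, hk, kzHom_apply, kzHom_apply, map_mul, map_inv, e2, toAdd_ofAdd, zpow_add, zpow_one,
        map_inv, map_mul]
      exact group_aux _ _ _ _ _ _ _ _ (fun x => (commute_scalarP p x).eq.symm)
        (fun x => ((commute_scalarP p x).zpow_right _).eq.symm)

end Hecke

/-! ### The lattice `Θ` and its reduction -/

section Lattice

variable (p : ℕ) [Fact p.Prime]

/-- The Hecke operator `T` on `ind_{KZ}^G Sym^r R²`. -/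
def heckeT {R : Type*} [CommRing R] (φ : ℤ_[p] →+* R) (r : ℕ) :
    Module.End R (cInd (kzHom p) (symRep p φ r)) where
  toFun f := ⟨heckeFun p φ r f.1, heckeFun_mem p φ r f⟩
  map_add' f g := by ext1; funext x; simp [heckeFun, Finset.sum_add_distrib]
  map_smul' a f := by ext1; funext x; simp [heckeFun, Finset.smul_sum]

theorem heckeT_comm {R : Type*} [CommRing R] (φ : ℤ_[p] →+* R) (r : ℕ) (x : GL (Fin 2) ℚ_[p])
    (f : cInd (kzHom p) (symRep p φ r)) :
    heckeT p φ r (cIndRep _ _ x f) = cIndRep _ _ x (heckeT p φ r f) := by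
  ext1; funext g
  simp [heckeT, heckeFun, cIndRep, mul_assoc]

/-- The submodule `(T - a) ind_{KZ}^G Sym^r R²`. -/
def heckeRange {R : Type*} [CommRing R] (φ : ℤ_[p] →+* R) (r : ℕ) (a : R) :
    Submodule R (cInd (kzHom p) (symRep p φ r)) :=
  LinearMap.range (heckeT p φ r - a • (1 : Module.End R (cInd (kzHom p) (symRep p φ r))))

theorem heckeRange_le {R : Type*} [CommRing R] (φ : ℤ_[p] →+* R) (r : ℕ) (a : R)
    (x : GL (Fin 2) ℚ_[p]) : heckeRange p φ r a ≤ (heckeRange p φ r a).comap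
    (cIndRep (kzHom p) (symRep p φ r) x) := by
  rintro _ ⟨f, rfl⟩
  refine ⟨cIndRep _ _ x f, ?_⟩
  simp [heckeT_comm]

/-- The ring of integers of the algebraic closure of `ℚ_p`. -/
abbrev ZBar : Type := (Valued.v : Valuation (PadicAlgCl p) NNReal).valuationSubring

/-- The residue field of the algebraic closure of `ℚ_p`, an algebraic closure of `𝔽_p`. -/
abbrev FBar : Type := IsLocalRing.ResidueField (ZBar p)

/-- The valuation of a nonzero `a ∈ ℚ̄_p`, normalized by `ν(p) = 1`. -/
def slopeVal (a : PadicAlgCl p) : ℝ := -Real.logb p ‖a‖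

theorem slopeVal_p : slopeVal p (p : PadicAlgCl p) = 1 := by
  have h1 : (1 : ℝ) < p := by exact_mod_cast (Fact.out : p.Prime).one_lt
  have h : ‖(p : PadicAlgCl p)‖ = (p : ℝ)⁻¹ := by
    rw [← map_natCast (algebraMap ℚ_[p] (PadicAlgCl p)), PadicAlgCl.norm_extends, Padic.norm_p]
  rw [slopeVal, h, Real.logb_inv, neg_neg, Real.logb_self_eq_one h1]

/-- The inclusion of `ℤ_p` into the ring of integers of its algebraic closure. -/
def zpToZBar : ℤ_[p] →+* ZBar p :=
  ((algebraMap ℚ_[p] (PadicAlgCl p)).comp PadicInt.Coe.ringHom).codRestrict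
    (Valued.v : Valuation (PadicAlgCl p) NNReal).valuationSubring fun z => by
      rw [Valuation.mem_valuationSubring_iff, PadicAlgCl.valuation_def, ← NNReal.coe_le_coe]
      change ‖(algebraMap ℚ_[p] (PadicAlgCl p)) (z : ℚ_[p])‖ ≤ 1
      rw [PadicAlgCl.norm_extends]
      exact z.2

/-- The structure map `ℤ_p → R` of an algebra over the ring of integers of `ℚ̄_p`. -/
def baseHom (R : Type*) [CommRing R] [Algebra (ZBar p) R] : ℤ_[p] →+* R :=
  (algebraMap (ZBar p) R).comp (zpToZBar p)

/-- `ind_{KZ}^G Sym^r R²`. -/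
abbrev IndSym (R : Type) [CommRing R] [Algebra (ZBar p) R] (r : ℕ) :
    Submodule R (GL (Fin 2) ℚ_[p] → SymPow R r) :=
  cInd (kzHom p) (symRep p (baseHom p R) r)

theorem symMap_equivariant (R : Type) [CommRing R] [Algebra (ZBar p) R] (r : ℕ)
    (h : GL (Fin 2) ℤ_[p] × Multiplicative ℤ) (v : SymPow (ZBar p) r) :
    symMap (ZBar p) R r (symRep p (baseHom p (ZBar p)) r h v) =
      symRep p (baseHom p R) r h (symMap (ZBar p) R r v) := by
  obtain ⟨k, n⟩ := h
  rw [symRep_apply, symRep_apply, symMap_symAct]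
  rfl

/-- Change of coefficients `ind_{KZ}^G Sym^r Z̄_p² → ind_{KZ}^G Sym^r R²`. -/
def indSymMap (R : Type) [CommRing R] [Algebra (ZBar p) R] (r : ℕ) :
    IndSym p (ZBar p) r →ₗ[ZBar p] IndSym p R r :=
  cIndMap (kzHom p) _ _ (symMap (ZBar p) R r) (symMap_equivariant p R r)

variable (r : ℕ) (a : PadicAlgCl p)

/-- `Π_{r+2, a} = ind_{KZ}^G Sym^r ℚ̄_p² / (T - a)`. -/
abbrev PiMod : Type := IndSym p (PadicAlgCl p) r ⧸
  heckeRange p (baseHom p (PadicAlgCl p)) r a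

/-- The action of `G` on `Π_{r+2, a}`. -/
def piRep : Representation (PadicAlgCl p) (GL (Fin 2) ℚ_[p]) (PiMod p r a) :=
  (cIndRep (kzHom p) (symRep p (baseHom p (PadicAlgCl p)) r)).quotient _
    (heckeRange_le p (baseHom p (PadicAlgCl p)) r a)

/-- The natural map `ind_{KZ}^G Sym^r Z̄_p² → Π_{r+2, a}`. -/
def toPi : IndSym p (ZBar p) r →ₗ[ZBar p] PiMod p r a :=
  ((heckeRange p (baseHom p (PadicAlgCl p)) r a).mkQ.restrictScalars (ZBar p)) ∘ₗ indSymMap p (PadicAlgCl p) r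

theorem toPi_equivariant (x : GL (Fin 2) ℚ_[p]) (f : IndSym p (ZBar p) r) :
    toPi p r a (cIndRep _ _ x f) = piRep p r a x (toPi p r a f) := rfl

/-- `Θ_{r+2, a}`, the image of `ind_{KZ}^G Sym^r Z̄_p²` in `Π_{r+2, a}`. -/
def Theta : Submodule (ZBar p) (PiMod p r a) := LinearMap.range (toPi p r a)

/-- The natural surjection `ind_{KZ}^G Sym^r Z̄_p² → Θ_{r+2, a}`. -/
def toTheta : IndSym p (ZBar p) r →ₗ[ZBar p] Theta p r a :=
  (toPi p r a).codRestrict (Theta p r a) fun f => ⟨f, rfl⟩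

/-- The action of `G` on `Θ_{r+2, a}`. -/
def thetaRep : Representation (ZBar p) (GL (Fin 2) ℚ_[p]) (Theta p r a) where
  toFun x := ((piRep p r a x).restrictScalars (ZBar p)).restrict <| by
    rintro _ ⟨f, rfl⟩
    exact ⟨cIndRep _ _ x f, toPi_equivariant p r a x f⟩
  map_one' := by
    ext f
    simp
  map_mul' x y := by
    ext f
    simp

/-- `Θ̄_{r+2, a} = Θ_{r+2, a} ⊗ F̄_p`. -/
abbrev ThetaBar : Type := FBar p ⊗[ZBar p] Theta p r a

/-- The action of `G` on `Θ̄_{r+2, a}`. -/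
def thetaBarRep : Representation (FBar p) (GL (Fin 2) ℚ_[p]) (ThetaBar p r a) where
  toFun x := (thetaRep p r a x).baseChange (FBar p)
  map_one' := by
    rw [map_one]; exact LinearMap.baseChange_id
  map_mul' x y := by
    rw [map_mul]; exact LinearMap.baseChange_comp _ _

/-- The class in `Θ̄_{r+2, a}` of an element of `ind_{KZ}^G Sym^r Z̄_p²`. -/
def toThetaBar : IndSym p (ZBar p) r →ₗ[ZBar p] ThetaBar p r a :=
  (TensorProduct.mk (ZBar p) (FBar p) (Theta p r a) 1) ∘ₗ toTheta p r a

theorem indSymMap_surjective : Function.Surjective (indSymMap p (FBar p) r) :=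
  cIndMap_surjective _ (kzHom_injective p) _ _ _ _
    (symMap_surjective r IsLocalRing.residue_surjective)

theorem exists_common_divisor {A : Type*} [CommRing A] [IsDomain A] [ValuationRing A]
    (S : Finset A) (hS : ∀ x ∈ S, x ∈ IsLocalRing.maximalIdeal A) :
    ∃ w ∈ IsLocalRing.maximalIdeal A, ∀ x ∈ S, w ∣ x := by
  classical
  induction S using Finset.induction_on with
  | empty => exact ⟨0, zero_mem _, by simp⟩
  | insert x S _ ih =>
    obtain ⟨w, hw, h⟩ := ih fun y hy => hS y (Finset.mem_insert_of_mem hy)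
    rcases ValuationRing.dvd_total w x with h1 | h1
    · refine ⟨w, hw, fun y hy => ?_⟩
      rcases Finset.mem_insert.1 hy with rfl | hy
      · exact h1
      · exact h y hy
    · refine ⟨x, hS x (Finset.mem_insert_self _ _), fun y hy => ?_⟩
      rcases Finset.mem_insert.1 hy with rfl | hy
      · exact dvd_rfl
      · exact h1.trans (h y hy)

theorem exists_smul_of_indSymMap_eq_zero (f : IndSym p (ZBar p) r)
    (hf : indSymMap p (FBar p) r f = 0) :
    ∃ w ∈ IsLocalRing.maximalIdeal (ZBar p), ∃ f' : IndSym p (ZBar p) r, f = w • f' := by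
  classical
  obtain ⟨S, hS⟩ := f.2.2
  have hmem : ∀ g d, MvPolynomial.coeff d (f.1 g).poly ∈ IsLocalRing.maximalIdeal (ZBar p) := by
    intro g d
    have h1 : symMap (ZBar p) (FBar p) r (f.1 g) = 0 := congrFun (congrArg Subtype.val hf) g
    have h2 := congrArg (fun q => MvPolynomial.coeff d q.poly) h1
    rw [← Ideal.Quotient.eq_zero_iff_mem]
    exact (MvPolynomial.coeff_map _ _ _).symm.trans h2
  obtain ⟨w, hw, hdvd⟩ := exists_common_divisor
    (S.biUnion fun s => (f.1 s).poly.support.image fun d => MvPolynomial.coeff d (f.1 s).poly) (by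
      intro x hx
      simp only [Finset.mem_biUnion, Finset.mem_image] at hx
      obtain ⟨s, -, d, -, rfl⟩ := hx
      exact hmem s d)
  refine ⟨w, hw, ?_⟩
  have hs : ∀ s ∈ S, ∃ v : SymPow (ZBar p) r, f.1 s = w • v := by
    intro s hs
    have h1 : MvPolynomial.C w ∣ (f.1 s).poly := by
      rw [MvPolynomial.C_dvd_iff_dvd_coeff]
      intro d
      by_cases hd : MvPolynomial.coeff d (f.1 s).poly = 0
      · rw [hd]; exact dvd_zero _
      · exact hdvd _ (Finset.mem_biUnion.2 ⟨s, hs, Finset.mem_image_of_mem _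
          (MvPolynomial.mem_support_iff.2 hd)⟩)
    obtain ⟨q, hq⟩ := h1
    refine ⟨SymPow.mk (MvPolynomial.homogeneousComponent r q)
      (MvPolynomial.homogeneousComponent_isHomogeneous r q), ?_⟩
    ext1
    have h2 := congrArg (MvPolynomial.homogeneousComponent r) hq
    rw [MvPolynomial.homogeneousComponent_of_mem (f.1 s).isHomogeneous, if_pos rfl,
      MvPolynomial.homogeneousComponent_C_mul] at h2
    rw [h2, ← MvPolynomial.smul_eq_C_mul]
    rfl
  have hg : ∀ g, ∃ v : SymPow (ZBar p) r, f.1 g = w • v := by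
    intro g
    by_cases h0 : f.1 g = 0
    · exact ⟨0, by rw [h0, smul_zero]⟩
    · obtain ⟨h, s, hs', rfl⟩ := hS g h0
      obtain ⟨v, hv⟩ := hs s hs'
      exact ⟨symRep p (baseHom p (ZBar p)) r h v, by rw [f.2.1, hv, map_smul]⟩
  by_cases hw0 : w = 0
  · refine ⟨0, ?_⟩
    ext1
    funext g
    obtain ⟨v, hv⟩ := hg g
    rw [hv, hw0, zero_smul, smul_zero]
    rfl
  · choose v hv using hg
    have hcancel : ∀ v₁ v₂ : SymPow (ZBar p) r, w • v₁ = w • v₂ → v₁ = v₂ := fun v₁ v₂ h => by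
      ext1
      have h1 := congrArg SymPow.poly h
      simp only [SymPow.poly_smul, MvPolynomial.smul_eq_C_mul] at h1
      exact mul_left_cancel₀ (MvPolynomial.C_ne_zero.2 hw0) h1
    refine ⟨⟨v, fun h g => hcancel _ _ ?_, S, fun g hg' => hS g fun h0 => hg' ?_⟩, ?_⟩
    · rw [← hv, f.2.1, hv g, map_smul]
    · apply hcancel
      rw [← hv, h0, smul_zero]
    · ext1
      funext g
      exact hv g

theorem toThetaBar_eq_zero (f : IndSym p (ZBar p) r) (hf : indSymMap p (FBar p) r f = 0) :
    toThetaBar p r a f = 0 := by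
  obtain ⟨w, hw, f', rfl⟩ := exists_smul_of_indSymMap_eq_zero p r f hf
  rw [map_smul]
  change w • ((1 : FBar p) ⊗ₜ[ZBar p] toTheta p r a f') = 0
  have h0 : w • (1 : FBar p) = 0 := by
    rw [Algebra.smul_def, mul_one]
    exact Ideal.Quotient.eq_zero_iff_mem.2 hw
  rw [TensorProduct.smul_tmul', h0, TensorProduct.zero_tmul]

theorem toThetaBar_congr (f₁ f₂ : IndSym p (ZBar p) r)
    (h : indSymMap p (FBar p) r f₁ = indSymMap p (FBar p) r f₂) :
    toThetaBar p r a f₁ = toThetaBar p r a f₂ := by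
  rw [← sub_eq_zero, ← map_sub]
  exact toThetaBar_eq_zero p r a _ (by rw [map_sub, h, sub_self])

/-- The natural surjection `P : ind_{KZ}^G V_r → Θ̄_{r+2, a}`, where `V_r = Sym^r F̄_p²`: the class
of `f` is the class of any lift of `f` to `ind_{KZ}^G Sym^r Z̄_p²` (see `natP_indSymMap`). -/
def natP : IndSym p (FBar p) r →ₗ[FBar p] ThetaBar p r a where
  toFun f := toThetaBar p r a (Function.surjInv (indSymMap_surjective p r) f)
  map_add' f g := by
    rw [← map_add]
    apply toThetaBar_congr
    rw [map_add]
    simp only [Function.surjInv_eq]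
  map_smul' c f := by
    obtain ⟨c, rfl⟩ := IsLocalRing.residue_surjective c
    have h1 : ∀ x : ThetaBar p r a, IsLocalRing.residue (ZBar p) c • x = c • x := fun x =>
      algebraMap_smul (FBar p) c x
    rw [RingHom.id_apply, h1, ← map_smul]
    apply toThetaBar_congr
    rw [map_smul]
    simp only [Function.surjInv_eq]
    exact algebraMap_smul (FBar p) c f

theorem natP_indSymMap (f : IndSym p (ZBar p) r) :
    natP p r a (indSymMap p (FBar p) r f) = toThetaBar p r a f :=
  toThetaBar_congr p r a _ _ (Function.surjInv_eq _ _)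

theorem natP_surjective : Function.Surjective (natP p r a) := by
  intro y
  induction y using TensorProduct.induction_on with
  | zero => exact ⟨0, map_zero _⟩
  | add x y hx hy =>
    obtain ⟨f, rfl⟩ := hx
    obtain ⟨g, rfl⟩ := hy
    exact ⟨f + g, map_add _ _ _⟩
  | tmul c x =>
    obtain ⟨_, f, rfl⟩ := x
    refine ⟨c • indSymMap p (FBar p) r f, ?_⟩
    rw [map_smul, natP_indSymMap]
    change c • ((1 : FBar p) ⊗ₜ[ZBar p] toTheta p r a f) = c ⊗ₜ[ZBar p] toTheta p r a f
    rw [TensorProduct.smul_tmul', smul_eq_mul, mul_one]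

end Lattice

/-! ### The filtration by powers of the Dickson polynomial -/

section Filtration

variable (p : ℕ) [Fact p.Prime] {k : Type*} [CommRing k] [CharP k p] (φ : ℤ_[p] →+* k) (r m : ℕ)

/-- The Dickson polynomial `θ = x^p y - x y^p`. -/
def dickson (p : ℕ) (k : Type*) [CommRing k] : MvPolynomial (Fin 2) k :=
  MvPolynomial.X 0 ^ p * MvPolynomial.X 1 - MvPolynomial.X 0 * MvPolynomial.X 1 ^ p

/-- `V_r^{(m)}`, the polynomials in `V_r = Sym^r k²` which are divisible by `θ^m`. -/
def filtV (p : ℕ) (k : Type*) [CommRing k] (r m : ℕ) : Submodule k (SymPow k r) where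
  carrier := {f | dickson p k ^ m ∣ f.poly}
  zero_mem' := dvd_zero _
  add_mem' hf hg := by
    rw [Set.mem_ofPred_eq, map_add]
    exact dvd_add hf hg
  smul_mem' c f hf := by
    rw [Set.mem_ofPred_eq, SymPow.poly_smul, MvPolynomial.smul_eq_C_mul]
    exact Dvd.dvd.mul_left hf _

theorem padicInt_hom_pow (z : ℤ_[p]) : φ z ^ p = φ z := by
  have h : PadicInt.toZMod (z ^ p - z) = 0 := by
    rw [map_sub, map_pow, ZMod.pow_card, sub_self]
  obtain ⟨w, hw⟩ := (toZMod_eq_zero_iff p _).1 h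
  rw [← map_pow, ← sub_eq_zero, ← map_sub, hw, map_mul, map_natCast, CharP.cast_eq_zero, zero_mul]

theorem polyAct_dickson (M : Matrix (Fin 2) (Fin 2) ℤ_[p]) :
    polyAct (M.map φ) (dickson p k) = MvPolynomial.C (φ M.det) * dickson p k := by
  have hF : ∀ z, MvPolynomial.C (σ := Fin 2) (φ z) ^ p = MvPolynomial.C (φ z) := fun z => by
    rw [← map_pow, padicInt_hom_pow]
  have e : M.map φ = !![φ (M 0 0), φ (M 0 1); φ (M 1 0), φ (M 1 1)] := by
    rw [Matrix.eta_fin_two (M.map φ)]; rfl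
  rw [e, dickson, map_sub, map_mul, map_mul, map_pow, map_pow, polyAct_X0, polyAct_X1,
    add_pow_char, add_pow_char, mul_pow, mul_pow, mul_pow, mul_pow, hF, hF, hF, hF,
    Matrix.det_fin_two, map_sub, map_mul, map_mul, map_sub, map_mul, map_mul]
  ring

theorem filtV_le (h : GL (Fin 2) ℤ_[p] × Multiplicative ℤ) :
    filtV p k r m ≤ (filtV p k r m).comap (symRep p φ r h) := by
  obtain ⟨κ, n⟩ := h
  intro f hf
  change dickson p k ^ m ∣ polyAct _ f.poly
  have h1 := map_dvd (polyAct ((κ : Matrix (Fin 2) (Fin 2) ℤ_[p]).map φ)) hf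
  rw [map_pow, polyAct_dickson, mul_pow] at h1
  exact (Dvd.intro_left _ rfl).trans h1

/-- The representation `V_r^{(m)}` of `KZ`. -/
def filtRep : Representation k (GL (Fin 2) ℤ_[p] × Multiplicative ℤ) (filtV p k r m) :=
  (symRep p φ r).subrepresentation (filtV p k r m) (filtV_le p φ r m)

/-- `V_r^{(m+1)}` as a submodule of `V_r^{(m)}`. -/
def filtSub (p : ℕ) (k : Type*) [CommRing k] (r m : ℕ) : Submodule k (filtV p k r m) :=
  (filtV p k r (m + 1)).submoduleOf (filtV p k r m)

theorem filtSub_le (h : GL (Fin 2) ℤ_[p] × Multiplicative ℤ) :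
    filtSub p k r m ≤ (filtSub p k r m).comap (filtRep p φ r m h) :=
  fun _ hf => filtV_le p φ r (m + 1) h hf

/-- The representation `V_r^{(m)} / V_r^{(m+1)}` of `KZ`. -/
def grRep : Representation k (GL (Fin 2) ℤ_[p] × Multiplicative ℤ)
    (filtV p k r m ⧸ filtSub p k r m) :=
  (filtRep p φ r m).quotient (filtSub p k r m) (filtSub_le p φ r m)

/-- The inclusion `ind_{KZ}^G V_r^{(m)} → ind_{KZ}^G V_r`. -/
def indIncl : cInd (kzHom p) (filtRep p φ r m) →ₗ[k] cInd (kzHom p) (symRep p φ r) :=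
  cIndMap (kzHom p) _ _ (filtV p k r m).subtype fun _ _ => rfl

/-- The projection `ind_{KZ}^G V_r^{(m)} → ind_{KZ}^G (V_r^{(m)} / V_r^{(m+1)})`. -/
def indProj : cInd (kzHom p) (filtRep p φ r m) →ₗ[k] cInd (kzHom p) (grRep p φ r m) :=
  cIndMap (kzHom p) _ _ (filtSub p k r m).mkQ fun _ _ => rfl

end Filtration

instance charP_FBar (p : ℕ) [Fact p.Prime] : CharP (FBar p) p := by
  refine (CharP.charP_iff_prime_eq_zero (Fact.out : p.Prime)).2 ?_
  have h : ¬ IsUnit ((p : ZBar p)) := by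
    intro hu
    have h1 := (Valuation.Integers.isUnit_iff_valuation_eq_one
      (Valuation.integer.integers (Valued.v : Valuation (PadicAlgCl p) NNReal))).1 hu
    have h2 : (Valued.v : Valuation (PadicAlgCl p) NNReal) (p : PadicAlgCl p) = 1 := h1
    rw [PadicAlgCl.valuation_p, one_div, inv_eq_one, Nat.cast_eq_one] at h2
    exact (Fact.out : p.Prime).one_lt.ne' h2
  rw [← map_natCast (IsLocalRing.residue (ZBar p)), IsLocalRing.residue_eq_zero_iff]
  exact (IsLocalRing.mem_maximalIdeal _).2 h

/-- The statement that the natural surjection `P : ind_{KZ}^G V_r → Θ̄_{r+2, a}` factors through the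
subquotient `ind_{KZ}^G (V_r^{(n)} / V_r^{(n+1)})` of its source: the restriction of `P` to
`ind_{KZ}^G V_r^{(n)}` induces a surjective homomorphism of representations of `G` from
`ind_{KZ}^G (V_r^{(n)} / V_r^{(n+1)})` to `Θ̄_{r+2, a}`. -/
def FactorsThrough (p : ℕ) [Fact p.Prime] (r : ℕ) (a : PadicAlgCl p) (n : ℕ) : Prop :=
  ∃ Q : cInd (kzHom p) (grRep p (baseHom p (FBar p)) r n) →ₗ[FBar p] ThetaBar p r a,
    Function.Surjective Q ∧
    (∀ (g : GL (Fin 2) ℚ_[p]) (f), Q (cIndRep _ _ g f) = thetaBarRep p r a g (Q f)) ∧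
    ∀ f, Q (indProj p _ r n f) = natP p r a (indIncl p _ r n f)

/-- The integer `ε ∈ {0, 1, 2}` attached to `b` and `c`: it is `0` if `2c - 1 ≤ b`, it is `1` if
`2(c - 1) - p ≤ b ≤ 2(c - 1)`, and it is `2` if `b ≤ 2(c - 1) - (p + 1)`. -/
def epsBC (p b c : ℕ) : ℕ :=
  if 2 * (c : ℤ) - 1 ≤ b then 0 else if 2 * ((c : ℤ) - 1) - p ≤ b then 1 else 2

end

/-! Write v for the valuation of `a`. Since P is equivariant, everything is decided by the
subrepresentation `killed` of vectors w of V_r with P[1, w] = 0: by `factorsThrough_of_killed` it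
suffices that V_r^(n+1) is contained in `killed` and that `killed` + V_r^(n) = V_r. Vectors are
shown to be killed by computing over Q̄_p modulo `negl`, the sum of the range of T - a and of the
functions with coefficients of norm < 1.

The nonzero values of T[1, q] are the M q for certain integral matrices M with p | det M. Modulo p
such a matrix has rank at most one, so it sends x and y to F_p-multiples of one linear form. This
has three consequences. (1) M θ^m is divisible by p^m, so V_r^(m) is killed for m > v. (2) The form
E = `unitForm` is 1 on P¹(F_p). Multiplication by E^(p^(t-1) d) therefore carries x^i y^(s-i) to x^i
y^(r-i) up to a negligible error, and integral relations in the small degree s can be used in degree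
r. (3) For δ = x^i y^n (y^(p-1) - x^(p-1))^(i+M), T[1, c δ] is, up to a small function, the
translate by α of [1, c p^i x^i y^(r-i)]; hence that translate is equivalent to [1, a c δ].

The input in degree s is membership in `monoSpan`. If p q lies in `monoSpan p s C` with C < v, then
E^(p^(t-1) d) q is killed (`unitForm_mul_mem_killed`). With q = θ^m y^(k+1) (y^(p-1) - x^(p-1)) this
generates V_r^(m) modulo V_r^(m+1), because the cofactor of θ^m vanishes at all points of P¹(F_p)
but one (`filtV_le_sup`). There is room for such q for all m < n when (p + 1) n ≤ s + 1, and ε is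
the least nonnegative integer for which n = c - ε satisfies this. For n < m ≤ v, (2) and (3) show
that δ itself is killed (`deltaForm_mem_killed`), and δ is ± θ^m times another generator; this needs
p x^m y^(s-m) in `monoSpan p s (m - 1)`. For m > c that follows from the statement for C = c, and
the values c - ε < m ≤ c are treated separately.

Membership in `monoSpan` comes from averaging translates of x^i y^(s-i) over Teichmüller
representatives. The average isolates one class of exponents modulo p - 1. Combinations over i
multiply its coefficients by any chosen product of factors J - e, which removes the unwanted
exponents in the middle; those near the ends belong to `monoSpan` already. How many can be removed
depends on the divisibility of binomial coefficients by p, which is read off from base-p digits. -/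

noncomputable section

/-! ### Functions supported on one coset -/

section Single

variable {R G H V : Type*} [CommRing R] [Group G] [Group H] [AddCommGroup V] [Module R V]

open Classical in
/-- The function supported on `φ(H)` with value `ρ(h) v` at `φ(h)`. -/
def cSingleFun (φ : H →* G) (ρ : Representation R H V) (v : V) (g : G) : V :=
  if hg : ∃ h, φ h = g then ρ hg.choose v else 0

theorem cSingleFun_map (φ : H →* G) (hφ : Function.Injective φ) (ρ : Representation R H V) (v : V)
    (h : H) : cSingleFun φ ρ v (φ h) = ρ h v := by
  have hg : ∃ k, φ k = φ h := ⟨h, rfl⟩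
  rw [cSingleFun, dif_pos hg, hφ hg.choose_spec]

theorem cSingleFun_of_not_mem (φ : H →* G) (ρ : Representation R H V) (v : V) (g : G)
    (hg : ¬ ∃ h, φ h = g) : cSingleFun φ ρ v g = 0 :=
  dif_neg hg

/-- The element `[1, v]` of the compact induction: the function supported on `φ(H)` with value `v`
at `1`. -/
def cSingle (φ : H →* G) (hφ : Function.Injective φ) (ρ : Representation R H V) :
    V →ₗ[R] cInd φ ρ where
  toFun v := ⟨cSingleFun φ ρ v, fun h g => by
    by_cases hg : ∃ k, φ k = g
    · obtain ⟨k, rfl⟩ := hg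
      rw [← map_mul, cSingleFun_map φ hφ, cSingleFun_map φ hφ, map_mul]; rfl
    · have hg' : ¬ ∃ k, φ k = φ h * g := fun ⟨k, hk⟩ =>
        hg ⟨h⁻¹ * k, by rw [map_mul, hk, map_inv]; group⟩
      rw [cSingleFun_of_not_mem _ _ _ _ hg, cSingleFun_of_not_mem _ _ _ _ hg', map_zero],
    {1}, fun g hg => by
      by_contra hn
      refine hg (dif_neg fun ⟨h, hh⟩ => hn ⟨h, 1, by simp, by rw [hh, mul_one]⟩)⟩
  map_add' v w := by
    ext g
    by_cases hg : ∃ h, φ h = g <;> simp [cSingleFun, hg]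
  map_smul' a v := by
    ext g
    by_cases hg : ∃ h, φ h = g <;> simp [cSingleFun, hg]

variable (φ : H →* G) (hφ : Function.Injective φ) (ρ : Representation R H V)

theorem cSingle_apply_map (v : V) (h : H) : (cSingle φ hφ ρ v).1 (φ h) = ρ h v :=
  cSingleFun_map φ hφ ρ v h

theorem cSingle_apply_of_not_mem (v : V) (g : G) (hg : ¬ ∃ h, φ h = g) :
    (cSingle φ hφ ρ v).1 g = 0 :=
  cSingleFun_of_not_mem φ ρ v g hg

theorem cSingle_rep (h : H) (v : V) :
    cSingle φ hφ ρ (ρ h v) = cIndRep φ ρ (φ h) (cSingle φ hφ ρ v) := by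
  ext g
  change _ = (cSingle φ hφ ρ v).1 (g * φ h)
  by_cases hg : ∃ k, φ k = g
  · obtain ⟨k, rfl⟩ := hg
    rw [← map_mul, cSingle_apply_map, cSingle_apply_map, map_mul]; rfl
  · rw [cSingle_apply_of_not_mem _ _ _ _ _ hg, cSingle_apply_of_not_mem]
    rintro ⟨k, hk⟩
    exact hg ⟨k * h⁻¹, by rw [map_mul, hk, map_inv]; group⟩

theorem cIndMap_cSingle {S W : Type*} [CommRing S] [Algebra R S] [AddCommGroup W] [Module S W]
    [Module R W] [IsScalarTower R S W] (τ : Representation S H W)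
    (u : V →ₗ[R] W) (hu : ∀ h v, u (ρ h v) = τ h (u v)) (v : V) :
    cIndMap φ ρ τ u hu (cSingle φ hφ ρ v) = cSingle φ hφ τ (u v) := by
  ext g
  change u ((cSingle φ hφ ρ v).1 g) = _
  by_cases hg : ∃ k, φ k = g
  · obtain ⟨k, rfl⟩ := hg
    rw [cSingle_apply_map, cSingle_apply_map, hu]
  · rw [cSingle_apply_of_not_mem _ _ _ _ _ hg, cSingle_apply_of_not_mem _ _ _ _ _ hg, map_zero]

/-- A compactly induced function is a finite sum of translates of functions supported on one
coset. -/
theorem cInd_induction {W : Submodule R V} {P : cInd φ ρ → Prop} (h0 : P 0)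
    (hadd : ∀ f₁ f₂, P f₁ → P f₂ → P (f₁ + f₂))
    (hs : ∀ g, ∀ v ∈ W, P (cIndRep φ ρ g (cSingle φ hφ ρ v)))
    (f : cInd φ ρ) (hf : ∀ g, f.1 g ∈ W) : P f := by
  classical
  obtain ⟨S, hS⟩ := f.2.2
  induction S using Finset.induction_on generalizing f with
  | empty =>
    have : f = 0 := by
      ext g
      by_contra hg
      obtain ⟨_, _, h, _⟩ := hS g hg
      simp at h
    rw [this]; exact h0
  | insert s S _ ih =>
    -- `e` agrees with `f` on the coset of `s` and vanishes elsewhere, so `f - e` is supported on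
    -- the cosets of `S`; its values are values of `f` or zero, hence stay in `W`.
    set e := cIndRep φ ρ s⁻¹ (cSingle φ hφ ρ (f.1 s)) with he
    have e1 : ∀ h, e.1 (φ h * s) = f.1 (φ h * s) := fun h => by
      change (cSingle φ hφ ρ (f.1 s)).1 (φ h * s * s⁻¹) = _
      rw [mul_inv_cancel_right, cSingle_apply_map, f.2.1]
    have e2 : ∀ g, (¬ ∃ h, g = φ h * s) → e.1 g = 0 := fun g hg => by
      change (cSingle φ hφ ρ (f.1 s)).1 (g * s⁻¹) = _
      rw [cSingle_apply_of_not_mem]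
      rintro ⟨h, hh⟩
      exact hg ⟨h, by rw [hh]; group⟩
    have h1 : P (f - e) := by
      refine ih _ (fun g => ?_) fun g hg => ?_
      · change f.1 g - e.1 g ∈ W
        refine W.sub_mem (hf g) ?_
        by_cases hg : ∃ h, g = φ h * s
        · obtain ⟨h, rfl⟩ := hg
          rw [e1]; exact hf _
        · rw [e2 g hg]; exact W.zero_mem
      · change f.1 g - e.1 g ≠ 0 at hg
        have hg' : ¬ ∃ h, g = φ h * s := by
          rintro ⟨h, rfl⟩
          exact hg (by rw [e1, sub_self])
        rw [e2 g hg', sub_zero] at hg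
        obtain ⟨h, s', hs', e'⟩ := hS g hg
        rcases Finset.mem_insert.1 hs' with rfl | hs'
        · exact absurd ⟨h, e'⟩ hg'
        · exact ⟨h, s', hs', e'⟩
    rw [← sub_add_cancel f e]
    exact hadd _ _ h1 (hs _ _ (hf s))

end Single

/-! ### Factorization of `P` -/

section Factor

variable (p : ℕ) [Fact p.Prime] (r : ℕ) (a : PadicAlgCl p)

theorem natP_equivariant (g : GL (Fin 2) ℚ_[p]) (f : IndSym p (FBar p) r) :
    natP p r a (cIndRep _ _ g f) = thetaBarRep p r a g (natP p r a f) := by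
  obtain ⟨f, rfl⟩ := indSymMap_surjective p r f
  have h : cIndRep _ _ g (indSymMap p (FBar p) r f) = indSymMap p (FBar p) r (cIndRep _ _ g f) := rfl
  rw [h, natP_indSymMap, natP_indSymMap]
  rfl

/-- The vectors `v` of `V_r` such that `P` kills `[1, v]`. -/
def killed : Submodule (FBar p) (SymPow (FBar p) r) :=
  LinearMap.ker (natP p r a ∘ₗ cSingle (kzHom p) (kzHom_injective p) (symRep p (baseHom p (FBar p)) r))

/-- [1, h v] is the translate of [1, v] by h. Thus `killed` is stable under KZ, and a single form in
it can generate a whole graded piece. -/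
theorem symRep_mem_killed (h : GL (Fin 2) ℤ_[p] × Multiplicative ℤ) {v : SymPow (FBar p) r}
    (hv : v ∈ killed p r a) : symRep p (baseHom p (FBar p)) r h v ∈ killed p r a := by
  have hv' : natP p r a (cSingle (kzHom p) (kzHom_injective p) _ v) = 0 := hv
  change natP p r a (cSingle (kzHom p) (kzHom_injective p) _ _) = 0
  rw [cSingle_rep, natP_equivariant, hv', map_zero]

theorem exists_comp_eq_of_surjective {k A B C : Type*} [CommRing k] [AddCommGroup A] [Module k A]
    [AddCommGroup B] [Module k B] [AddCommGroup C] [Module k C] (π : A →ₗ[k] B)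
    (hπ : Function.Surjective π) (u : A →ₗ[k] C) (h : ∀ x, π x = 0 → u x = 0) :
    ∃ Q : B →ₗ[k] C, ∀ x, Q (π x) = u x := by
  have h' : LinearMap.ker π ≤ LinearMap.ker u := fun x hx => h x hx
  refine ⟨(Submodule.liftQ (LinearMap.ker π) u h') ∘ₗ
    (π.quotKerEquivOfSurjective hπ).symm.toLinearMap, fun x => ?_⟩
  have : (π.quotKerEquivOfSurjective hπ).symm (π x) = Submodule.Quotient.mk x := by
    rw [LinearEquiv.symm_apply_eq]; rfl
  rw [LinearMap.comp_apply, LinearEquiv.coe_coe, this, Submodule.liftQ_apply]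

theorem indIncl_cSingle (n : ℕ) (w : filtV p (FBar p) r n) :
    indIncl p (baseHom p (FBar p)) r n (cSingle (kzHom p) (kzHom_injective p) _ w) =
      cSingle (kzHom p) (kzHom_injective p) _ w.1 :=
  cIndMap_cSingle (kzHom p) (kzHom_injective p) _ _ _ _ w

/-- By `cInd_induction` both hypotheses need only be used on translates of functions [1, v]. The
first makes P vanish on the kernel of the projection to the graded piece, whose elements take values
in V_r^(n+1). The second lets v be replaced by a vector of V_r^(n) with the same image, which gives
surjectivity. -/
theorem factorsThrough_of_killed (n : ℕ) (h1 : filtV p (FBar p) r (n + 1) ≤ killed p r a)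
    (h2 : killed p r a ⊔ filtV p (FBar p) r n = ⊤) : FactorsThrough p r a n := by
  have hsurj : Function.Surjective (indProj p (baseHom p (FBar p)) r n) :=
    cIndMap_surjective _ (kzHom_injective p) _ _ _ _ (Submodule.mkQ_surjective _)
  have hker : ∀ f, indProj p (baseHom p (FBar p)) r n f = 0 →
      natP p r a (indIncl p _ r n f) = 0 := fun f hf => by
    refine cInd_induction (kzHom p) (kzHom_injective p) _ (W := filtV p (FBar p) r (n + 1))
      (P := fun f => natP p r a f = 0) (map_zero _)
      (fun f₁ f₂ h₁ h₂ => by rw [map_add, h₁, h₂, add_zero]) (fun g v hv => ?_) _ fun g => ?_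
    · rw [natP_equivariant]
      have : natP p r a (cSingle (kzHom p) (kzHom_injective p) _ v) = 0 := h1 hv
      rw [this, map_zero]
    · have h3 : (filtSub p (FBar p) r n).mkQ (f.1 g) = 0 := congrFun (congrArg Subtype.val hf) g
      rw [Submodule.mkQ_apply, Submodule.Quotient.mk_eq_zero] at h3
      exact h3
  have hrange : ∀ f, ∃ f', natP p r a (indIncl p _ r n f') = natP p r a f := fun f => by
    refine cInd_induction (kzHom p) (kzHom_injective p) _ (W := ⊤)
      (P := fun f => ∃ f', natP p r a (indIncl p _ r n f') = natP p r a f)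
      ⟨0, by rw [map_zero]⟩
      ?_ (fun g v _ => ?_) f fun g => Submodule.mem_top
    · rintro f₁ f₂ ⟨f₁', h₁⟩ ⟨f₂', h₂⟩
      exact ⟨f₁' + f₂', by rw [map_add, map_add, map_add, h₁, h₂]⟩
    · obtain ⟨x, hx, w, hw, rfl⟩ : ∃ x ∈ killed p r a, ∃ w ∈ filtV p (FBar p) r n, x + w = v :=
        Submodule.mem_sup.1 (by rw [h2]; exact Submodule.mem_top)
      have hx' : natP p r a (cSingle (kzHom p) (kzHom_injective p) _ x) = 0 := hx
      refine ⟨cIndRep _ _ g (cSingle (kzHom p) (kzHom_injective p) (filtRep p _ r n) ⟨w, hw⟩), ?_⟩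
      have h3 : indIncl p _ r n (cIndRep _ _ g
          (cSingle (kzHom p) (kzHom_injective p) (filtRep p (baseHom p (FBar p)) r n) ⟨w, hw⟩)) =
          cIndRep _ _ g (indIncl p _ r n
          (cSingle (kzHom p) (kzHom_injective p) (filtRep p _ r n) ⟨w, hw⟩)) := rfl
      rw [h3, indIncl_cSingle, map_add, map_add, map_add, natP_equivariant p r a g (cSingle _ _ _ x),
        hx', map_zero, zero_add]
  obtain ⟨Q, hQ⟩ := exists_comp_eq_of_surjective _ hsurj (natP p r a ∘ₗ indIncl p _ r n) hker
  replace hQ : ∀ f, Q (indProj p _ r n f) = natP p r a (indIncl p _ r n f) := hQ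
  refine ⟨Q, fun y => ?_, fun g f => ?_, hQ⟩
  · obtain ⟨f, rfl⟩ := natP_surjective p r a y
    obtain ⟨f', hf'⟩ := hrange f
    exact ⟨indProj p _ r n f', by rw [hQ, hf']⟩
  · obtain ⟨f, rfl⟩ := hsurj f
    have h4 : indIncl p _ r n (cIndRep _ _ g f) = cIndRep _ _ g (indIncl p _ r n f) := rfl
    have h3 : cIndRep _ _ g (indProj p (baseHom p (FBar p)) r n f) =
      indProj p _ r n (cIndRep _ _ g f) := rfl
    exact (congrArg Q h3).trans ((hQ _).trans ((congrArg (natP p r a) h4).trans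
      ((natP_equivariant p r a g _).trans (congrArg (thetaBarRep p r a g) (hQ f).symm))))

end Factor

/-! ### Reductions of integral polynomials -/

section SymLift

variable (p : ℕ) [Fact p.Prime] {R : Type*} [CommRing R] (φ : ℤ_[p] →+* R) (r : ℕ)

/-- The class in `Sym^r R²` of a polynomial with coefficients in `ℤ_p`. -/
def symLift : MvPolynomial (Fin 2) ℤ_[p] →+ SymPow R r where
  toFun q := SymPow.mk (MvPolynomial.homogeneousComponent r (MvPolynomial.map φ q))
    (MvPolynomial.homogeneousComponent_isHomogeneous r _)
  map_zero' := by ext1; simp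
  map_add' q₁ q₂ := by ext1; simp

variable {p r}

theorem poly_symLift {q : MvPolynomial (Fin 2) ℤ_[p]} (hq : q.IsHomogeneous r) :
    (symLift p φ r q).poly = MvPolynomial.map φ q :=
  MvPolynomial.homogeneousComponent_eq_self (hq.map φ)

theorem symLift_C_mul (z : ℤ_[p]) (q : MvPolynomial (Fin 2) ℤ_[p]) :
    symLift p φ r (MvPolynomial.C z * q) = φ z • symLift p φ r q := by
  ext1
  change MvPolynomial.homogeneousComponent r (MvPolynomial.map φ (MvPolynomial.C z * q)) =
    φ z • MvPolynomial.homogeneousComponent r (MvPolynomial.map φ q)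
  rw [map_mul, MvPolynomial.map_C, MvPolynomial.homogeneousComponent_C_mul,
    MvPolynomial.smul_eq_C_mul]

theorem map_polyAct (M : Matrix (Fin 2) (Fin 2) ℤ_[p]) (q : MvPolynomial (Fin 2) ℤ_[p]) :
    MvPolynomial.map φ (polyAct M q) = polyAct (M.map φ) (MvPolynomial.map φ q) := by
  induction q using MvPolynomial.induction_on with
  | C a => simp [polyAct]
  | add p q hp hq => simp [hp, hq]
  | mul_X p i hp =>
    simp only [map_mul, hp, MvPolynomial.map_X]
    congr 1
    simp only [polyAct, MvPolynomial.aeval_X, ← Matrix.toMvPolynomial_map, Matrix.transpose_map]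

theorem symAct_symLift (M : Matrix (Fin 2) (Fin 2) ℤ_[p]) {q : MvPolynomial (Fin 2) ℤ_[p]}
    (hq : q.IsHomogeneous r) :
    symAct R r (M.map φ) (symLift p φ r q) = symLift p φ r (polyAct M q) := by
  ext1
  rw [symAct_poly, poly_symLift φ hq, poly_symLift φ (polyAct_isHomogeneous M hq), map_polyAct]

theorem symMap_symLift (S : Type) [CommRing S] [Algebra (ZBar p) S]
    {q : MvPolynomial (Fin 2) ℤ_[p]} (hq : q.IsHomogeneous r) :
    symMap (ZBar p) S r (symLift p (baseHom p (ZBar p)) r q) = symLift p (baseHom p S) r q := by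
  ext1
  rw [poly_symLift _ hq]
  change MvPolynomial.map _ (symLift p (baseHom p (ZBar p)) r q).poly = _
  rw [poly_symLift _ hq, MvPolynomial.map_map]
  rfl

end SymLift

/-! ### The lattice of functions with small coefficients -/

section Small

variable (p : ℕ) [Fact p.Prime] (r : ℕ)

theorem mem_ZBar_iff (x : PadicAlgCl p) :
    x ∈ (Valued.v : Valuation (PadicAlgCl p) NNReal).valuationSubring ↔ ‖x‖ ≤ 1 := by
  rw [Valuation.mem_valuationSubring_iff, PadicAlgCl.valuation_def, ← NNReal.coe_le_coe]
  rfl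

theorem norm_ZBar_le (x : ZBar p) : ‖(x : PadicAlgCl p)‖ ≤ 1 := (mem_ZBar_iff p x).1 x.2

theorem mem_maximalIdeal_ZBar (x : ZBar p) (h : ‖(x : PadicAlgCl p)‖ < 1) :
    x ∈ IsLocalRing.maximalIdeal (ZBar p) := by
  rw [IsLocalRing.mem_maximalIdeal, mem_nonunits_iff]
  intro hu
  have h1 := (Valuation.Integers.isUnit_iff_valuation_eq_one
    (Valuation.integer.integers (Valued.v : Valuation (PadicAlgCl p) NNReal))).1 hu
  have h2 : (Valued.v : Valuation (PadicAlgCl p) NNReal) (x : PadicAlgCl p) = 1 := h1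
  rw [PadicAlgCl.valuation_def, ← NNReal.coe_inj] at h2
  exact h.ne h2

theorem norm_baseHom_le (z : ℤ_[p]) : ‖baseHom p (PadicAlgCl p) z‖ ≤ 1 :=
  norm_ZBar_le p (zpToZBar p z)

/-- The polynomials all of whose coefficients have norm `< 1`. -/
def smallPoly : Submodule (ZBar p) (MvPolynomial (Fin 2) (PadicAlgCl p)) where
  carrier := {q | ∀ d, ‖MvPolynomial.coeff d q‖ < 1}
  zero_mem' d := by simp
  add_mem' h₁ h₂ d := by
    rw [MvPolynomial.coeff_add]
    exact (PadicAlgCl.isNonarchimedean p _ _).trans_lt (max_lt (h₁ d) (h₂ d))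
  smul_mem' c q h d := by
    change ‖MvPolynomial.coeff d ((c : PadicAlgCl p) • q)‖ < 1
    rw [MvPolynomial.coeff_smul, smul_eq_mul, norm_mul]
    exact (mul_le_of_le_one_left (norm_nonneg _) (norm_ZBar_le p c)).trans_lt (h d)

theorem C_mul_map_mem_smallPoly {c : PadicAlgCl p} (hc : ‖c‖ < 1)
    (q : MvPolynomial (Fin 2) ℤ_[p]) :
    MvPolynomial.C c * MvPolynomial.map (baseHom p (PadicAlgCl p)) q ∈ smallPoly p := by
  intro d
  rw [MvPolynomial.coeff_C_mul, MvPolynomial.coeff_map, norm_mul]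
  exact (mul_le_of_le_one_right (norm_nonneg _) (norm_baseHom_le p _)).trans_lt hc

theorem polyAct_mem_smallPoly (M : Matrix (Fin 2) (Fin 2) ℤ_[p])
    {q : MvPolynomial (Fin 2) (PadicAlgCl p)} (hq : q ∈ smallPoly p) :
    polyAct (M.map (baseHom p (PadicAlgCl p))) q ∈ smallPoly p := by
  rw [q.as_sum, map_sum]
  refine sum_mem fun d _ => ?_
  have h : MvPolynomial.monomial d (MvPolynomial.coeff d q) =
      MvPolynomial.C (MvPolynomial.coeff d q) *
        MvPolynomial.map (baseHom p (PadicAlgCl p)) (MvPolynomial.monomial d 1) := by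
    rw [MvPolynomial.map_monomial, map_one, MvPolynomial.C_mul_monomial, mul_one]
  rw [h, map_mul, ← map_polyAct, ← MvPolynomial.algebraMap_eq, AlgHom.commutes,
    MvPolynomial.algebraMap_eq]
  exact C_mul_map_mem_smallPoly p (hq d) _

/-- The functions in `ind_{KZ}^G Sym^r Q̄_p²` whose values have coefficients of norm `< 1`. -/
def smallInd : Submodule (ZBar p) (IndSym p (PadicAlgCl p) r) where
  carrier := {f | ∀ g, (f.1 g).poly ∈ smallPoly p}
  zero_mem' _ := (smallPoly p).zero_mem
  add_mem' h₁ h₂ g := (smallPoly p).add_mem (h₁ g) (h₂ g)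
  smul_mem' c _ h g := (smallPoly p).smul_mem c (h g)

/-- An abbreviation for the function `[1, v]`. -/
abbrev single {R : Type} [CommRing R] [Algebra (ZBar p) R] (v : SymPow R r) : IndSym p R r :=
  cSingle (kzHom p) (kzHom_injective p) (symRep p (baseHom p R) r) v

theorem single_mem_smallInd {v : SymPow (PadicAlgCl p) r} (hv : v.poly ∈ smallPoly p) :
    single p r v ∈ smallInd p r := by
  intro g
  by_cases hg : ∃ h, kzHom p h = g
  · obtain ⟨h, rfl⟩ := hg
    rw [cSingle_apply_map]
    exact polyAct_mem_smallPoly p _ hv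
  · rw [cSingle_apply_of_not_mem _ _ _ _ _ hg]
    exact (smallPoly p).zero_mem

/-- Coefficients of norm at most 1 lift to Z̄_p. The lift is unique, and this is what makes the
lifted function equivariant with the same support. -/
theorem exists_indSymMap_eq (f : IndSym p (PadicAlgCl p) r)
    (hf : ∀ g d, ‖MvPolynomial.coeff d (f.1 g).poly‖ ≤ 1) :
    ∃ f₀ : IndSym p (ZBar p) r, indSymMap p (PadicAlgCl p) r f₀ = f := by
  have hinj : Function.Injective (symMap (ZBar p) (PadicAlgCl p) r) := fun v w h => by
    ext1
    exact MvPolynomial.map_injective _ Subtype.val_injective (congrArg SymPow.poly h)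
  have hex : ∀ g, ∃ v, symMap (ZBar p) (PadicAlgCl p) r v = f.1 g := fun g => by
    have h1 : (f.1 g).poly ∈ Set.range (MvPolynomial.map (algebraMap (ZBar p) (PadicAlgCl p))) := by
      rw [MvPolynomial.mem_range_map_iff_coeffs_subset]
      intro c hc
      obtain ⟨d, -, rfl⟩ := MvPolynomial.mem_coeffs_iff.1 hc
      exact ⟨⟨_, (mem_ZBar_iff p _).2 (hf g d)⟩, rfl⟩
    obtain ⟨q, hq⟩ := h1
    refine ⟨SymPow.mk (MvPolynomial.homogeneousComponent r q)
      (MvPolynomial.homogeneousComponent_isHomogeneous r q), ?_⟩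
    ext1
    rw [← MvPolynomial.homogeneousComponent_eq_self (f.1 g).isHomogeneous, ← hq]
    ext d
    change MvPolynomial.coeff d (MvPolynomial.map _ (MvPolynomial.homogeneousComponent r q)) = _
    rw [MvPolynomial.coeff_map, MvPolynomial.coeff_homogeneousComponent,
      MvPolynomial.coeff_homogeneousComponent]
    split_ifs
    · rw [MvPolynomial.coeff_map]
    · rw [map_zero]
  choose v hv using hex
  obtain ⟨S, hS⟩ := f.2.2
  refine ⟨⟨v, fun h g => hinj ?_, S, fun g hg => hS g fun h0 => hg (hinj ?_)⟩, ?_⟩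
  · rw [hv, f.2.1, symMap_equivariant, hv]
  · rw [hv, h0, map_zero]
  · ext1
    funext g
    exact hv g

variable (a : PadicAlgCl p)

/-- The functions whose class in `Π_{r+2, a}` belongs to `𝔪 Θ_{r+2, a}`. -/
def negl : Submodule (ZBar p) (IndSym p (PadicAlgCl p) r) :=
  (heckeRange p (baseHom p (PadicAlgCl p)) r a).restrictScalars (ZBar p) ⊔ smallInd p r

/-- Split the image of `f` into an element of the range of T - a and a small function. The first
dies in Π; the second comes from an integral function whose coefficients lie in the maximal ideal.
-/
theorem toThetaBar_eq_zero_of_mem_negl (f : IndSym p (ZBar p) r)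
    (hf : indSymMap p (PadicAlgCl p) r f ∈ negl p r a) : toThetaBar p r a f = 0 := by
  obtain ⟨x, hx, u, hu, hxu⟩ := Submodule.mem_sup.1 hf
  obtain ⟨u₀, hu₀⟩ := exists_indSymMap_eq p r u fun g d => (hu g d).le
  have h1 : toTheta p r a f = toTheta p r a u₀ := by
    apply Subtype.ext
    change (heckeRange p _ r a).mkQ (indSymMap p (PadicAlgCl p) r f) =
      (heckeRange p _ r a).mkQ (indSymMap p (PadicAlgCl p) r u₀)
    rw [hu₀, ← hxu, map_add, add_eq_right]
    exact (Submodule.Quotient.mk_eq_zero _).2 hx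
  have h2 : toThetaBar p r a f = toThetaBar p r a u₀ := by
    change (1 : FBar p) ⊗ₜ[ZBar p] toTheta p r a f = (1 : FBar p) ⊗ₜ[ZBar p] toTheta p r a u₀
    rw [h1]
  rw [h2]
  apply toThetaBar_eq_zero
  ext1
  funext g
  ext1
  change MvPolynomial.map (IsLocalRing.residue (ZBar p)) (u₀.1 g).poly = 0
  ext d
  rw [MvPolynomial.coeff_map, MvPolynomial.coeff_zero, IsLocalRing.residue_eq_zero_iff]
  apply mem_maximalIdeal_ZBar
  have h3 := hu g d
  rw [← hu₀] at h3
  have h4 : MvPolynomial.coeff d ((indSymMap p (PadicAlgCl p) r u₀).1 g).poly =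
      ((MvPolynomial.coeff d (u₀.1 g).poly : ZBar p) : PadicAlgCl p) :=
    MvPolynomial.coeff_map _ _ _
  rwa [h4] at h3

/-- One integral polynomial is read both over Q̄_p, where the relations given by T - a live, and
over F̄_p, where the conclusion is wanted. -/
theorem symLift_mem_killed {q : MvPolynomial (Fin 2) ℤ_[p]} (hq : q.IsHomogeneous r)
    (h : single p r (symLift p (baseHom p (PadicAlgCl p)) r q) ∈ negl p r a) :
    symLift p (baseHom p (FBar p)) r q ∈ killed p r a := by
  have e : ∀ (S : Type) [CommRing S] [Algebra (ZBar p) S],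
      indSymMap p S r (single p r (symLift p (baseHom p (ZBar p)) r q)) =
        single p r (symLift p (baseHom p S) r q) := fun S _ _ => by
    rw [indSymMap, single, cIndMap_cSingle, symMap_symLift S hq]
  change natP p r a (single p r _) = 0
  rw [← e (FBar p), natP_indSymMap]
  apply toThetaBar_eq_zero_of_mem_negl
  rw [e]
  exact h

theorem cIndRep_mem_negl (g : GL (Fin 2) ℚ_[p]) {f : IndSym p (PadicAlgCl p) r}
    (hf : f ∈ negl p r a) : cIndRep _ _ g f ∈ negl p r a := by
  obtain ⟨x, hx, u, hu, rfl⟩ := Submodule.mem_sup.1 hf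
  rw [map_add]
  refine Submodule.add_mem_sup (heckeRange_le p _ r a g hx) fun y => hu (y * g)

theorem single_symRep_mem_negl (h : GL (Fin 2) ℤ_[p] × Multiplicative ℤ)
    {v : SymPow (PadicAlgCl p) r} (hv : single p r v ∈ negl p r a) :
    single p r (symRep p (baseHom p (PadicAlgCl p)) r h v) ∈ negl p r a := by
  rw [single, cSingle_rep]
  exact cIndRep_mem_negl p r a _ hv

end Small

/-! ### The Hecke operator on functions supported on one coset -/

section HeckeSingle

variable (p : ℕ) [Fact p.Prime]

theorem teich_zero : teich p 0 = 0 := by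
  rw [teich, WittVector.teichmuller_zero, map_zero]

theorem norm_det_heckeElt (i : Option (ZMod p)) :
    ‖((heckeElt p i).det : ℚ_[p])‖ = (p : ℝ)⁻¹ := by
  have h1 : ((heckeElt p i).det : ℚ_[p]) = (p : ℚ_[p]) := by
    have h := RingHom.map_det (PadicInt.Coe.ringHom (p := p)) (heckeMat p i)
    rw [RingHom.mapMatrix_apply, det_heckeMat, map_natCast] at h
    exact h.symm
  rw [h1, Padic.norm_p]

/-- All the `heckeElt` have determinants of the same norm, so the power of p in the KZ factor is
trivial and the identity descends to integral matrices. -/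
theorem heckeElt_mul_kzHom_ext {i j : Option (ZMod p)} {k : GL (Fin 2) ℤ_[p]}
    {n : Multiplicative ℤ} (h : heckeElt p i = heckeElt p j * kzHom p (k, n)) :
    n = 1 ∧ heckeMat p i = heckeMat p j * (k : Matrix (Fin 2) (Fin 2) ℤ_[p]) := by
  have hp : (1 : ℝ) < p := by exact_mod_cast (Fact.out : p.Prime).one_lt
  have hn : n.toAdd = 0 := by
    have h1 := congrArg (fun g => ‖((Matrix.GeneralLinearGroup.det g : ℚ_[p]ˣ) : ℚ_[p])‖) h
    simp only [map_mul, Units.val_mul, norm_mul, norm_det_heckeElt, norm_det_kzHom] at h1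
    have h2 : (p : ℝ)⁻¹ ≠ 0 := inv_ne_zero (by positivity)
    have h3 : (p : ℝ) ^ (-2 * n.toAdd) = 1 := (mul_eq_left₀ h2).1 h1.symm
    have := (zpow_eq_one_iff_right₀ (by positivity) hp.ne').1 h3
    omega
  refine ⟨hn, ?_⟩
  rw [kzHom_apply, hn, zpow_zero, mul_one] at h
  have h1 := congrArg (fun g : GL (Fin 2) ℚ_[p] => (g : Matrix (Fin 2) (Fin 2) ℚ_[p])) h
  have h2 : (heckeMat p i).map PadicInt.Coe.ringHom =
      (heckeMat p j * (k : Matrix (Fin 2) (Fin 2) ℤ_[p])).map PadicInt.Coe.ringHom := by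
    rw [Matrix.map_mul]; exact h1
  exact Matrix.map_injective Subtype.val_injective h2

variable {R : Type*} [CommRing R] (φ : ℤ_[p] →+* R) (r : ℕ)

/-- Distinct representatives give disjoint cosets (`heckeMat_unique`), so one summand of the Hecke
operator survives. -/
theorem heckeFun_single_apply (v : SymPow R r) (j : Option (ZMod p)) (k : GL (Fin 2) ℤ_[p])
    (n : Multiplicative ℤ) :
    heckeFun p φ r (cSingle (kzHom p) (kzHom_injective p) (symRep p φ r) v).1
      (heckeElt p j * kzHom p (k, n)) =
      symAct R r ((heckeMat p j * (k : Matrix (Fin 2) (Fin 2) ℤ_[p])).map φ) v := by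
  rw [heckeFun, Finset.sum_eq_single j]
  · rw [inv_mul_cancel_left, cSingle_apply_map, symRep_apply, symAct_symAct]
  · intro i _ hij
    rw [cSingle_apply_of_not_mem, map_zero]
    rintro ⟨⟨k', n'⟩, h⟩
    apply hij
    have h1 : heckeElt p i = heckeElt p j * kzHom p ((k, n) * (k', n')⁻¹) := by
      rw [map_mul, map_inv, h]; group
    exact heckeMat_unique p i j _ (heckeElt_mul_kzHom_ext p h1).2
  · simp

theorem heckeFun_single_of_not_mem (v : SymPow R r) (g : GL (Fin 2) ℚ_[p])
    (hg : ∀ j k n, g ≠ heckeElt p j * kzHom p (k, n)) :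
    heckeFun p φ r (cSingle (kzHom p) (kzHom_injective p) (symRep p φ r) v).1 g = 0 := by
  rw [heckeFun]
  refine Finset.sum_eq_zero fun i _ => ?_
  rw [cSingle_apply_of_not_mem, map_zero]
  rintro ⟨⟨k, n⟩, h⟩
  exact hg i k n (by rw [h]; group)

theorem heckeElt_zero_mul_none : heckeElt p (some 0) * heckeElt p none = scalarP p := by
  apply Units.ext
  change (heckeMat p (some 0)).map PadicInt.Coe.ringHom * (heckeMat p none).map PadicInt.Coe.ringHom
    = Matrix.scalar (Fin 2) (p : ℚ_[p])
  rw [← Matrix.map_mul, Matrix.scalar_apply]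
  ext i j
  fin_cases i <;> fin_cases j <;> simp [heckeMat, teich_zero]

/-- The coset `KZ α⁻¹` consists of the elements `κ (p 0; 0 1) z`. -/
theorem mul_heckeElt_none_eq_iff (g : GL (Fin 2) ℚ_[p]) (κ : GL (Fin 2) ℤ_[p]) (n : ℤ) :
    g * heckeElt p none = kzHom p (κ, Multiplicative.ofAdd (n + 1)) ↔
      g = inclK p κ * heckeElt p (some 0) * scalarP p ^ n := by
  have h : kzHom p (κ, Multiplicative.ofAdd (n + 1)) =
      inclK p κ * heckeElt p (some 0) * scalarP p ^ n * heckeElt p none := by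
    have h1 : Commute (heckeElt p none) (scalarP p ^ n) := (commute_scalarP p _).zpow_right _
    rw [kzHom_apply, toAdd_ofAdd, add_comm, zpow_add, zpow_one, mul_assoc _ (scalarP p ^ n),
      ← h1.eq, mul_assoc, ← mul_assoc (heckeElt p (some 0)), heckeElt_zero_mul_none]
  rw [h, mul_left_inj]

theorem dvd_det_heckeMat_mul (j : Option (ZMod p)) (k : GL (Fin 2) ℤ_[p]) :
    (p : ℤ_[p]) ∣ (heckeMat p j * (k : Matrix (Fin 2) (Fin 2) ℤ_[p])).det := by
  rw [Matrix.det_mul, det_heckeMat]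
  exact dvd_mul_right _ _

/-- If the first column of `h_j k` vanishes modulo `p`, then this matrix is in `K (p 0; 0 1)`. -/
theorem exists_eq_mul_heckeMat_zero (j : Option (ZMod p)) (k : GL (Fin 2) ℤ_[p])
    (h0 : (p : ℤ_[p]) ∣ (heckeMat p j * (k : Matrix (Fin 2) (Fin 2) ℤ_[p])) 0 0)
    (h1 : (p : ℤ_[p]) ∣ (heckeMat p j * (k : Matrix (Fin 2) (Fin 2) ℤ_[p])) 1 0) :
    ∃ κ : GL (Fin 2) ℤ_[p], heckeMat p j * (k : Matrix (Fin 2) (Fin 2) ℤ_[p]) =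
      (κ : Matrix (Fin 2) (Fin 2) ℤ_[p]) * heckeMat p (some 0) := by
  have hp0 : (p : ℤ_[p]) ≠ 0 := Nat.cast_ne_zero.2 (Fact.out : p.Prime).ne_zero
  have hdet : (heckeMat p j * (k : Matrix (Fin 2) (Fin 2) ℤ_[p])).det =
      p * (k : Matrix (Fin 2) (Fin 2) ℤ_[p]).det := by rw [Matrix.det_mul, det_heckeMat]
  have hu : IsUnit (k : Matrix (Fin 2) (Fin 2) ℤ_[p]).det :=
    (Matrix.isUnit_iff_isUnit_det _).1 k.isUnit
  generalize heckeMat p j * (k : Matrix (Fin 2) (Fin 2) ℤ_[p]) = M at h0 h1 hdet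
  obtain ⟨x, hx⟩ := h0
  obtain ⟨y, hy⟩ := h1
  obtain ⟨κ, hκ⟩ := exists_GL_of_det p !![x, M 0 1; y, M 1 1] (by
    have : (!![x, M 0 1; y, M 1 1] : Matrix (Fin 2) (Fin 2) ℤ_[p]).det =
        (k : Matrix (Fin 2) (Fin 2) ℤ_[p]).det := by
      apply mul_left_cancel₀ hp0
      rw [← hdet, Matrix.det_fin_two_of, Matrix.det_fin_two, hx, hy]
      ring
    rw [this]; exact hu)
  refine ⟨κ, ?_⟩
  rw [hκ]
  ext i j
  fin_cases i <;> fin_cases j <;> simp [heckeMat, Matrix.mul_apply, teich_zero, hx, hy, mul_comm]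

theorem heckeElt_mul_inclK (j j' : Option (ZMod p)) (k κ : GL (Fin 2) ℤ_[p])
    (h : heckeMat p j * (k : Matrix (Fin 2) (Fin 2) ℤ_[p]) =
      (κ : Matrix (Fin 2) (Fin 2) ℤ_[p]) * heckeMat p j') :
    heckeElt p j * inclK p k = inclK p κ * heckeElt p j' := by
  apply Units.ext
  have := congrArg (RingHom.mapMatrix (PadicInt.Coe.ringHom (p := p))) h
  rw [map_mul, map_mul] at this
  exact this

variable {r}

theorem smul_symLift_mem_smallPoly {c : PadicAlgCl p} {k : ℕ}
    (hc : ‖c * (p : PadicAlgCl p) ^ k‖ < 1) {q : MvPolynomial (Fin 2) ℤ_[p]}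
    (hq : q.IsHomogeneous r) (h : MvPolynomial.C ((p : ℤ_[p]) ^ k) ∣ q) :
    (c • symLift p (baseHom p (PadicAlgCl p)) r q).poly ∈ smallPoly p := by
  rw [SymPow.poly_smul, poly_symLift _ hq]
  obtain ⟨q', rfl⟩ := h
  rw [map_mul, MvPolynomial.map_C, map_pow, map_natCast, MvPolynomial.smul_eq_C_mul, ← mul_assoc,
    ← map_mul]
  exact C_mul_map_mem_smallPoly p hc q'

theorem heckeT_single_mem_smallInd {c : PadicAlgCl p} {k : ℕ}
    (hc : ‖c * (p : PadicAlgCl p) ^ k‖ < 1) {q : MvPolynomial (Fin 2) ℤ_[p]}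
    (hq : q.IsHomogeneous r)
    (h : ∀ M : Matrix (Fin 2) (Fin 2) ℤ_[p], (p : ℤ_[p]) ∣ M.det →
      MvPolynomial.C ((p : ℤ_[p]) ^ k) ∣ polyAct M q) :
    heckeT p (baseHom p (PadicAlgCl p)) r
      (single p r (c • symLift p (baseHom p (PadicAlgCl p)) r q)) ∈ smallInd p r := by
  intro g
  change (heckeFun p _ r _ g).poly ∈ _
  by_cases hg : ∃ j k n, g = heckeElt p j * kzHom p (k, n)
  · obtain ⟨j, κ, n, rfl⟩ := hg
    rw [heckeFun_single_apply, map_smul, symAct_symLift _ _ hq]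
    exact smul_symLift_mem_smallPoly p hc (polyAct_isHomogeneous _ hq)
      (h _ (dvd_det_heckeMat_mul p j κ))
  · push Not at hg
    rw [heckeFun_single_of_not_mem _ _ _ _ _ hg]
    exact (smallPoly p).zero_mem

theorem heckeT_sub_mem_negl (a : PadicAlgCl p) (f : IndSym p (PadicAlgCl p) r) :
    heckeT p (baseHom p (PadicAlgCl p)) r f - a • f ∈ negl p r a :=
  Submodule.mem_sup_left ⟨f, rfl⟩

/-- A function `[1, v]` is negligible if `T [1, v]` is divisible by a number of norm less than that
of `a`. -/
theorem single_mem_negl {a : PadicAlgCl p} (ha : a ≠ 0) {c : PadicAlgCl p} {k : ℕ}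
    (hc : ‖c * a⁻¹ * (p : PadicAlgCl p) ^ k‖ < 1) {q : MvPolynomial (Fin 2) ℤ_[p]}
    (hq : q.IsHomogeneous r)
    (h : ∀ M : Matrix (Fin 2) (Fin 2) ℤ_[p], (p : ℤ_[p]) ∣ M.det →
      MvPolynomial.C ((p : ℤ_[p]) ^ k) ∣ polyAct M q) :
    single p r (c • symLift p (baseHom p (PadicAlgCl p)) r q) ∈ negl p r a := by
  set φ := baseHom p (PadicAlgCl p) with hφ
  have h1 := heckeT_single_mem_smallInd p (r := r) hc hq h
  set f := single p r ((c * a⁻¹) • symLift p φ r q) with hf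
  have h2 : single p r (c • symLift p φ r q) = a • f := by
    rw [hf, single, single, ← map_smul (cSingle _ _ _) a, smul_smul, mul_comm c,
      mul_inv_cancel_left₀ ha]
  rw [h2, ← sub_sub_cancel (heckeT p φ r f) (a • f)]
  exact sub_mem (Submodule.mem_sup_right h1) (heckeT_sub_mem_negl p a f)

theorem translate_single_apply {R : Type*} [CommRing R] (φ : ℤ_[p] →+* R) (v : SymPow R r)
    (j : Option (ZMod p)) (κ κ' : GL (Fin 2) ℤ_[p]) (n : Multiplicative ℤ)
    (h : heckeMat p j * (κ : Matrix (Fin 2) (Fin 2) ℤ_[p]) =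
      (κ' : Matrix (Fin 2) (Fin 2) ℤ_[p]) * heckeMat p (some 0)) :
    (cSingle (kzHom p) (kzHom_injective p) (symRep p φ r) v).1
      (heckeElt p j * kzHom p (κ, n) * heckeElt p none) =
      symAct R r ((κ' : Matrix (Fin 2) (Fin 2) ℤ_[p]).map φ) v := by
  have e1 : heckeElt p j * kzHom p (κ, n) * heckeElt p none =
      kzHom p (κ', Multiplicative.ofAdd (n.toAdd + 1)) := by
    rw [mul_heckeElt_none_eq_iff, kzHom_apply, ← mul_assoc, heckeElt_mul_inclK p j _ κ κ' h]
  rw [e1, cSingle_apply_map, symRep_apply]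

theorem exists_of_mul_heckeElt_none_mem (g : GL (Fin 2) ℚ_[p])
    (h : ∃ h, kzHom p h = g * heckeElt p none) :
    ∃ j k n, g = heckeElt p j * kzHom p (k, n) ∧
      (p : ℤ_[p]) ∣ (heckeMat p j * (k : Matrix (Fin 2) (Fin 2) ℤ_[p])) 0 0 ∧
      (p : ℤ_[p]) ∣ (heckeMat p j * (k : Matrix (Fin 2) (Fin 2) ℤ_[p])) 1 0 := by
  obtain ⟨⟨κ', n'⟩, h⟩ := h
  have h3 := (mul_heckeElt_none_eq_iff p g κ' (n'.toAdd - 1)).1 (by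
    rw [sub_add_cancel]; exact h.symm)
  obtain ⟨j', k', hk'⟩ := hecke_coset p κ' (some 0)
  have h4 := heckeElt_mul_inclK p j' _ k' κ' hk'.symm
  refine ⟨j', k', Multiplicative.ofAdd (n'.toAdd - 1), ?_, ?_, ?_⟩
  · rw [h3, ← h4, kzHom_apply, mul_assoc, toAdd_ofAdd]
  · rw [← hk']; simp [heckeMat, Matrix.mul_apply]
  · rw [← hk']; simp [heckeMat, Matrix.mul_apply]

theorem heckeElt_mul_kzHom_eq {j j' : Option (ZMod p)} {k k' : GL (Fin 2) ℤ_[p]}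
    {n n' : Multiplicative ℤ} (h : heckeElt p j * kzHom p (k, n) = heckeElt p j' * kzHom p (k', n')) :
    heckeMat p j * (k : Matrix (Fin 2) (Fin 2) ℤ_[p]) =
      heckeMat p j' * (k' : Matrix (Fin 2) (Fin 2) ℤ_[p]) := by
  have h5 : heckeElt p j = heckeElt p j' * kzHom p ((k', n') * (k, n)⁻¹) := by
    rw [map_mul, map_inv, ← mul_assoc, eq_mul_inv_iff_mul_eq, h]
  rw [(heckeElt_mul_kzHom_ext p h5).2, mul_assoc, ← Units.val_mul]
  congr 2
  exact inv_mul_cancel_right k' k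

/-- Separates the points of h_j KZ at which a function supported on KZ α⁻¹ can be nonzero from the
others; the polynomials used later satisfy different congruences in the two cases. -/
theorem first_column_cases (j : Option (ZMod p)) (κ : GL (Fin 2) ℤ_[p]) :
    (∃ κ' : GL (Fin 2) ℤ_[p], ∃ M, heckeMat p j * (κ : Matrix (Fin 2) (Fin 2) ℤ_[p]) = M ∧
      M = (κ' : Matrix (Fin 2) (Fin 2) ℤ_[p]) * heckeMat p (some 0) ∧
      (p : ℤ_[p]) ∣ M 0 0 ∧ (p : ℤ_[p]) ∣ M 1 0) ∨
    ∃ M, heckeMat p j * (κ : Matrix (Fin 2) (Fin 2) ℤ_[p]) = M ∧ (p : ℤ_[p]) ∣ M.det ∧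
      ¬ ((p : ℤ_[p]) ∣ M 0 0 ∧ (p : ℤ_[p]) ∣ M 1 0) := by
  by_cases h : (p : ℤ_[p]) ∣ (heckeMat p j * (κ : Matrix (Fin 2) (Fin 2) ℤ_[p])) 0 0 ∧
      (p : ℤ_[p]) ∣ (heckeMat p j * (κ : Matrix (Fin 2) (Fin 2) ℤ_[p])) 1 0
  · obtain ⟨κ', hκ'⟩ := exists_eq_mul_heckeMat_zero p j κ h.1 h.2
    exact Or.inl ⟨κ', _, rfl, hκ', h⟩
  · exact Or.inr ⟨_, rfl, dvd_det_heckeMat_mul p j κ, h⟩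

/-- By `hw0`, w is an eigenvector of (p 0; 0 1) with eigenvalue p^i. The scalar p^i is absorbed by
passing from κ to κ (p 0; 0 1), a matrix of the kind met in T[1, q]. -/
theorem symAct_smul_symLift {R : Type*} [CommRing R] (φ : ℤ_[p] →+* R) (c : R) {i : ℕ}
    {w : MvPolynomial (Fin 2) ℤ_[p]} (hw : w.IsHomogeneous r) (κ : Matrix (Fin 2) (Fin 2) ℤ_[p])
    (hw0 : polyAct (heckeMat p (some 0)) w = MvPolynomial.C ((p : ℤ_[p]) ^ i) * w) :
    symAct R r (κ.map φ) ((c * (p : R) ^ i) • symLift p φ r w) =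
      c • symLift p φ r (polyAct (κ * heckeMat p (some 0)) w) := by
  rw [polyAct_mul, AlgHom.comp_apply, hw0, map_mul, ← MvPolynomial.algebraMap_eq,
    AlgHom.commutes, MvPolynomial.algebraMap_eq, symLift_C_mul, map_smul,
    symAct_symLift _ _ hw, mul_smul, map_pow, map_natCast]

/-- Where the first column of M = h_j k vanishes modulo p, the translate takes the value c M w,
which `h1` compares with c M q. At the other points of h_j KZ the translate is zero and `h2` bounds
c M q. -/
theorem heckeT_single_sub_mem_smallInd {c : PadicAlgCl p} {k i : ℕ}
    (hc : ‖c * (p : PadicAlgCl p) ^ k‖ < 1) {q w : MvPolynomial (Fin 2) ℤ_[p]}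
    (hq : q.IsHomogeneous r) (hw : w.IsHomogeneous r)
    (hw0 : polyAct (heckeMat p (some 0)) w = MvPolynomial.C ((p : ℤ_[p]) ^ i) * w)
    (h1 : ∀ M : Matrix (Fin 2) (Fin 2) ℤ_[p], (p : ℤ_[p]) ∣ M 0 0 → (p : ℤ_[p]) ∣ M 1 0 →
      MvPolynomial.C ((p : ℤ_[p]) ^ k) ∣ polyAct M q - polyAct M w)
    (h2 : ∀ M : Matrix (Fin 2) (Fin 2) ℤ_[p], (p : ℤ_[p]) ∣ M.det →
      ¬ ((p : ℤ_[p]) ∣ M 0 0 ∧ (p : ℤ_[p]) ∣ M 1 0) →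
      MvPolynomial.C ((p : ℤ_[p]) ^ k) ∣ polyAct M q) :
    heckeT p (baseHom p (PadicAlgCl p)) r
      (single p r (c • symLift p (baseHom p (PadicAlgCl p)) r q)) -
      cIndRep _ _ (heckeElt p none)
        (single p r ((c * (p : PadicAlgCl p) ^ i) • symLift p (baseHom p (PadicAlgCl p)) r w)) ∈
      smallInd p r := by
  intro g
  change (heckeFun p _ r _ g - (single p r _).1 (g * heckeElt p none)).poly ∈ _
  by_cases hg : ∃ j k n, g = heckeElt p j * kzHom p (k, n)
  · obtain ⟨j, κ, n, rfl⟩ := hg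
    rw [heckeFun_single_apply, map_smul, symAct_symLift _ _ hq]
    rcases first_column_cases p j κ with ⟨κ', M, hM, hκ', hcol⟩ | ⟨M, hM, hdet, hcol⟩
    · rw [translate_single_apply p _ _ j κ κ' n (hM.trans hκ'), symAct_smul_symLift p _ _ hw _ hw0,
        ← hκ', hM, ← smul_sub, ← map_sub]
      exact smul_symLift_mem_smallPoly p hc ((polyAct_isHomogeneous _ hq).sub
        (polyAct_isHomogeneous _ hw)) (h1 _ hcol.1 hcol.2)
    · rw [cSingle_apply_of_not_mem, sub_zero, hM]
      · exact smul_symLift_mem_smallPoly p hc (polyAct_isHomogeneous _ hq) (h2 _ hdet hcol)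
      · intro h
        obtain ⟨j', k', n', h3, h4⟩ := exists_of_mul_heckeElt_none_mem p _ h
        rw [← heckeElt_mul_kzHom_eq p h3, hM] at h4
        exact hcol h4
  · rw [cSingle_apply_of_not_mem _ _ _ _ (g * heckeElt p none), sub_zero]
    · push Not at hg
      rw [heckeFun_single_of_not_mem _ _ _ _ _ hg]
      exact (smallPoly p).zero_mem
    · intro h
      obtain ⟨j', k', n', h3, -⟩ := exists_of_mul_heckeElt_none_mem p _ h
      exact hg ⟨j', k', n', h3⟩

theorem sub_smul_mem_negl (a : PadicAlgCl p) {f f' : IndSym p (PadicAlgCl p) r}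
    (h : heckeT p (baseHom p (PadicAlgCl p)) r f - f' ∈ smallInd p r) :
    f' - a • f ∈ negl p r a := by
  have h1 := sub_mem (heckeT_sub_mem_negl p a f) (Submodule.mem_sup_right h)
  rwa [sub_sub_sub_cancel_left] at h1

/-- Up to negligible functions, `[1, c pⁱ w] = [α⁻¹, a c q]`. -/
theorem single_sub_mem_negl {a c : PadicAlgCl p} {k i : ℕ}
    (hc : ‖c * (p : PadicAlgCl p) ^ k‖ < 1) {q w : MvPolynomial (Fin 2) ℤ_[p]}
    (hq : q.IsHomogeneous r) (hw : w.IsHomogeneous r)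
    (hw0 : polyAct (heckeMat p (some 0)) w = MvPolynomial.C ((p : ℤ_[p]) ^ i) * w)
    (h1 : ∀ M : Matrix (Fin 2) (Fin 2) ℤ_[p], (p : ℤ_[p]) ∣ M 0 0 → (p : ℤ_[p]) ∣ M 1 0 →
      MvPolynomial.C ((p : ℤ_[p]) ^ k) ∣ polyAct M q - polyAct M w)
    (h2 : ∀ M : Matrix (Fin 2) (Fin 2) ℤ_[p], (p : ℤ_[p]) ∣ M.det →
      ¬ ((p : ℤ_[p]) ∣ M 0 0 ∧ (p : ℤ_[p]) ∣ M 1 0) →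
      MvPolynomial.C ((p : ℤ_[p]) ^ k) ∣ polyAct M q) :
    cIndRep _ _ (heckeElt p none)
        (single p r ((c * (p : PadicAlgCl p) ^ i) • symLift p (baseHom p (PadicAlgCl p)) r w)) -
      single p r ((a * c) • symLift p (baseHom p (PadicAlgCl p)) r q) ∈ negl p r a := by
  have h3 := heckeT_single_sub_mem_smallInd p (r := r) hc hq hw hw0 h1 h2
  have h4 : single p r ((a * c) • symLift p (baseHom p (PadicAlgCl p)) r q) =
      a • single p r (c • symLift p (baseHom p (PadicAlgCl p)) r q) := by
    rw [mul_smul, single, map_smul]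
  rw [h4]
  exact sub_smul_mem_negl p a h3

end HeckeSingle

/-! ### Matrices with determinant divisible by `p` acting on polynomials -/

section Congruences

open MvPolynomial

variable {p : ℕ} [Fact p.Prime]

theorem C_prime_pow_eq (k : ℕ) :
    (C ((p : ℤ_[p]) ^ k) : MvPolynomial (Fin 2) ℤ_[p]) = (p : MvPolynomial (Fin 2) ℤ_[p]) ^ k := by
  rw [map_pow, map_natCast]

theorem prime_dvd_iff_map_toZMod (q : MvPolynomial (Fin 2) ℤ_[p]) :
    (p : MvPolynomial (Fin 2) ℤ_[p]) ∣ q ↔ map PadicInt.toZMod q = 0 := by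
  rw [← map_natCast C p, C_dvd_iff_dvd_coeff, MvPolynomial.ext_iff]
  refine forall_congr' fun d => ?_
  rw [coeff_map, coeff_zero, toZMod_eq_zero_iff]

/-- Modulo p the matrix has rank at most one. -/
theorem exists_common_form (M : Matrix (Fin 2) (Fin 2) ℤ_[p]) (hM : (p : ℤ_[p]) ∣ M.det) :
    ∃ (l : MvPolynomial (Fin 2) (ZMod p)) (u v : ZMod p),
      map PadicInt.toZMod (polyAct M (X 0)) = C u * l ∧
      map PadicInt.toZMod (polyAct M (X 1)) = C v * l := by
  obtain ⟨a, b, c, d, rfl⟩ : ∃ a b c d, M = !![a, b; c, d] := ⟨_, _, _, _, Matrix.eta_fin_two M⟩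
  rw [Matrix.det_fin_two_of, ← toZMod_eq_zero_iff, map_sub, map_mul, map_mul, sub_eq_zero] at hM
  rw [polyAct_X0, polyAct_X1]
  simp only [map_add, map_mul, map_C, map_X]
  generalize PadicInt.toZMod a = a at *
  generalize PadicInt.toZMod b = b at *
  generalize PadicInt.toZMod c = c at *
  generalize PadicInt.toZMod d = d at *
  by_cases hb : b = 0
  · by_cases hd : d = 0
    · exact ⟨_, 1, 0, by rw [map_one, one_mul], by simp [hb, hd]⟩
    · refine ⟨_, c / d, 1, ?_, by rw [map_one, one_mul]⟩
      have ha : a = 0 := by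
        rw [hb, zero_mul] at hM
        exact (mul_eq_zero.1 hM).resolve_right hd
      rw [hb, ha, mul_add, ← mul_assoc, ← mul_assoc, ← map_mul, ← map_mul, mul_zero,
        div_mul_cancel₀ _ hd]
  · refine ⟨_, a / b, 1, ?_, by rw [map_one, one_mul]⟩
    rw [mul_add, ← mul_assoc, ← mul_assoc, ← map_mul, ← map_mul, div_mul_cancel₀ _ hb,
      div_mul_eq_mul_div, hM, mul_div_cancel_left₀ _ hb]

theorem prime_dvd_polyAct_X0_iff (M : Matrix (Fin 2) (Fin 2) ℤ_[p]) :
    (p : MvPolynomial (Fin 2) ℤ_[p]) ∣ polyAct M (X 0) ↔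
      (p : ℤ_[p]) ∣ M 0 0 ∧ (p : ℤ_[p]) ∣ M 1 0 := by
  have h : polyAct M (X 0) = C (M 0 0) * X 0 + C (M 1 0) * X 1 := by
    conv_lhs => rw [Matrix.eta_fin_two M]
    exact polyAct_X0 _ _ _ _
  rw [h]
  constructor
  · rw [← map_natCast C p, C_dvd_iff_dvd_coeff]
    intro h1
    have h2 := h1 (Finsupp.single 0 1)
    have h3 := h1 (Finsupp.single 1 1)
    simp [coeff_C_mul, coeff_X, Finsupp.single_left_inj] at h2 h3
    exact ⟨h2, h3⟩
  · rintro ⟨⟨x, hx⟩, y, hy⟩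
    rw [hx, hy, map_mul, map_mul, map_natCast, mul_assoc, mul_assoc, ← mul_add]
    exact dvd_mul_right _ _

/-- Modulo p both images are nonzero F_p-multiples of one form, and the power p - 1 erases the
scalars. -/
theorem prime_dvd_pow_sub_pow_of_det (M : Matrix (Fin 2) (Fin 2) ℤ_[p]) (hM : (p : ℤ_[p]) ∣ M.det)
    (h0 : ¬ (p : MvPolynomial (Fin 2) ℤ_[p]) ∣ polyAct M (X 0))
    (h1 : ¬ (p : MvPolynomial (Fin 2) ℤ_[p]) ∣ polyAct M (X 1)) :
    (p : MvPolynomial (Fin 2) ℤ_[p]) ∣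
      polyAct M (X 1) ^ (p - 1) - polyAct M (X 0) ^ (p - 1) := by
  obtain ⟨l, u, v, hu, hv⟩ := exists_common_form M hM
  rw [prime_dvd_iff_map_toZMod, hu] at h0
  rw [prime_dvd_iff_map_toZMod, hv] at h1
  have hu0 : u ≠ 0 := fun h => h0 (by rw [h, map_zero, zero_mul])
  have hv0 : v ≠ 0 := fun h => h1 (by rw [h, map_zero, zero_mul])
  rw [prime_dvd_iff_map_toZMod, map_sub, map_pow, map_pow, hu, hv, mul_pow, mul_pow, ← map_pow,
    ← map_pow, ZMod.pow_card_sub_one_eq_one hu0, ZMod.pow_card_sub_one_eq_one hv0, sub_self]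

/-- A form of degree `p (p - 1)` which takes the value `1` at all points of `P¹(𝔽_p)`. -/
def unitForm (p : ℕ) (R : Type*) [CommRing R] : MvPolynomial (Fin 2) R :=
  X 0 ^ (p * (p - 1)) + X 1 ^ (p * (p - 1)) - X 0 ^ (p - 1) * X 1 ^ ((p - 1) * (p - 1))

theorem unitForm_isHomogeneous (R : Type*) [CommRing R] :
    (unitForm p R).IsHomogeneous (p * (p - 1)) := by
  have hp := (Fact.out : p.Prime).one_lt
  have e : (p - 1) + (p - 1) * (p - 1) = p * (p - 1) := by
    obtain ⟨k, rfl⟩ : ∃ k, p = k + 1 := ⟨p - 1, by omega⟩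
    simp only [Nat.add_sub_cancel]; ring
  refine ((isHomogeneous_X_pow _ _).add (isHomogeneous_X_pow _ _)).sub ?_
  have := (isHomogeneous_X_pow (R := R) (0 : Fin 2) (p - 1)).mul
    (isHomogeneous_X_pow (R := R) (1 : Fin 2) ((p - 1) * (p - 1)))
  rwa [e] at this

/-- If a coordinate vanishes, a single term survives, with value 1; otherwise the value is 1 + 1 -
1. -/
theorem zmod_unitForm (u v : ZMod p) (h : u ≠ 0 ∨ v ≠ 0) :
    u ^ (p * (p - 1)) + v ^ (p * (p - 1)) - u ^ (p - 1) * v ^ ((p - 1) * (p - 1)) = 1 := by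
  have hp := (Fact.out : p.Prime).one_lt
  have hp1 : p - 1 ≠ 0 := by omega
  have hpp : p * (p - 1) ≠ 0 := mul_ne_zero (by omega) hp1
  by_cases hu : u = 0
  · have hv : v ≠ 0 := h.resolve_left (not_not.2 hu)
    rw [hu, zero_pow hpp, zero_pow hp1, mul_comm p, pow_mul, ZMod.pow_card_sub_one_eq_one hv]
    simp
  · by_cases hv : v = 0
    · rw [hv, zero_pow hpp, zero_pow (mul_ne_zero hp1 hp1), mul_comm p, pow_mul,
        ZMod.pow_card_sub_one_eq_one hu]
      simp
    · rw [mul_comm p, pow_mul, pow_mul, pow_mul, ZMod.pow_card_sub_one_eq_one hu,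
        ZMod.pow_card_sub_one_eq_one hv]
      simp

/-- With l the common form, the two terms are E(u, v) l^(p(p-1)) and (w l)^(p(p-1)) modulo p. By
hypothesis w ≠ 0, hence (u, v) ≠ 0, and both scalars are 1. -/
theorem prime_dvd_unitForm_sub (M g : Matrix (Fin 2) (Fin 2) ℤ_[p]) (hM : (p : ℤ_[p]) ∣ M.det)
    (h : ¬ (p : MvPolynomial (Fin 2) ℤ_[p]) ∣ polyAct M (polyAct g (X 1))) :
    (p : MvPolynomial (Fin 2) ℤ_[p]) ∣
      polyAct M (unitForm p ℤ_[p]) - polyAct M (polyAct g (X 1)) ^ (p * (p - 1)) := by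
  obtain ⟨l, u, v, hu, hv⟩ := exists_common_form M hM
  have hg : polyAct g (X 1) = C (g 0 1) * X 0 + C (g 1 1) * X 1 := by
    conv_lhs => rw [Matrix.eta_fin_two g]
    exact polyAct_X1 _ _ _ _
  have hC : ∀ z : ℤ_[p], polyAct M (C z) = C z := fun z => (polyAct M).commutes z
  set w : ZMod p := PadicInt.toZMod (g 0 1) * u + PadicInt.toZMod (g 1 1) * v with hw
  have e : map PadicInt.toZMod (polyAct M (polyAct g (X 1))) = C w * l := by
    rw [hg, map_add, map_mul, map_mul, hC, hC, map_add, map_mul, map_mul, hu, hv, map_C, map_C, hw,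
      map_add, map_mul, map_mul]
    ring
  rw [prime_dvd_iff_map_toZMod, e] at h
  have hw0 : w ≠ 0 := fun h' => h (by rw [h', map_zero, zero_mul])
  have huv : u ≠ 0 ∨ v ≠ 0 := by
    by_contra! h'
    exact hw0 (by rw [hw, h'.1, h'.2, mul_zero, mul_zero, add_zero])
  rw [prime_dvd_iff_map_toZMod, map_sub, map_pow _ (polyAct M _), e, unitForm]
  simp only [map_sub, map_add, map_mul, map_pow, hu, hv]
  have h1 := congrArg (C (σ := Fin 2)) (zmod_unitForm u v huv)
  have h2 : (C w : MvPolynomial (Fin 2) (ZMod p)) ^ (p * (p - 1)) = 1 := by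
    rw [← map_pow, mul_comm p, pow_mul, ZMod.pow_card_sub_one_eq_one hw0, one_pow, map_one]
  simp only [map_sub, map_add, map_mul, map_pow, map_one] at h1
  have e1 : p * (p - 1) = (p - 1) + (p - 1) * (p - 1) := by
    have hp := (Fact.out : p.Prime).one_lt
    obtain ⟨k, rfl⟩ : ∃ k, p = k + 1 := ⟨p - 1, by omega⟩
    simp only [Nat.add_sub_cancel]; ring
  rw [mul_pow (C w), h2]
  have e2 : l ^ (p - 1) * l ^ ((p - 1) * (p - 1)) = l ^ (p * (p - 1)) := by rw [e1, pow_add]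
  simp only [mul_pow]
  linear_combination (l ^ (p * (p - 1))) * h1 - (C u ^ (p - 1) * C v ^ ((p - 1) * (p - 1))) * e2

/-- Multiplication by a power of `unitForm` relates the monomials of two weights `s` and
`s + p^(e + 1) (p - 1) d`. -/
theorem prime_pow_dvd_unitForm_mul_sub (M g : Matrix (Fin 2) (Fin 2) ℤ_[p])
    (hM : (p : ℤ_[p]) ∣ M.det) (e d i j : ℕ) :
    (p : MvPolynomial (Fin 2) ℤ_[p]) ^ min (e + 1) j ∣
      polyAct M (unitForm p ℤ_[p] ^ (p ^ e * d) * polyAct g (X 0 ^ i * X 1 ^ j) -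
        polyAct g (X 0 ^ i * X 1 ^ (j + p * (p - 1) * (p ^ e * d)))) := by
  have h0 : polyAct M (unitForm p ℤ_[p] ^ (p ^ e * d) * polyAct g (X 0 ^ i * X 1 ^ j) -
        polyAct g (X 0 ^ i * X 1 ^ (j + p * (p - 1) * (p ^ e * d)))) =
      polyAct M (polyAct g (X 0)) ^ i * polyAct M (polyAct g (X 1)) ^ j *
        ((polyAct M (unitForm p ℤ_[p]) ^ (p ^ e)) ^ d -
        (((polyAct M (polyAct g (X 1))) ^ (p * (p - 1))) ^ p ^ e) ^ d) := by
    simp only [map_sub, map_mul, map_pow]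
    rw [← pow_mul, ← pow_mul, ← pow_mul, pow_add]
    ring
  rw [h0]
  -- If p divides the image of g y, the factor with exponent j suffices. Otherwise the two bases
  -- agree modulo p, and the power p^e improves this to a congruence modulo p^(e+1).
  by_cases h : (p : MvPolynomial (Fin 2) ℤ_[p]) ∣ polyAct M (polyAct g (X 1))
  · refine Dvd.dvd.mul_right (Dvd.dvd.mul_left ?_ _) _
    exact (pow_dvd_pow _ (min_le_right _ _)).trans (pow_dvd_pow_of_dvd h j)
  · refine Dvd.dvd.mul_left ?_ _
    refine (pow_dvd_pow _ (min_le_left _ _)).trans (Dvd.dvd.trans ?_ (sub_dvd_pow_sub_pow _ _ d))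
    exact dvd_sub_pow_of_dvd_sub (prime_dvd_unitForm_sub M g hM h) e

theorem prime_dvd_polyAct_dickson (M : Matrix (Fin 2) (Fin 2) ℤ_[p]) (hM : (p : ℤ_[p]) ∣ M.det) :
    (p : MvPolynomial (Fin 2) ℤ_[p]) ∣ polyAct M (dickson p ℤ_[p]) := by
  have h : map PadicInt.toZMod (dickson p ℤ_[p]) = dickson p (ZMod p) := by
    simp [dickson]
  rw [prime_dvd_iff_map_toZMod, map_polyAct, h, polyAct_dickson, (toZMod_eq_zero_iff p _).2 hM,
    map_zero, zero_mul]

/-- The polynomial `x^i y^n (y^(p-1) - x^(p-1))^N`. -/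
def deltaForm (p : ℕ) (R : Type*) [CommRing R] (i n N : ℕ) : MvPolynomial (Fin 2) R :=
  X 0 ^ i * X 1 ^ n * (X 1 ^ (p - 1) - X 0 ^ (p - 1)) ^ N

theorem deltaForm_isHomogeneous {p : ℕ} (R : Type*) [CommRing R] (i n N : ℕ) :
    (deltaForm p R i n N).IsHomogeneous (i + n + N * (p - 1)) := by
  rw [mul_comm N]
  exact ((isHomogeneous_X_pow _ _).mul (isHomogeneous_X_pow _ _)).mul
    (((isHomogeneous_X_pow _ _).sub (isHomogeneous_X_pow _ _)).pow N)

/-- x^i contributes p^i, and replacing y^(p-1) - x^(p-1) by y^(p-1) costs a multiple of x^(p-1),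
hence of p^(p-1). -/
theorem prime_pow_dvd_polyAct_deltaForm_sub (M : Matrix (Fin 2) (Fin 2) ℤ_[p])
    (h : (p : MvPolynomial (Fin 2) ℤ_[p]) ∣ polyAct M (X 0)) (i n N : ℕ) :
    (p : MvPolynomial (Fin 2) ℤ_[p]) ^ (i + (p - 1)) ∣
      polyAct M (deltaForm p ℤ_[p] i n N) - polyAct M (X 0 ^ i * X 1 ^ (n + N * (p - 1))) := by
  have h0 : polyAct M (deltaForm p ℤ_[p] i n N) - polyAct M (X 0 ^ i * X 1 ^ (n + N * (p - 1))) =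
      polyAct M (X 0) ^ i * (polyAct M (X 1) ^ n *
        ((polyAct M (X 1) ^ (p - 1) - polyAct M (X 0) ^ (p - 1)) ^ N -
          (polyAct M (X 1) ^ (p - 1)) ^ N)) := by
    simp only [deltaForm, map_sub, map_mul, map_pow, pow_add, ← pow_mul, mul_comm N]
    ring
  rw [h0, pow_add]
  refine mul_dvd_mul (pow_dvd_pow_of_dvd h i) (Dvd.dvd.mul_left ?_ _)
  refine Dvd.dvd.trans ?_ (sub_dvd_pow_sub_pow _ _ N)
  rw [sub_sub_cancel_left, dvd_neg]
  exact pow_dvd_pow_of_dvd h _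

/-- Either p divides the image of y and the factor y^n suffices, as N ≤ n, or both images are
nonzero modulo p and each factor y^(p-1) - x^(p-1) yields one p. -/
theorem prime_pow_dvd_polyAct_deltaForm (M : Matrix (Fin 2) (Fin 2) ℤ_[p])
    (hM : (p : ℤ_[p]) ∣ M.det) (h : ¬ (p : MvPolynomial (Fin 2) ℤ_[p]) ∣ polyAct M (X 0))
    (i : ℕ) {n N : ℕ} (hn : N ≤ n) :
    (p : MvPolynomial (Fin 2) ℤ_[p]) ^ N ∣ polyAct M (deltaForm p ℤ_[p] i n N) := by
  simp only [deltaForm, map_sub, map_mul, map_pow]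
  by_cases h1 : (p : MvPolynomial (Fin 2) ℤ_[p]) ∣ polyAct M (X 1)
  · exact Dvd.dvd.mul_right (Dvd.dvd.mul_left
      ((pow_dvd_pow _ hn).trans (pow_dvd_pow_of_dvd h1 n)) _) _
  · exact Dvd.dvd.mul_left (pow_dvd_pow_of_dvd (prime_dvd_pow_sub_pow_of_det M hM h h1) N) _

/-- Comes from -θ = x y (y^(p-1) - x^(p-1)); it places the forms produced by the Hecke operator in
the filtration. -/
theorem deltaForm_eq_dickson_pow_mul (R : Type*) [CommRing R] (m n N : ℕ) :
    deltaForm p R m (n + m) (N + m) = (-1) ^ m * (dickson p R ^ m * deltaForm p R 0 n N) := by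
  have hp := (Fact.out : p.Prime).one_lt
  have h : -dickson p R = X 0 * X 1 * (X 1 ^ (p - 1) - X 0 ^ (p - 1)) := by
    obtain ⟨k, rfl⟩ : ∃ k, p = k + 1 := ⟨p - 1, by omega⟩
    simp only [dickson, Nat.add_sub_cancel]; ring
  rw [← mul_assoc, ← mul_pow, neg_one_mul, h, deltaForm, deltaForm]
  generalize (X 1 ^ (p - 1) - X 0 ^ (p - 1) : MvPolynomial (Fin 2) R) = D
  ring

theorem polyAct_heckeMat_zero_monomial (i j : ℕ) :
    polyAct (heckeMat p (some 0)) (X 0 ^ i * X 1 ^ j) =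
      C ((p : ℤ_[p]) ^ i) * (X 0 ^ i * X 1 ^ j : MvPolynomial (Fin 2) ℤ_[p]) := by
  rw [heckeMat, map_mul, map_pow, map_pow, polyAct_X0, polyAct_X1, teich_zero]
  simp only [map_zero, zero_mul, add_zero, zero_add, map_one, one_mul, map_pow]
  ring

end Congruences

/-! ### Divisibility by the Dickson polynomial -/

section Divisibility

open MvPolynomial

variable {k : Type*} [CommRing k]

theorem dvd_sub_aeval {σ : Type*} (l : MvPolynomial σ k) (w : σ → MvPolynomial σ k)
    (h : ∀ i, l ∣ X i - w i) (f : MvPolynomial σ k) : l ∣ f - aeval w f := by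
  induction f using MvPolynomial.induction_on with
  | C a => simp [← algebraMap_eq]
  | add f g hf hg =>
    rw [map_add, add_sub_add_comm]
    exact dvd_add hf hg
  | mul_X f i hf =>
    rw [map_mul, aeval_X]
    have : f * X i - aeval w f * w i = (f - aeval w f) * X i + aeval w f * (X i - w i) := by ring
    rw [this]
    exact dvd_add (Dvd.dvd.mul_right hf _) (Dvd.dvd.mul_left (h i) _)

theorem aeval_mul_C_of_isHomogeneous {σ : Type*} {f : MvPolynomial σ k} {n : ℕ}
    (hf : f.IsHomogeneous n) (z : MvPolynomial σ k) (c : σ → k) :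
    aeval (fun i => z * C (c i)) f = z ^ n * C (eval c f) := by
  rw [aeval_def, eval₂_eq, eval_eq, map_sum, Finset.mul_sum]
  refine Finset.sum_congr rfl fun d hd => ?_
  have h1 : ∑ i ∈ d.support, d i = n := by
    change d.degree = n
    rw [Finsupp.degree_eq_weight_one]
    exact hf (mem_support_iff.1 hd)
  simp only [mul_pow, Finset.prod_mul_distrib, map_mul, map_prod, map_pow, algebraMap_eq]
  rw [Finset.prod_pow_eq_pow_sum, h1]
  ring

theorem homogeneousComponent_mul_of_isHomogeneous {σ : Type*} {f : MvPolynomial σ k} {d : ℕ}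
    (hf : f.IsHomogeneous d) (g : MvPolynomial σ k) (n : ℕ) :
    homogeneousComponent n (f * g) =
      if d ≤ n then f * homogeneousComponent (n - d) g else 0 := by
  classical
  conv_lhs => rw [← sum_homogeneousComponent g, Finset.mul_sum, map_sum]
  have h1 : ∀ i, homogeneousComponent n (f * homogeneousComponent i g) =
      if d + i = n then f * homogeneousComponent i g else 0 := fun i => by
    rw [homogeneousComponent_of_mem (hf.mul (homogeneousComponent_isHomogeneous i g))]
    simp only [eq_comm]
  simp only [h1]
  split_ifs with hdn
  · by_cases hn : n - d ∈ Finset.range (g.totalDegree + 1)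
    · rw [Finset.sum_eq_single_of_mem _ hn fun i _ hi => if_neg (by omega), if_pos (by omega)]
    · rw [homogeneousComponent_eq_zero _ _ (by simp at hn; omega), mul_zero]
      exact Finset.sum_eq_zero fun i hi => if_neg fun h => hn (by
        have : n - d = i := by omega
        rwa [this])
  · exact Finset.sum_eq_zero fun i _ => if_neg (by omega)

theorem dickson_isHomogeneous (p : ℕ) (k : Type*) [CommRing k] :
    (dickson p k).IsHomogeneous (p + 1) := by
  refine IsHomogeneous.sub ?_ ?_
  · exact (isHomogeneous_X_pow _ _).mul (isHomogeneous_X _ _)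
  · rw [add_comm]
    exact (isHomogeneous_X _ _).mul (isHomogeneous_X_pow _ _)

/-- An element of `V_r^{(m)}` is `θ^m u` with `u` homogeneous. -/
theorem exists_eq_dickson_pow_mul {p r m : ℕ} (f : SymPow k r) (hf : f ∈ filtV p k r m) :
    ∃ u : MvPolynomial (Fin 2) k, f.poly = dickson p k ^ m * u ∧
      ((p + 1) * m ≤ r → u.IsHomogeneous (r - (p + 1) * m)) ∧ (r < (p + 1) * m → u = 0) := by
  obtain ⟨u, hu⟩ := hf
  have h1 := homogeneousComponent_mul_of_isHomogeneous ((dickson_isHomogeneous p k).pow m) u r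
  rw [← hu, homogeneousComponent_eq_self f.isHomogeneous] at h1
  split_ifs at h1 with h
  · exact ⟨_, h1, fun _ => homogeneousComponent_isHomogeneous _ _, fun h' => absurd h (by omega)⟩
  · exact ⟨0, by rw [h1, mul_zero], fun _ => isHomogeneous_zero _ _ _, fun _ => rfl⟩

variable [IsDomain k]

/-- A form vanishing at (1 : c) vanishes after the substitution y = c x, so y - c x divides it. The
factors for distinct points are split off one at a time; x is the factor of the point (0 : 1). -/
theorem X0_mul_prod_dvd (S : Finset k) {f : MvPolynomial (Fin 2) k} {n : ℕ}
    (hf : f.IsHomogeneous n) (h0 : eval ![0, 1] f = 0) (hS : ∀ c ∈ S, eval ![1, c] f = 0) :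
    X 0 * ∏ c ∈ S, (X 1 - C c * X 0) ∣ f := by
  classical
  have hzero : ∀ c ∈ S, aeval ![X 0, C c * X 0] f = (0 : MvPolynomial (Fin 2) k) := fun c hc => by
    have h1 := aeval_mul_C_of_isHomogeneous hf (X 0) ![1, c]
    rw [hS c hc, map_zero, mul_zero] at h1
    rw [← h1]
    congr 2
    funext i
    fin_cases i <;> simp [mul_comm]
  have hX : X 0 ∣ f := by
    have h1 := aeval_mul_C_of_isHomogeneous hf (X 1) ![0, 1]
    rw [h0, map_zero, mul_zero] at h1
    have h2 := dvd_sub_aeval (X 0 : MvPolynomial (Fin 2) k) (fun i => X 1 * C (![0, 1] i))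
      (fun i => by fin_cases i <;> simp) f
    rwa [h1, sub_zero] at h2
  obtain ⟨g, rfl⟩ := hX
  refine mul_dvd_mul_left _ ?_
  have hg : ∀ c ∈ S, aeval ![X 0, C c * X 0] g = (0 : MvPolynomial (Fin 2) k) := fun c hc => by
    have h1 := hzero c hc
    rw [map_mul, aeval_X] at h1
    exact (mul_eq_zero.1 h1).resolve_left (X_ne_zero _)
  clear hzero hS h0 hf
  induction S using Finset.induction_on generalizing g with
  | empty => simp
  | insert c S hcS ih =>
    have h2 := dvd_sub_aeval (X 1 - C c * X 0 : MvPolynomial (Fin 2) k) ![X 0, C c * X 0]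
      (fun i => by fin_cases i <;> simp) g
    rw [hg c (Finset.mem_insert_self _ _), sub_zero] at h2
    obtain ⟨g', rfl⟩ := h2
    rw [Finset.prod_insert hcS]
    refine mul_dvd_mul_left _ (ih g' fun c' hc' => ?_)
    have h3 := hg c' (Finset.mem_insert_of_mem hc')
    rw [map_mul] at h3
    have h4 : aeval ![X 0, C c' * X 0] (X 1 - C c * X 0 : MvPolynomial (Fin 2) k) =
        C (c' - c) * (X 0 : MvPolynomial (Fin 2) k) := by
      simp [sub_mul, algebraMap_eq]
    rw [h4] at h3
    refine (mul_eq_zero.1 h3).resolve_left ?_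
    refine mul_ne_zero (C_ne_zero.2 (sub_ne_zero.2 ?_)) (X_ne_zero _)
    rintro rfl
    exact hcS hc'

theorem dickson_ne_zero {p : ℕ} (hp : 1 < p) : dickson p k ≠ 0 := by
  intro h
  have h1 := congrArg (coeff (Finsupp.single 0 p + Finsupp.single 1 1)) h
  have e1 : (X 0 ^ p * X 1 : MvPolynomial (Fin 2) k) =
      monomial (Finsupp.single 0 p + Finsupp.single 1 1) 1 := by
    rw [X_pow_eq_monomial, X, monomial_mul, one_mul]
  have e2 : (X 0 * X 1 ^ p : MvPolynomial (Fin 2) k) =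
      monomial (Finsupp.single 0 1 + Finsupp.single 1 p) 1 := by
    rw [X_pow_eq_monomial, X, monomial_mul, one_mul]
  rw [dickson, e1, e2, coeff_sub, coeff_monomial, coeff_monomial, if_pos rfl, if_neg, coeff_zero,
    sub_zero] at h1
  · exact one_ne_zero h1
  · intro h2
    have := DFunLike.congr_fun h2 0
    simp at this
    omega

/-- A form which vanishes at the points of `P¹(𝔽_p)` is divisible by `θ`. -/
theorem dickson_dvd {k : Type*} [Field k] {p : ℕ} (hp : 1 < p) (S : Finset k) (hS : S.card = p)
    (hSp : ∀ c ∈ S, c ^ p = c) {f : MvPolynomial (Fin 2) k} {n : ℕ}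
    (hf : f.IsHomogeneous n) (h0 : eval ![0, 1] f = 0) (hf1 : ∀ c ∈ S, eval ![1, c] f = 0) :
    dickson p k ∣ f := by
  have h1 := X0_mul_prod_dvd S hf h0 hf1
  have h2 := X0_mul_prod_dvd S (dickson_isHomogeneous p k) (by
    simp [dickson]; omega) (fun c hc => by simp [dickson, hSp c hc])
  refine Dvd.dvd.trans ?_ h1
  obtain ⟨q, hq⟩ := h2
  have hθ := dickson_ne_zero (k := k) hp
  have hP0 : X 0 * ∏ c ∈ S, (X 1 - C c * X 0) ≠ (0 : MvPolynomial (Fin 2) k) := fun h => by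
    rw [h, zero_mul] at hq; exact hθ hq
  have hq0 : q ≠ 0 := fun h => by rw [h, mul_zero] at hq; exact hθ hq
  have hP : (X 0 * ∏ c ∈ S, (X 1 - C c * X 0) : MvPolynomial (Fin 2) k).IsHomogeneous (1 + p) := by
    refine (isHomogeneous_X _ _).mul ?_
    have := IsHomogeneous.prod S (fun c => (X 1 - C c * X 0 : MvPolynomial (Fin 2) k)) (fun _ => 1)
      fun c _ => (isHomogeneous_X _ _).sub (isHomogeneous_C_mul_X _ _)
    rwa [Finset.sum_const, smul_eq_mul, mul_one, hS] at this
  -- θ and the product of the p + 1 linear forms have equal degree, so their quotient is a nonzero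
  -- constant.
  have hdeg := congrArg totalDegree hq
  rw [totalDegree_mul_of_isDomain hP0 hq0, (dickson_isHomogeneous p k).totalDegree hθ,
    hP.totalDegree hP0] at hdeg
  have hq1 : q = C (coeff 0 q) := totalDegree_eq_zero_iff_eq_C.1 (by omega)
  have hc : coeff 0 q ≠ 0 := fun h => hq0 (by rw [hq1, h, map_zero])
  refine ⟨C (coeff 0 q)⁻¹, ?_⟩
  have hqc : q * C (coeff 0 q)⁻¹ = 1 := by
    calc q * C (coeff 0 q)⁻¹ = C (coeff 0 q) * C (coeff 0 q)⁻¹ := congrArg (· * _) hq1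
      _ = 1 := by rw [← map_mul, mul_inv_cancel₀ hc, map_one]
  rw [hq, mul_assoc, hqc, mul_one]

end Divisibility

/-! ### Generators of the graded pieces -/

section Generators

open MvPolynomial

variable {p : ℕ} [Fact p.Prime] {k : Type*} [Field k] (φ : ℤ_[p] →+* k) {r m : ℕ}

theorem hom_ne_zero_of_toZMod_ne_zero {z : ℤ_[p]} (hz : PadicInt.toZMod z ≠ 0) : φ z ≠ 0 :=
  ((isUnit_of_toZMod_ne_zero p hz).map φ).ne_zero

theorem hom_teich_injective : Function.Injective fun l : ZMod p => φ (teich p l) := by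
  intro l l' h
  by_contra hne
  refine hom_ne_zero_of_toZMod_ne_zero φ (z := teich p l - teich p l') ?_ ?_
  · rw [map_sub, toZMod_teich, toZMod_teich]
    exact sub_ne_zero.2 hne
  · rw [map_sub, sub_eq_zero]; exact h

theorem eval_polyAct {k : Type*} [CommRing k] (a b c d : k) (v : Fin 2 → k)
    (f : MvPolynomial (Fin 2) k) :
    eval v (polyAct !![a, b; c, d] f) = eval ![a * v 0 + c * v 1, b * v 0 + d * v 1] f := by
  have h : (eval v).comp (polyAct !![a, b; c, d]).toRingHom =
      eval ![a * v 0 + c * v 1, b * v 0 + d * v 1] := by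
    apply MvPolynomial.ringHom_ext
    · intro z
      change eval v (polyAct _ (C z)) = _
      rw [← algebraMap_eq, AlgHom.commutes, algebraMap_eq, eval_C, eval_C]
    · intro i
      change eval v (polyAct _ (X i)) = _
      fin_cases i
      · change eval v (polyAct _ (X 0)) = _
        rw [polyAct_X0]; simp
      · change eval v (polyAct _ (X 1)) = _
        rw [polyAct_X1]; simp
  exact RingHom.congr_fun h f

variable [CharP k p]

/-- A subrepresentation of `V_r` which contains `θ^m h`, where `h` vanishes at exactly all but one
of the points of `P¹(𝔽_p)`, generates `V_r^{(m)}` modulo `V_r^{(m+1)}`. -/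
theorem filtV_le_sup (W : Submodule k (SymPow k r))
    (hW : ∀ g, ∀ v ∈ W, symRep p φ r g v ∈ W) {h : MvPolynomial (Fin 2) ℤ_[p]} {n : ℕ}
    (hh : h.IsHomogeneous n) (hr : r = (p + 1) * m + n)
    (hmem : symLift p φ r (dickson p ℤ_[p] ^ m * h) ∈ W)
    (h01 : eval ![0, 1] (map φ h) = 1) (h1 : ∀ z, eval ![1, φ z] (map φ h) = 0)
    (hz : ∀ z, PadicInt.toZMod z ≠ 0 → eval ![φ z, 1] (map φ h) = 0) :
    filtV p k r m ≤ W ⊔ filtV p k r (m + 1) := by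
  classical
  intro f hf
  obtain ⟨u, hu, hu1, -⟩ := exists_eq_dickson_pow_mul f hf
  replace hu1 := hu1 (by omega)
  have hn : r - (p + 1) * m = n := by omega
  rw [hn] at hu1
  -- This matrix moves (1 : [l]) to (0 : 1), the only point where h does not vanish. Its determinant
  -- -1 is the source of the signs (-1)^m below.
  have hex : ∀ l : ZMod p, ∃ κ : GL (Fin 2) ℤ_[p],
      (κ : Matrix (Fin 2) (Fin 2) ℤ_[p]) = !![-teich p l, 1; 1, 0] := fun l =>
    exists_GL_of_det p _ (by rw [Matrix.det_fin_two_of]; simp)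
  choose κ hκ using hex
  set v := symLift p φ r (dickson p ℤ_[p] ^ m * h) with hv
  have hdick : map φ (dickson p ℤ_[p]) = dickson p k := by simp [dickson]
  have hhom : (dickson p ℤ_[p] ^ m * h).IsHomogeneous r := by
    rw [hr]; exact ((dickson_isHomogeneous p _).pow m).mul hh
  have hvp : v.poly = dickson p k ^ m * map φ h := by
    rw [hv, poly_symLift _ hhom, map_mul, map_pow, hdick]
  have hact : ∀ l, (symRep p φ r (κ l, 1) v).poly =
      (-1) ^ m * (dickson p k ^ m * polyAct !![-φ (teich p l), 1; 1, 0] (map φ h)) := fun l => by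
    rw [symRep_apply, symAct_poly, hvp, map_mul, map_pow, polyAct_dickson]
    have e : (κ l : Matrix (Fin 2) (Fin 2) ℤ_[p]).map φ = !![-φ (teich p l), 1; 1, 0] := by
      rw [hκ]
      ext i j
      fin_cases i <;> fin_cases j <;> simp
    rw [e, hκ, Matrix.det_fin_two_of]
    simp only [mul_zero, mul_one, zero_sub, map_neg, map_one, mul_pow]
    ring
  -- Interpolation: h and its translates are the indicator functions of the vectors (0, 1) and (1,
  -- [l]). So u minus the cofactor of θ^m in `x` vanishes on P¹(F_p) and is divisible by θ.
  set x : SymPow k r := eval ![0, 1] u • v +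
    ∑ l : ZMod p, ((-1) ^ m * eval ![1, φ (teich p l)] u) • symRep p φ r (κ l, 1) v with hx
  have hxW : x ∈ W := by
    refine W.add_mem (W.smul_mem _ hmem) (W.sum_mem fun l _ => W.smul_mem _ (hW _ _ hmem))
  set u' : MvPolynomial (Fin 2) k := u - (C (eval ![0, 1] u) * map φ h +
    ∑ l : ZMod p, C (eval ![1, φ (teich p l)] u) *
      polyAct !![-φ (teich p l), 1; 1, 0] (map φ h)) with hu'
  have hsq : ((-1 : MvPolynomial (Fin 2) k) ^ m) * (-1) ^ m = 1 := by
    rw [← mul_pow]; simp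
  have hfx : (f - x).poly = dickson p k ^ m * u' := by
    rw [map_sub, hx, map_add, map_sum, hu, map_smul, hvp, hu', mul_sub, mul_add, Finset.mul_sum,
      smul_eq_C_mul]
    congr 2
    · ring
    · refine Finset.sum_congr rfl fun l _ => ?_
      rw [map_smul, hact, smul_eq_C_mul, map_mul, map_pow, map_neg, map_one]
      linear_combination (C (eval ![1, φ (teich p l)] u) * dickson p k ^ m *
        polyAct !![-φ (teich p l), 1; 1, 0] (map φ h)) * hsq
  have hdvd : dickson p k ∣ u' := by
    have hp := (Fact.out : p.Prime)
    refine dickson_dvd hp.one_lt (Finset.univ.image fun l : ZMod p => φ (teich p l)) ?_ ?_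
      (n := n) ?_ ?_ ?_
    · rw [Finset.card_image_of_injective _ (hom_teich_injective φ), Finset.card_univ, ZMod.card]
    · intro c hc
      obtain ⟨l, -, rfl⟩ := Finset.mem_image.1 hc
      exact padicInt_hom_pow p φ _
    · refine hu1.sub (((hh.map φ).C_mul _).add (IsHomogeneous.sum _ _ _ fun l _ => ?_))
      exact (polyAct_isHomogeneous _ (hh.map φ)).C_mul _
    · rw [hu', map_sub, map_add, map_mul, eval_C, h01, mul_one, map_sum,
        Finset.sum_eq_zero, add_zero, sub_self]
      intro l _
      rw [map_mul, eval_polyAct]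
      have h10 := h1 0
      rw [map_zero] at h10
      simp only [Matrix.cons_val_zero, Matrix.cons_val_one, mul_zero, zero_add, mul_one]
      rw [h10, mul_zero]
    · intro c hc
      obtain ⟨l, -, rfl⟩ := Finset.mem_image.1 hc
      have h3 : ∀ l' : ZMod p, eval ![1, φ (teich p l)]
          (polyAct !![-φ (teich p l'), 1; 1, 0] (map φ h)) = if l' = l then 1 else 0 := by
        intro l'
        rw [eval_polyAct]
        split_ifs with hl
        · refine Eq.trans ?_ h01
          congr 2
          funext i
          fin_cases i <;> simp [hl]
        · refine Eq.trans ?_ (hz (teich p l - teich p l') ?_)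
          · congr 2
            funext i
            fin_cases i <;> simp [add_comm, sub_eq_add_neg]
          · rw [map_sub, toZMod_teich, toZMod_teich]
            exact sub_ne_zero.2 (Ne.symm hl)
      have h4 : eval ![1, φ (teich p l)] (map φ h) = 0 := h1 _
      rw [hu', map_sub, map_add, map_mul, eval_C, h4, mul_zero, zero_add, map_sum,
        Finset.sum_eq_single l]
      · rw [map_mul, eval_C, h3, if_pos rfl, mul_one, sub_self]
      · intro l' _ hl'
        rw [map_mul, h3, if_neg hl', mul_zero]
      · simp
  rw [← add_sub_cancel x f]
  refine Submodule.add_mem_sup hxW ?_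
  change dickson p k ^ (m + 1) ∣ (f - x).poly
  rw [hfx, pow_succ]
  exact mul_dvd_mul_left _ hdvd

end Generators

/-! ### Sums of powers of Teichmüller representatives -/

section TeichSums

variable (p : ℕ) [Fact p.Prime]

/-- The Teichmüller character `𝔽_p^× → ℤ_p^×`, with values in `ℤ_p`. -/
def teichHom : (ZMod p)ˣ →* ℤ_[p] :=
  (((WittVector.equiv p : WittVector p (ZMod p) ≃+* ℤ_[p]) : WittVector p (ZMod p) →* ℤ_[p]).comp
    (WittVector.teichmuller p)).comp (Units.coeHom _)

theorem teichHom_apply (l : (ZMod p)ˣ) : teichHom p l = teich p l := rfl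

theorem sum_teich_pow (k : ℕ) :
    ∑ l : (ZMod p)ˣ, teich p l ^ k = if p - 1 ∣ k then ((p - 1 : ℕ) : ℤ_[p]) else 0 := by
  classical
  have h := sum_hom_units (teichHom p ^ k)
  simp only [MonoidHom.pow_apply, teichHom_apply] at h
  rw [h]
  have hiff : teichHom p ^ k = 1 ↔ p - 1 ∣ k := by
    have h0 := FiniteField.forall_pow_eq_one_iff (ZMod p) k
    rw [ZMod.card] at h0
    rw [← h0]
    constructor
    · intro h x
      have h1 := congrArg PadicInt.toZMod (DFunLike.congr_fun h x)
      rw [MonoidHom.pow_apply, teichHom_apply, map_pow, toZMod_teich, MonoidHom.one_apply,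
        map_one] at h1
      exact Units.ext (by rw [Units.val_pow_eq_pow_val, h1, Units.val_one])
    · intro h
      ext1 x
      rw [MonoidHom.pow_apply, ← map_pow, h, map_one, MonoidHom.one_apply]
  simp only [hiff, ZMod.card_units]
  split_ifs <;> simp

end TeichSums

/-! ### Integral combinations of translates of monomials -/

section MonoSpan

open MvPolynomial

variable (p : ℕ) [Fact p.Prime]

/-- The `ℤ_p`-module generated by the `GL₂(ℤ_p)`-translates of the forms `p x^i y^(s-i)` for `i ≤ C`
and `x^i y^(s-i)` for `i < C`. -/
def monoSpan (s C : ℕ) : Submodule ℤ_[p] (MvPolynomial (Fin 2) ℤ_[p]) :=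
  Submodule.span ℤ_[p] {q | ∃ (g : GL (Fin 2) ℤ_[p]) (e i : ℕ), e ≤ 1 ∧ i + 1 ≤ C + e ∧ i ≤ s ∧
    q = (p : ℤ_[p]) ^ e • polyAct (g : Matrix (Fin 2) (Fin 2) ℤ_[p]) (X 0 ^ i * X 1 ^ (s - i))}

variable {p} {s C : ℕ}

theorem monoSpan_mono {C' : ℕ} (h : C ≤ C') : monoSpan p s C ≤ monoSpan p s C' := by
  refine Submodule.span_mono ?_
  rintro _ ⟨g, e, i, he, hi, his, rfl⟩
  exact ⟨g, e, i, he, by omega, his, rfl⟩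

theorem smul_polyAct_mem_monoSpan {M : Matrix (Fin 2) (Fin 2) ℤ_[p]} (hM : IsUnit M.det)
    {e i : ℕ} (he : e ≤ 1) (hi : i + 1 ≤ C + e) (his : i ≤ s) :
    (p : ℤ_[p]) ^ e • polyAct M (X 0 ^ i * X 1 ^ (s - i)) ∈ monoSpan p s C := by
  obtain ⟨g, rfl⟩ := exists_GL_of_det p M hM
  exact Submodule.subset_span ⟨g, e, i, he, hi, his, rfl⟩

theorem smul_monomial_mem_monoSpan {e i : ℕ} (he : e ≤ 1)
    (hi : i + 1 ≤ C + e ∨ s - i + 1 ≤ C + e) (his : i ≤ s) :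
    (p : ℤ_[p]) ^ e • (X 0 ^ i * X 1 ^ (s - i) : MvPolynomial (Fin 2) ℤ_[p]) ∈
      monoSpan p s C := by
  rcases hi with hi | hi
  · have := smul_polyAct_mem_monoSpan (p := p) (M := 1) (by simp) he hi his
    rwa [polyAct_one, AlgHom.id_apply] at this
  · have := smul_polyAct_mem_monoSpan (p := p) (M := !![0, 1; 1, 0])
      (by rw [Matrix.det_fin_two_of]; simp) he hi (Nat.sub_le s i)
    rw [map_mul, map_pow, map_pow, polyAct_X0, polyAct_X1, Nat.sub_sub_self his] at this
    simpa [mul_comm] using this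

/-- The average of the translates of `x^i y^(s-i)` by the matrices `(1 [l]; 0 1)`. -/
theorem sum_teich_polyAct (i s m : ℕ) (h : i ≤ s) :
    ∑ l : (ZMod p)ˣ, teich p l ^ m • polyAct !![1, teich p l; 0, 1]
        (X 0 ^ i * X 1 ^ (s - i) : MvPolynomial (Fin 2) ℤ_[p]) =
      ∑ J ∈ Finset.Icc i s, (((s - i).choose (J - i) : ℤ_[p]) *
        ∑ l : (ZMod p)ˣ, teich p l ^ (m + (J - i))) • (X 0 ^ J * X 1 ^ (s - J)) := by
  have h1 : ∀ l : (ZMod p)ˣ, teich p l ^ m • polyAct !![1, teich p l; 0, 1]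
        (X 0 ^ i * X 1 ^ (s - i) : MvPolynomial (Fin 2) ℤ_[p]) =
      ∑ J ∈ Finset.Icc i s, (((s - i).choose (J - i) : ℤ_[p]) *
        teich p l ^ (m + (J - i))) • (X 0 ^ J * X 1 ^ (s - J)) := by
    intro l
    rw [map_mul, map_pow, map_pow, polyAct_X0, polyAct_X1, map_zero, zero_mul, add_zero,
      add_pow, Finset.mul_sum, Finset.smul_sum,
      ← Finset.Ico_add_one_right_eq_Icc, Finset.sum_Ico_eq_sum_range,
      show s + 1 - i = s - i + 1 by omega]
    refine Finset.sum_congr rfl fun k hk => ?_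
    have hk' : k ≤ s - i := by simpa [Nat.lt_succ_iff] using hk
    rw [Nat.add_sub_cancel_left, show s - (i + k) = s - i - k by omega]
    simp only [smul_eq_C_mul, map_mul, map_pow, map_natCast, map_one,
      one_mul]
    ring
  simp only [h1]
  rw [Finset.sum_comm]
  refine Finset.sum_congr rfl fun J _ => ?_
  rw [Finset.mul_sum, Finset.sum_smul]

/-- Multiplication by a falling factorial of s turns the coefficients of `sum_teich_polyAct` into
the common factor `s.choose J` times a polynomial of degree i in J, so that different i can be
combined. -/
theorem descFactorial_mul_choose {i J s : ℕ} (h : i ≤ J) :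
    s.descFactorial i * (s - i).choose (J - i) = J.descFactorial i * s.choose J := by
  rw [Nat.descFactorial_eq_factorial_mul_choose, Nat.descFactorial_eq_factorial_mul_choose,
    mul_assoc, ← Nat.choose_mul h]
  ring

/-- A product of linear factors is an integral combination of falling factorials. -/
theorem exists_prod_sub_eq_sum_descFactorial (S : Finset ℕ) :
    ∃ β : ℕ → ℤ, ∀ J : ℕ, ∏ e ∈ S, ((J : ℤ) - e) =
      ∑ i ∈ Finset.range (S.card + 1), β i * J.descFactorial i := by
  classical
  induction S using Finset.induction_on with
  | empty => exact ⟨fun _ => 1, fun J => by simp⟩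
  | insert e S he ih =>
    obtain ⟨β, hβ⟩ := ih
    -- Multiply by J - e = (J - i) + (i - e): the first part raises the falling factorial of index i
    -- to index i + 1, the second keeps it. The zeros mark the two ends of the range.
    refine ⟨fun i => (if i = 0 then 0 else β (i - 1)) +
      (if i ≤ S.card then β i * (i - e) else 0), fun J => ?_⟩
    rw [Finset.prod_insert he, hβ, Finset.card_insert_of_notMem he, Finset.mul_sum]
    simp only [add_mul, Finset.sum_add_distrib]
    rw [Finset.sum_range_succ' _ (S.card + 1), Finset.sum_range_succ _ (S.card + 1)]
    have h1 : ∀ i, ((J : ℤ) - i) * J.descFactorial i = J.descFactorial (i + 1) := by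
      intro i
      rw [Nat.descFactorial_succ]
      by_cases hi : i ≤ J
      · push_cast [Nat.cast_sub hi]; ring
      · rw [Nat.descFactorial_eq_zero_iff_lt.2 (by omega)]; simp
    simp only [if_true, zero_mul, add_zero, Nat.succ_ne_zero, if_false, Nat.add_sub_cancel,
      show ¬ (S.card + 1 ≤ S.card) by omega]
    rw [← Finset.sum_add_distrib]
    refine Finset.sum_congr rfl fun i hi => ?_
    rw [if_pos (by simpa [Nat.lt_succ_iff] using hi), ← h1]
    ring

/-- If all binomial coefficients in the residue class of `J` modulo `p - 1`, apart from the one at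
`J` and those in a small set `S`, belong to monomials in `monoSpan`, then the monomial at `J` is
there up to a factor `p`. -/
theorem prime_mul_monomial_mem_monoSpan {J κ w : ℕ} (hJ : J ≤ s) (hκ : κ ≤ 1) (hw : ¬ p ∣ w)
    (hchoose : p ^ (1 - κ) * s.choose J = p * w) (S : Finset ℕ)
    (hS : ∀ e ∈ S, ¬ (p : ℤ) ∣ (J : ℤ) - e)
    (hcov : ∀ J' ≤ s, J' ≡ J [MOD p - 1] → J' ≠ J → J' ∉ S → J' + κ ≤ C ∨ s - J' + κ ≤ C)
    (hcard : ∀ i ≤ S.card, i + κ ≤ C ∨ (κ = 1 ∧ i ≤ C ∧ p ∣ s.descFactorial i)) :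
    (p : ℤ_[p]) • (X 0 ^ J * X 1 ^ (s - J) : MvPolynomial (Fin 2) ℤ_[p]) ∈ monoSpan p s C := by
  have hp := (Fact.out : p.Prime)
  obtain ⟨β, hβ⟩ := exists_prod_sub_eq_sum_descFactorial S
  -- The weight is [l]^(i - J), with (p - 2) J in place of -J modulo p - 1 to avoid negative
  -- exponents. Only exponents congruent to J modulo p - 1 survive the sum.
  set A : ℕ → MvPolynomial (Fin 2) ℤ_[p] := fun i => ∑ l : (ZMod p)ˣ,
    teich p l ^ ((p - 2) * J + i) • polyAct !![1, teich p l; 0, 1] (X 0 ^ i * X 1 ^ (s - i))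
    with hA
  set c : ℕ → ℤ_[p] := fun J' => ∑ l : (ZMod p)ˣ, teich p l ^ ((p - 2) * J + J') with hc
  have hAmem : ∀ e i, e ≤ 1 → i + 1 ≤ C + e → i ≤ s → (p : ℤ_[p]) ^ e • A i ∈ monoSpan p s C := by
    intro e i he hi his
    rw [hA, Finset.smul_sum]
    refine Submodule.sum_mem _ fun l _ => ?_
    rw [smul_comm]
    exact Submodule.smul_mem _ _ (smul_polyAct_mem_monoSpan
      (by rw [Matrix.det_fin_two_of]; simp) he hi his)
  have hAeq : ∀ i ≤ s, (s.descFactorial i : ℤ_[p]) • A i = ∑ J' ∈ Finset.range (s + 1),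
      ((J'.descFactorial i : ℤ_[p]) * s.choose J' * c J') • (X 0 ^ J' * X 1 ^ (s - J')) := by
    intro i hi
    rw [hA]
    simp only
    rw [sum_teich_polyAct i s _ hi, Finset.smul_sum]
    have hsub : Finset.Icc i s ⊆ Finset.range (s + 1) := fun J' hJ' => by
      simp at hJ' ⊢; omega
    rw [← Finset.sum_subset hsub]
    · refine Finset.sum_congr rfl fun J' hJ' => ?_
      have hJi := (Finset.mem_Icc.1 hJ').1
      rw [smul_smul, ← mul_assoc, ← Nat.cast_mul, descFactorial_mul_choose hJi, Nat.cast_mul]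
      have : (p - 2) * J + i + (J' - i) = (p - 2) * J + J' := by omega
      rw [this]
    · intro J' h1 h2
      have : J' < i := by simp at h1 h2; omega
      rw [Nat.descFactorial_eq_zero_iff_lt.2 this]
      simp
  -- For κ = 0 the extra factor p makes the index i = C available. For κ = 1 there is none to spare,
  -- and i = C is allowed only when the falling factorial of s supplies it.
  have hsum : (p : ℤ_[p]) ^ (1 - κ) • ∑ i ∈ Finset.range (S.card + 1), (β i : ℤ_[p]) •
      (s.descFactorial i : ℤ_[p]) • A i ∈ monoSpan p s C := by
    rw [Finset.smul_sum]
    refine Submodule.sum_mem _ fun i hi => ?_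
    have hi' : i ≤ S.card := by simpa [Nat.lt_succ_iff] using hi
    rw [smul_comm]
    refine Submodule.smul_mem _ _ ?_
    by_cases his : i ≤ s
    · rcases hcard i hi' with h1 | ⟨h1, h2, x, hx⟩
      · rw [smul_comm]
        exact Submodule.smul_mem _ _ (hAmem _ _ (by omega) (by omega) his)
      · rw [hx, h1, Nat.sub_self, pow_zero, one_smul, Nat.cast_mul, mul_comm, mul_smul]
        have := hAmem 1 i le_rfl (by omega) his
        rw [pow_one] at this
        exact Submodule.smul_mem _ _ this
    · rw [Nat.descFactorial_eq_zero_iff_lt.2 (by omega)]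
      simp
  -- The combination of falling factorials is the product of the J' - e, which vanishes at the
  -- unwanted exponents.
  have hsum' : ∑ i ∈ Finset.range (S.card + 1), (β i : ℤ_[p]) •
      (s.descFactorial i : ℤ_[p]) • A i = ∑ J' ∈ Finset.range (s + 1),
      (((∏ e ∈ S, ((J' : ℤ) - e) : ℤ) : ℤ_[p]) * s.choose J' * c J') •
        (X 0 ^ J' * X 1 ^ (s - J')) := by
    have h1 : ∀ i ∈ Finset.range (S.card + 1), (β i : ℤ_[p]) • (s.descFactorial i : ℤ_[p]) • A i =
        ∑ J' ∈ Finset.range (s + 1),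
          ((β i : ℤ_[p]) * ((J'.descFactorial i : ℤ_[p]) * s.choose J' * c J')) •
            (X 0 ^ J' * X 1 ^ (s - J') : MvPolynomial (Fin 2) ℤ_[p]) := by
      intro i _
      by_cases his : i ≤ s
      · rw [hAeq i his, Finset.smul_sum]
        simp only [smul_smul]
      · rw [Nat.descFactorial_eq_zero_iff_lt.2 (by omega), Nat.cast_zero, zero_smul, smul_zero]
        refine (Finset.sum_eq_zero fun J' hJ' => ?_).symm
        have : J' < i := by simp at hJ'; omega
        rw [Nat.descFactorial_eq_zero_iff_lt.2 this]
        simp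
    rw [Finset.sum_congr rfl h1, Finset.sum_comm]
    refine Finset.sum_congr rfl fun J' _ => ?_
    rw [← Finset.sum_smul, hβ]
    congr 1
    push_cast
    rw [Finset.sum_mul, Finset.sum_mul]
    refine Finset.sum_congr rfl fun i _ => ?_
    ring
  have hc0 : ∀ J', ¬ J' ≡ J [MOD p - 1] → c J' = 0 := by
    intro J' h1
    rw [hc]
    simp only
    rw [sum_teich_pow, if_neg]
    intro h2
    apply h1
    have h3 : (p - 2) * J + J = (p - 1) * J := by
      rw [← Nat.succ_mul]; congr 1; have := hp.two_le; omega
    have h4 : (p - 2) * J + J' ≡ (p - 2) * J + J [MOD p - 1] := by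
      rw [h3]
      exact ((Nat.modEq_zero_iff_dvd.2 h2).trans
        (Nat.modEq_zero_iff_dvd.2 (dvd_mul_right _ _)).symm)
    exact Nat.ModEq.add_left_cancel' _ h4
  have hcJ : c J = ((p - 1 : ℕ) : ℤ_[p]) := by
    rw [hc]
    simp only
    rw [sum_teich_pow, if_pos]
    refine ⟨J, ?_⟩
    rw [← Nat.succ_mul]; congr 1; have := hp.two_le; omega
  rw [hsum', Finset.smul_sum, ← Finset.add_sum_erase _ _ (Finset.mem_range.2 (by omega : J < s + 1))]
    at hsum
  rw [Submodule.add_mem_iff_left] at hsum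
  -- The coefficient at J is p times P w (p - 1), and the last product is a unit.
  · set P : ℤ := ∏ e ∈ S, ((J : ℤ) - e) with hP
    have hPu : ¬ (p : ℤ) ∣ P := fun h =>
      let ⟨e, he, h1⟩ := ((Nat.prime_iff_prime_int.1 hp).dvd_finsetProd_iff _).1 h
      hS e he h1
    have hu : IsUnit ((P : ℤ_[p]) * (w : ℤ_[p]) * ((p - 1 : ℕ) : ℤ_[p])) := by
      apply isUnit_of_toZMod_ne_zero
      rw [map_mul, map_mul, map_intCast, map_natCast, map_natCast]
      refine mul_ne_zero (mul_ne_zero ?_ ?_) ?_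
      · rwa [Ne, ZMod.intCast_zmod_eq_zero_iff_dvd]
      · rwa [Ne, ZMod.natCast_eq_zero_iff]
      · rw [Ne, ZMod.natCast_eq_zero_iff]
        have := hp.two_le
        exact Nat.not_dvd_of_pos_of_lt (by omega) (by omega)
    obtain ⟨u, hu⟩ := hu
    have h1 := Submodule.smul_mem _ ((u⁻¹ : ℤ_[p]ˣ) : ℤ_[p]) hsum
    rw [smul_smul, smul_smul, hcJ] at h1
    convert h1 using 2
    have h2 : (p : ℤ_[p]) ^ (1 - κ) * s.choose J = p * w := by exact_mod_cast hchoose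
    calc (p : ℤ_[p]) = ((u⁻¹ : ℤ_[p]ˣ) : ℤ_[p]) * u * p := by simp
      _ = _ := by rw [hu]; linear_combination (-(((u⁻¹ : ℤ_[p]ˣ) : ℤ_[p]) * P * ((p - 1 : ℕ) : ℤ_[p]))) * h2
  · refine Submodule.sum_mem _ fun J' hJ' => ?_
    rw [Finset.mem_erase, Finset.mem_range] at hJ'
    have hJs : J' ≤ s := by omega
    by_cases hmod : J' ≡ J [MOD p - 1]
    · by_cases hJS : J' ∈ S
      · rw [Finset.prod_eq_zero hJS (sub_self _)]
        simp
      · rw [smul_comm]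
        refine Submodule.smul_mem _ _ (smul_monomial_mem_monoSpan (by omega) ?_ hJs)
        have := hcov J' hJs hmod hJ'.1 hJS
        omega
    · rw [hc0 J' hmod]
      simp

end MonoSpan

/-! ### Monomials in `monoSpan` -/

section BinomialArithmetic

open MvPolynomial

variable {p : ℕ} [Fact p.Prime]

/-- The exponent of p in `s.choose J` is at most log_p s, hence at most 1. -/
theorem exists_choose_eq_prime_mul {s J : ℕ} (hs : s < p ^ 2) (hJ : J ≤ s) (h : p ∣ s.choose J) :
    ∃ w, ¬ p ∣ w ∧ s.choose J = p * w := by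
  obtain ⟨w, hw⟩ := h
  refine ⟨w, fun hpw => ?_, hw⟩
  have hp := (Fact.out : p.Prime)
  have h1 : p ^ 2 ∣ s.choose J := by
    rw [hw, pow_two]; exact mul_dvd_mul_left p hpw
  have h2 := (hp.pow_dvd_iff_le_factorization (Nat.choose_pos hJ).ne').1 h1
  have h3 : (s.choose J).factorization p ≤ Nat.log p s := Nat.factorization_choose_le_log
  have h4 : Nat.log p s < 2 := Nat.log_lt_of_lt_pow' (by omega) hs
  omega

theorem not_prime_dvd_choose {n k : ℕ} (hn : n < p) (hk : k ≤ n) : ¬ p ∣ n.choose k := by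
  have hp := (Fact.out : p.Prime)
  intro h
  have h1 : p ∣ n.factorial := by
    rw [← Nat.choose_mul_factorial_mul_factorial hk]
    exact Dvd.dvd.mul_right (Dvd.dvd.mul_right h _) _
  have := hp.dvd_factorial.1 h1
  omega

/-- Lucas with two base-p digits; the leading digits b ≤ a < p contribute no factor p. -/
theorem prime_dvd_choose_iff {n k a b : ℕ} (hn : n < p) (hk : k < p) (ha : a < p) (hb : b ≤ a) :
    p ∣ (n + a * p).choose (k + b * p) ↔ n < k := by
  have hp := (Fact.out : p.Prime)
  have h := Choose.choose_modEq_choose_mod_mul_choose_div_nat (n := n + a * p) (k := k + b * p)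
    (p := p)
  rw [Nat.add_mul_mod_self_right, Nat.add_mul_mod_self_right, Nat.add_mul_div_right _ _ hp.pos,
    Nat.add_mul_div_right _ _ hp.pos, Nat.mod_eq_of_lt hn, Nat.mod_eq_of_lt hk, Nat.div_eq_of_lt hn,
    Nat.div_eq_of_lt hk, zero_add, zero_add] at h
  rw [h.dvd_iff dvd_rfl, hp.dvd_mul]
  constructor
  · rintro (h1 | h1)
    · by_contra h2
      exact not_prime_dvd_choose hn (by omega) h1
    · exact absurd h1 (not_prime_dvd_choose ha hb)
  · intro h1
    left
    rw [Nat.choose_eq_zero_of_lt h1]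
    exact dvd_zero _

/-- The product contains the factor (n + a p) - n. -/
theorem dvd_descFactorial_of_lt {p n a i : ℕ} (h : n < i) : p ∣ (n + a * p).descFactorial i := by
  induction i with
  | zero => omega
  | succ i ih =>
    rw [Nat.descFactorial_succ]
    rcases Nat.lt_succ_iff_lt_or_eq.1 h with h1 | h1
    · exact Dvd.dvd.mul_left (ih h1) _
    · rw [← h1, Nat.add_sub_cancel_left]
      exact Dvd.dvd.mul_right (dvd_mul_left _ _) _

theorem card_filter_modEq_le {A B J m n : ℕ} (hm : 0 < m) (h : ∀ x, x ≡ J [MOD m] → A ≤ x →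
    x < B → x < A + n * m) : ((Finset.Ico A B).filter (· ≡ J [MOD m])).card ≤ n := by
  rw [← Finset.card_range n]
  refine Finset.card_le_card_of_injOn (fun x => (x - A) / m) ?_ ?_
  · intro x hx
    simp only [Finset.coe_filter, Finset.mem_Ico, Set.mem_ofPred_eq] at hx
    have := h x hx.2 hx.1.1 hx.1.2
    simp only [Finset.coe_range, Set.mem_Iio]
    rw [Nat.div_lt_iff_lt_mul hm]
    omega
  · intro x hx y hy hxy
    simp only [Finset.coe_filter, Finset.mem_Ico, Set.mem_ofPred_eq] at hx hy hxy
    have h1 : x - A ≡ y - A [MOD m] := by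
      apply Nat.ModEq.add_right_cancel' A
      rw [Nat.sub_add_cancel hx.1.1, Nat.sub_add_cancel hy.1.1]
      exact hx.2.trans hy.2.symm
    have h2 : x - A = y - A := by
      rw [← Nat.div_add_mod (x - A) m, ← Nat.div_add_mod (y - A) m, hxy, h1]
    omega

theorem exists_eq_add_mul_of_modEq {J J' m : ℕ} (h : J' ≡ J [MOD m]) (hJ : J < m) :
    ∃ k, J' = J + k * m := by
  refine ⟨J' / m, ?_⟩
  have h1 : J' % m = J := by rw [h, Nat.mod_eq_of_lt hJ]
  rw [← h1, mul_comm, Nat.mod_add_div]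

/-- As p and p - 1 are coprime, J - J' would be a nonzero multiple of p (p - 1), too large for the
range. -/
theorem not_prime_dvd_sub_of_modEq {J J' : ℕ} (h : J' ≡ J [MOD p - 1]) (hne : J' ≠ J)
    (hJ : J < p * (p - 1)) (hJ' : J' < p * (p - 1)) : ¬ (p : ℤ) ∣ (J : ℤ) - J' := by
  have hp := (Fact.out : p.Prime)
  intro h1
  have hcop : IsCoprime (p : ℤ) ((p - 1 : ℕ) : ℤ) := by
    rw [Nat.isCoprime_iff_coprime]
    exact (Nat.coprime_self_sub_right hp.one_le).2 (Nat.coprime_one_right p)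
  have h2 := hcop.mul_dvd h1 ((Nat.modEq_iff_dvd.1 h))
  have h3 : (J : ℤ) - J' = 0 := by
    apply Int.eq_zero_of_abs_lt_dvd h2
    rw [← Nat.cast_mul, abs_lt]
    constructor <;> omega
  omega

variable {b c s : ℕ}

/-- The class of J consists of the J + k (p - 1). Those with 1 ≤ k ≤ n are removed by the product,
and those with k > n are close enough to s to be in `monoSpan` already. -/
theorem prime_mul_monomial_mem_monoSpan_of_progression {J κ w C n : ℕ} (hJs : J ≤ s)
    (hJp : J < p - 1) (hn : n < p) (hκ : κ ≤ 1) (hw : ¬ p ∣ w)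
    (hchoose : p ^ (1 - κ) * s.choose J = p * w)
    (hcov : ∀ k, n < k → J + k * (p - 1) ≤ s → s - (J + k * (p - 1)) + κ ≤ C)
    (hcard : ∀ i ≤ n, i + κ ≤ C ∨ (κ = 1 ∧ i ≤ C ∧ p ∣ s.descFactorial i)) :
    (p : ℤ_[p]) • (X 0 ^ J * X 1 ^ (s - J) : MvPolynomial (Fin 2) ℤ_[p]) ∈ monoSpan p s C := by
  classical
  refine prime_mul_monomial_mem_monoSpan hJs hκ hw hchoose
    ((Finset.Icc 1 n).image fun k => J + k * (p - 1)) ?_ ?_ fun i hi => hcard i (hi.trans ?_)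
  · intro e he
    obtain ⟨k, hk, rfl⟩ := Finset.mem_image.1 he
    rw [Finset.mem_Icc] at hk
    have hkp : (k + 1) * (p - 1) ≤ p * (p - 1) := Nat.mul_le_mul_right _ (by omega)
    rw [Nat.succ_mul] at hkp
    have : 0 < k * (p - 1) := Nat.mul_pos (by omega) (by omega)
    refine not_prime_dvd_sub_of_modEq (p := p) ?_ (by omega) (by omega) (by omega)
    exact (Nat.ModEq.refl J).add (Nat.modEq_zero_iff_dvd.2 (dvd_mul_left _ _))
  · intro J' hJ' hmod hne hnot
    obtain ⟨k, rfl⟩ := exists_eq_add_mul_of_modEq hmod hJp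
    right
    refine hcov k ?_ hJ'
    by_contra hk
    refine hnot (Finset.mem_image.2 ⟨k, Finset.mem_Icc.2 ⟨?_, by omega⟩, rfl⟩)
    by_contra hk0
    have : k = 0 := by omega
    exact hne (by rw [this]; simp)
  · exact Finset.card_image_le.trans (by simp)

/-- All exponents of the class between the two ends, except J, are removed. By `hcount` they fit in
C + 1 - κ steps of length p - 1, and J is one of them, so the degree of the product is at most C -
κ. -/
theorem prime_mul_monomial_mem_monoSpan_of_interval {J κ w C : ℕ} (hs : s < p * (p - 1))
    (hJs : J ≤ s) (hκ : κ ≤ 1) (hw : ¬ p ∣ w) (hchoose : p ^ (1 - κ) * s.choose J = p * w)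
    (hJ : C < J + κ) (hJ' : C < s - J + κ)
    (hcount : ∀ x, x ≡ J [MOD p - 1] → C + 1 - κ ≤ x → x + C < s + κ →
      x < (C + 1 - κ) + (C + 1 - κ) * (p - 1)) :
    (p : ℤ_[p]) • (X 0 ^ J * X 1 ^ (s - J) : MvPolynomial (Fin 2) ℤ_[p]) ∈ monoSpan p s C := by
  classical
  have hp := (Fact.out : p.Prime)
  set S := (Finset.Ico (C + 1 - κ) (s + κ - C)).filter (· ≡ J [MOD p - 1]) with hS
  have hmem : ∀ x, x ∈ S ↔ (C + 1 - κ ≤ x ∧ x < s + κ - C) ∧ x ≡ J [MOD p - 1] := fun x => by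
    rw [hS, Finset.mem_filter, Finset.mem_Ico]
  have hJS : J ∈ S := (hmem J).2 ⟨⟨by omega, by omega⟩, Nat.ModEq.refl J⟩
  have hScard : S.card ≤ C + 1 - κ := by
    refine card_filter_modEq_le (by have := hp.two_le; omega) fun x h1 h2 h3 => ?_
    exact hcount x h1 h2 (by omega)
  refine prime_mul_monomial_mem_monoSpan hJs hκ hw hchoose (S.erase J) ?_ ?_ ?_
  · intro e he
    rw [Finset.mem_erase, hmem] at he
    exact not_prime_dvd_sub_of_modEq he.2.2 he.1 (by omega) (by omega)
  · intro x hx hmod hne hnot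
    rw [Finset.mem_erase, hmem] at hnot
    by_contra hcon
    rw [not_or] at hcon
    exact hnot ⟨hne, ⟨by omega, by omega⟩, hmod⟩
  · intro i hi
    rw [Finset.card_erase_of_mem hJS] at hi
    left
    have := Finset.card_pos.2 ⟨J, hJS⟩
    omega

theorem lt_mul_pred_of_eq (hp5 : 5 ≤ p) (hbp : b ≤ p) (hc : c ≤ p - 2) (hs : s = b + c * (p - 1)) :
    s < p * (p - 1) := by
  obtain ⟨q, rfl⟩ : ∃ q, p = q + 2 := ⟨p - 2, by omega⟩
  simp only [Nat.add_sub_cancel, show q + 2 - 1 = q + 1 by omega] at *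
  nlinarith [Nat.mul_le_mul_right (q + 1) hc]

theorem prime_mul_monomial_mem_monoSpan_of_ne (hp5 : 5 ≤ p) (hb : 2 ≤ b) (hbp : b ≤ p)
    (hc : c ≤ p - 2) (hs : s = b + c * (p - 1)) (hbc : (b, c) ≠ (p, 0)) {J : ℕ} (hJ : J ≤ s) :
    (p : ℤ_[p]) • (X 0 ^ J * X 1 ^ (s - J) : MvPolynomial (Fin 2) ℤ_[p]) ∈ monoSpan p s c := by
  have hp := (Fact.out : p.Prime)
  have hsp := lt_mul_pred_of_eq hp5 hbp hc hs
  have hsp2 : s < p ^ 2 := by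
    rw [pow_two]
    exact hsp.trans_le (Nat.mul_le_mul_left _ (by omega))
  by_cases htriv : J ≤ c ∨ s - J ≤ c
  · have := smul_monomial_mem_monoSpan (p := p) (C := c) (e := 1) le_rfl (by omega) hJ
    rwa [pow_one] at this
  rw [not_or] at htriv
  by_cases hdvd : p ∣ s.choose J
  · obtain ⟨w, hw, hw'⟩ := exists_choose_eq_prime_mul hsp2 hJ hdvd
    refine prime_mul_monomial_mem_monoSpan_of_interval (κ := 1) hsp hJ le_rfl hw
      (by rw [hw']; simp) (by omega) (by omega) fun x hx h1 h2 => ?_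
    rw [Nat.add_sub_cancel] at h1 ⊢
    -- An exponent x beyond the bound forces the base-p digits of J to be at most those of s, so
    -- that p does not divide the binomial coefficient.
    by_contra hcon
    rw [not_lt] at hcon
    have hb2 : 2 * c ≤ b := by omega
    -- The exclusion of (p, 0) enters here: for c = 0 it gives s = b < p, and the binomial
    -- coefficient is prime to p.
    have hc0 : 0 < c := by
      rcases Nat.eq_zero_or_pos c with rfl | h
      · have : b ≠ p := fun h => hbc (by rw [h])
        exact absurd hdvd (not_prime_dvd_choose (by omega) hJ)
      · exact h
    have hcp : c ≤ c * (p - 1) := Nat.le_mul_of_pos_right _ (by omega)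
    obtain ⟨k, hk⟩ := exists_eq_add_mul_of_modEq (J' := J - c) (J := (J - c) % (p - 1))
      (Nat.mod_modEq _ _).symm (Nat.mod_lt _ (by omega))
    set j := (J - c) % (p - 1) with hj
    have hjp : j < p - 1 := Nat.mod_lt _ (by omega)
    have hkc : k ≤ c := by
      by_contra hkc
      have := Nat.mul_le_mul_right (p - 1) (by omega : c + 1 ≤ k)
      rw [Nat.succ_mul] at this
      omega
    have hkp : k * p = k * (p - 1) + k := by
      rw [← Nat.mul_succ]; congr 1; omega
    have hcpp : c * p = c * (p - 1) + c := by
      rw [← Nat.mul_succ]; congr 1; omega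
    have hxj : x ≡ c + j [MOD p - 1] := by
      refine hx.trans ?_
      have : J = c + j + k * (p - 1) := by omega
      rw [this]
      exact (Nat.ModEq.refl (c + j)).add (Nat.modEq_zero_iff_dvd.2 (dvd_mul_left _ _))
    -- c + j + c (p - 1) is the least member of the class from c p on; since x lies between c p and
    -- s - c, so does it.
    have hjb : j + c ≤ b - c := by
      by_contra hjb
      have h3 : x < c + j + c * (p - 1) := by omega
      have h4 : c + j + c * (p - 1) ≡ x + 0 [MOD p - 1] := by
        refine Nat.ModEq.trans ?_ hxj.symm
        exact (Nat.ModEq.refl (c + j)).add (Nat.modEq_zero_iff_dvd.2 (dvd_mul_left _ _))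
      have h5 : p - 1 ∣ c + j + c * (p - 1) - x := by
        rw [← Nat.modEq_iff_dvd' h3.le]; exact h4.symm
      have h6 := Nat.le_of_dvd (by omega) h5
      omega
    have h1 : s = (b - c) + c * p := by omega
    have h2 : J = (c + j - k) + k * p := by omega
    rw [h1, h2, prime_dvd_choose_iff (by omega) (by omega) (by omega) hkc] at hdvd
    omega
  · refine prime_mul_monomial_mem_monoSpan_of_interval (κ := 0) hsp hJ zero_le_one hdvd
      (by simp) (by omega) (by omega) fun x hx h1 h2 => ?_
    simp only [Nat.sub_zero] at h1 ⊢
    rw [Nat.succ_mul]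
    omega

/-- For 2 ≤ J ≤ p - 2 no other exponent up to p is congruent to J, so nothing has to be removed, and
p divides the binomial coefficient exactly once: averaging y^p suffices. -/
theorem prime_mul_monomial_mem_monoSpan_self (hp2 : 2 < p) {J : ℕ} (hJ : J ≤ p) :
    (p : ℤ_[p]) • (X 0 ^ J * X 1 ^ (p - J) : MvPolynomial (Fin 2) ℤ_[p]) ∈ monoSpan p p 1 := by
  have hp := (Fact.out : p.Prime)
  by_cases htriv : J ≤ 1 ∨ p - J ≤ 1
  · have := smul_monomial_mem_monoSpan (p := p) (s := p) (C := 1) (e := 1) le_rfl (by omega) hJ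
    rwa [pow_one] at this
  rw [not_or] at htriv
  obtain ⟨w, hw, hw'⟩ := exists_choose_eq_prime_mul (p := p) (s := p)
    (by have := Nat.mul_lt_mul_of_pos_left hp2 hp.pos; rw [pow_two]; omega) hJ
    (hp.dvd_choose_self (by omega) (by omega))
  refine prime_mul_monomial_mem_monoSpan_of_progression (κ := 1) (n := 0) hJ (by omega) hp.pos
    le_rfl hw (by rw [hw']; simp) (fun k hk hk' => ?_) fun i hi => by omega
  have := Nat.le_mul_of_pos_left (p - 1) hk
  omega

/-- Used when ε ≥ 1. The class of c consists of the c + k (p - 1) with k ≤ c. The base-p digits of s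
decide whether p divides the binomial coefficient, and the distance to s decides which of the last
exponents need not be removed. -/
theorem prime_mul_monomial_mem_monoSpan_pred (hp5 : 5 ≤ p) (hb : 2 ≤ b) (hbp : b ≤ p) (hc : c ≤ p - 2)
    (hs : s = b + c * (p - 1)) (hbc : b + 2 ≤ 2 * c) :
    (p : ℤ_[p]) • (X 0 ^ c * X 1 ^ (s - c) : MvPolynomial (Fin 2) ℤ_[p]) ∈
      monoSpan p s (c - 1) := by
  have hp := (Fact.out : p.Prime)
  have hsp := lt_mul_pred_of_eq hp5 hbp hc hs
  have hsp2 : s < p ^ 2 := by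
    rw [pow_two]
    exact hsp.trans_le (Nat.mul_le_mul_left _ (by omega))
  have hcp : c ≤ c * (p - 1) := Nat.le_mul_of_pos_right _ (by omega)
  have hcpp : c * p = c * (p - 1) + c := by
    rw [← Nat.mul_succ]; congr 1; omega
  have hc1 : (c - 1) * p + p = c * p := by
    rw [← Nat.succ_mul]; congr 1; omega
  have hc2 : (c - 1) * (p - 1) + (p - 1) = c * (p - 1) := by
    rw [← Nat.succ_mul]; congr 1; omega
  have hmono : ∀ k, c + 1 ≤ k → c * (p - 1) + (p - 1) ≤ k * (p - 1) := fun k hk => by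
    rw [← Nat.succ_mul]; exact Nat.mul_le_mul_right _ hk
  by_cases hcb : c ≤ b
  · have h1 : s = (b - c) + c * p := by omega
    have hdvd : p ∣ s.choose c := by
      have := prime_dvd_choose_iff (p := p) (n := b - c) (k := c) (a := c) (b := 0) (by omega)
        (by omega) (by omega) (by omega)
      rw [zero_mul, add_zero, ← h1] at this
      exact this.2 (by omega)
    obtain ⟨w, hw, hw'⟩ := exists_choose_eq_prime_mul hsp2 (by omega) hdvd
    refine prime_mul_monomial_mem_monoSpan_of_progression (κ := 1) (n := c - 1) (by omega)
      (by omega) (by omega) le_rfl hw (by rw [hw']; simp) (fun k hk hk' => ?_) fun i hi => ?_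
    · rcases Nat.lt_or_ge c k with h | h
      · have := hmono k h
        omega
      · have : k = c := by omega
        subst this
        omega
    -- The borderline degree c - 1 has a generator only with the factor p. The lower digit b - c of
    -- s is less than c - 1, so the falling factorial supplies it.
    · rcases Nat.lt_or_ge i (c - 1) with h | h
      · left; omega
      · right
        refine ⟨rfl, hi, ?_⟩
        rw [h1]
        exact dvd_descFactorial_of_lt (by omega)
  · have h1 : s = (b + p - c) + (c - 1) * p := by omega
    have hdvd : p ∣ s.choose c ↔ b + p - c < c := by
      have := prime_dvd_choose_iff (p := p) (n := b + p - c) (k := c) (a := c - 1) (b := 0)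
        (by omega) (by omega) (by omega) (by omega)
      rwa [zero_mul, add_zero, ← h1] at this
    by_cases hd : b + p - c < c
    · obtain ⟨w, hw, hw'⟩ := exists_choose_eq_prime_mul hsp2 (by omega) (hdvd.2 hd)
      refine prime_mul_monomial_mem_monoSpan_of_progression (κ := 1) (n := c - 2) (by omega)
        (by omega) (by omega) le_rfl hw (by rw [hw']; simp) (fun k hk hk' => ?_)
        fun i hi => by omega
      rcases Nat.lt_or_ge (c - 1) k with h | h
      · have := Nat.mul_le_mul_right (p - 1) (by omega : c ≤ k)
        omega
      · have : k = c - 1 := by omega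
        subst this
        omega
    · refine prime_mul_monomial_mem_monoSpan_of_progression (κ := 0) (n := c - 1)
        (by omega) (by omega) (by omega) zero_le_one (fun h => hd (hdvd.1 h)) (by simp)
        (fun k hk hk' => ?_) fun i hi => by omega
      have := Nat.mul_le_mul_right (p - 1) (by omega : c ≤ k)
      omega

/-- Used when ε = 2. The lower digit b + p - c of s is less than c - 2, so p divides both the
binomial coefficient at c - 1 and the falling factorial of the borderline degree c - 2. -/
theorem prime_mul_monomial_mem_monoSpan_pred_pred (hp5 : 5 ≤ p) (hb : 2 ≤ b) (hc : c ≤ p - 2)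
    (hs : s = b + c * (p - 1)) (hbc : b + p + 3 ≤ 2 * c) :
    (p : ℤ_[p]) • (X 0 ^ (c - 1) * X 1 ^ (s - (c - 1)) : MvPolynomial (Fin 2) ℤ_[p]) ∈
      monoSpan p s (c - 2) := by
  have hp := (Fact.out : p.Prime)
  have hsp := lt_mul_pred_of_eq hp5 (by omega) hc hs
  have hsp2 : s < p ^ 2 := by
    rw [pow_two]
    exact hsp.trans_le (Nat.mul_le_mul_left _ (by omega))
  have hcp : c ≤ c * (p - 1) := Nat.le_mul_of_pos_right _ (by omega)
  have hcpp : c * p = c * (p - 1) + c := by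
    rw [← Nat.mul_succ]; congr 1; omega
  have hc1 : (c - 1) * p + p = c * p := by
    rw [← Nat.succ_mul]; congr 1; omega
  have hc2 : (c - 1) * (p - 1) + (p - 1) = c * (p - 1) := by
    rw [← Nat.succ_mul]; congr 1; omega
  have h1 : s = (b + p - c) + (c - 1) * p := by omega
  have hdvd : p ∣ s.choose (c - 1) := by
    have := prime_dvd_choose_iff (p := p) (n := b + p - c) (k := c - 1) (a := c - 1) (b := 0)
      (by omega) (by omega) (by omega) (by omega)
    rw [zero_mul, add_zero, ← h1] at this
    exact this.2 (by omega)
  obtain ⟨w, hw, hw'⟩ := exists_choose_eq_prime_mul hsp2 (by omega) hdvd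
  refine prime_mul_monomial_mem_monoSpan_of_progression (κ := 1) (n := c - 2) (by omega)
    (by omega) (by omega) le_rfl hw (by rw [hw']; simp) (fun k hk hk' => ?_) fun i hi => ?_
  · rcases Nat.lt_or_ge (c - 1) k with h | h
    · have := Nat.mul_le_mul_right (p - 1) (by omega : c ≤ k)
      omega
    · have : k = c - 1 := by omega
      subst this
      omega
  · rcases Nat.lt_or_ge i (c - 2) with h | h
    · left; omega
    · right
      refine ⟨rfl, hi, ?_⟩
      rw [h1]
      exact dvd_descFactorial_of_lt (by omega)

end BinomialArithmetic

/-! ### Norms of elements of `ℚ̄_p` -/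

section SlopeVal

variable {p : ℕ} [Fact p.Prime]

theorem slopeVal_mul {x y : PadicAlgCl p} (hx : x ≠ 0) (hy : y ≠ 0) :
    slopeVal p (x * y) = slopeVal p x + slopeVal p y := by
  rw [slopeVal, norm_mul, Real.logb_mul (norm_ne_zero_iff.2 hx) (norm_ne_zero_iff.2 hy), slopeVal,
    slopeVal]
  ring

theorem slopeVal_inv (x : PadicAlgCl p) : slopeVal p x⁻¹ = -slopeVal p x := by
  rw [slopeVal, norm_inv, Real.logb_inv, slopeVal]

theorem prime_cast_ne_zero : (p : PadicAlgCl p) ≠ 0 :=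
  Nat.cast_ne_zero.2 (Fact.out : p.Prime).ne_zero

theorem slopeVal_prime_pow (k : ℕ) : slopeVal p ((p : PadicAlgCl p) ^ k) = k := by
  have h := slopeVal_p p
  rw [slopeVal] at h ⊢
  rw [norm_pow, Real.logb_pow, ← mul_neg, h, mul_one]

theorem norm_lt_one_of_slopeVal_pos {x : PadicAlgCl p} (h : 0 < slopeVal p x) : ‖x‖ < 1 := by
  have hp : (1 : ℝ) < p := by exact_mod_cast (Fact.out : p.Prime).one_lt
  by_contra hx
  rw [not_lt] at hx
  have := Real.logb_nonneg hp hx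
  rw [slopeVal] at h
  linarith

end SlopeVal

/-! ### Values of forms at the points of the projective line -/

section Values

open MvPolynomial

variable {p : ℕ} [Fact p.Prime] {k : Type*} [Field k] (φ : ℤ_[p] →+* k)

/-- A submodule which contains the forms `θ^m u` with `u` integral contains `V_r^{(m)}`. -/
theorem filtV_le_of_symLift_mem {r m : ℕ} (W : Submodule k (SymPow k r))
    (h : (p + 1) * m ≤ r → ∀ u : MvPolynomial (Fin 2) ℤ_[p],
      u.IsHomogeneous (r - (p + 1) * m) → symLift p φ r (dickson p ℤ_[p] ^ m * u) ∈ W) :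
    filtV p k r m ≤ W := by
  intro f hf
  obtain ⟨u, hu, hu1, hu2⟩ := exists_eq_dickson_pow_mul f hf
  by_cases hr : (p + 1) * m ≤ r
  · replace hu1 := hu1 hr
    have hmon : ∀ d ∈ u.support,
        (monomial d (1 : ℤ_[p])).IsHomogeneous (r - (p + 1) * m) := fun d hd => by
      refine isHomogeneous_monomial _ ?_
      rw [Finsupp.degree_eq_weight_one]
      exact hu1 (mem_support_iff.1 hd)
    have hf' : f = ∑ d ∈ u.support,
        coeff d u • symLift p φ r (dickson p ℤ_[p] ^ m * monomial d 1) := by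
      ext1
      rw [map_sum, hu]
      conv_lhs => rw [u.as_sum, Finset.mul_sum]
      refine Finset.sum_congr rfl fun d hd => ?_
      have hhom : (dickson p ℤ_[p] ^ m * monomial d (1 : ℤ_[p])).IsHomogeneous r := by
        have := ((dickson_isHomogeneous p ℤ_[p]).pow m).mul (hmon d hd)
        rwa [Nat.add_sub_cancel' hr] at this
      rw [map_smul, poly_symLift _ hhom, map_mul, map_pow, map_monomial, map_one, smul_eq_C_mul,
        mul_left_comm, C_mul_monomial, mul_one]
      congr 2
      simp [dickson]
    rw [hf']
    exact W.sum_mem fun d hd => W.smul_mem _ (h hr _ (hmon d hd))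
  · have : f = 0 := by
      ext1
      rw [hu, hu2 (by omega), mul_zero, map_zero]
    rw [this]
    exact W.zero_mem

theorem map_deltaForm (i n N : ℕ) : map φ (deltaForm p ℤ_[p] i n N) = deltaForm p k i n N := by
  simp [deltaForm]

theorem eval_unitForm_zero_one : eval ![0, 1] (map φ (unitForm p ℤ_[p])) = 1 := by
  have hp := (Fact.out : p.Prime).two_le
  simp [unitForm, show p - 1 ≠ 0 by omega, show p ≠ 0 by omega]

theorem eval_deltaForm_zero_one (n N : ℕ) :
    eval ![0, 1] (map φ (deltaForm p ℤ_[p] 0 n N)) = 1 := by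
  have hp := (Fact.out : p.Prime).two_le
  rw [map_deltaForm]
  simp [deltaForm, show p - 1 ≠ 0 by omega]

variable [CharP k p]

theorem hom_pow_pred_eq_one {z : ℤ_[p]} (h : φ z ≠ 0) : φ z ^ (p - 1) = 1 := by
  have hp := (Fact.out : p.Prime).one_le
  refine mul_right_cancel₀ h ?_
  rw [← pow_succ, Nat.sub_add_cancel hp, padicInt_hom_pow, one_mul]

theorem eval_deltaForm_one_hom {n N : ℕ} (hn : n ≠ 0) (hN : N ≠ 0) (z : ℤ_[p]) :
    eval ![1, φ z] (map φ (deltaForm p ℤ_[p] 0 n N)) = 0 := by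
  rw [map_deltaForm]
  by_cases h0 : φ z = 0
  · simp [deltaForm, h0, hn]
  · simp [deltaForm, hom_pow_pred_eq_one φ h0, hN]

theorem eval_deltaForm_hom_one {n N : ℕ} (hN : N ≠ 0) {z : ℤ_[p]} (hz : PadicInt.toZMod z ≠ 0) :
    eval ![φ z, 1] (map φ (deltaForm p ℤ_[p] 0 n N)) = 0 := by
  rw [map_deltaForm]
  simp [deltaForm, hom_pow_pred_eq_one φ (hom_ne_zero_of_toZMod_ne_zero φ hz), hN]

end Values

/-! ### Negligible functions -/

section Negligible

open MvPolynomial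

variable {p : ℕ} [Fact p.Prime] {r s e d : ℕ} {a : PadicAlgCl p}

theorem unitForm_pow_mul_isHomogeneous (hr : r = s + p * (p - 1) * (p ^ e * d))
    {q : MvPolynomial (Fin 2) ℤ_[p]} (hq : q.IsHomogeneous s) :
    (unitForm p ℤ_[p] ^ (p ^ e * d) * q).IsHomogeneous r := by
  rw [hr, add_comm]
  exact ((unitForm_isHomogeneous ℤ_[p]).pow _).mul hq

theorem monomial_isHomogeneous {i : ℕ} (hi : i ≤ s) :
    (X 0 ^ i * X 1 ^ (s - i) : MvPolynomial (Fin 2) ℤ_[p]).IsHomogeneous s := by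
  have := (isHomogeneous_X_pow (R := ℤ_[p]) (0 : Fin 2) i).mul
    (isHomogeneous_X_pow (R := ℤ_[p]) (1 : Fin 2) (s - i))
  rwa [Nat.add_sub_cancel' hi] at this

/-- Modulo negligible functions, translates of `x^i y^(r-i)` come from translates of
`x^i y^(s-i)`. -/
theorem single_smul_unitForm_mul_sub_mem_negl (ha : a ≠ 0)
    (hr : r = s + p * (p - 1) * (p ^ e * d)) {i : ℕ} (hi : i ≤ s) {c : PadicAlgCl p} (hc : c ≠ 0)
    (h1 : 0 < slopeVal p c - slopeVal p a + (min (e + 1) (s - i) : ℕ))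
    (g : Matrix (Fin 2) (Fin 2) ℤ_[p]) :
    single p r (c • symLift p (baseHom p (PadicAlgCl p)) r
      (unitForm p ℤ_[p] ^ (p ^ e * d) * polyAct g (X 0 ^ i * X 1 ^ (s - i)))) -
    single p r (c • symLift p (baseHom p (PadicAlgCl p)) r
      (polyAct g (X 0 ^ i * X 1 ^ (r - i)))) ∈ negl p r a := by
  rw [single, single, ← map_sub, ← smul_sub, ← map_sub]
  refine single_mem_negl p ha (k := min (e + 1) (s - i)) (norm_lt_one_of_slopeVal_pos ?_) ?_ ?_
  · rw [slopeVal_mul (mul_ne_zero hc (inv_ne_zero ha)) (pow_ne_zero _ prime_cast_ne_zero),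
      slopeVal_mul hc (inv_ne_zero ha), slopeVal_inv, slopeVal_prime_pow]
    linarith
  · exact (unitForm_pow_mul_isHomogeneous hr
      (polyAct_isHomogeneous _ (monomial_isHomogeneous hi))).sub
        (polyAct_isHomogeneous _ (monomial_isHomogeneous (by omega)))
  · intro M hM
    rw [C_prime_pow_eq]
    have := prime_pow_dvd_unitForm_mul_sub M g hM e d i (s - i)
    rwa [show s - i + p * (p - 1) * (p ^ e * d) = r - i by omega] at this

/-- The relation between `[α, c p^i x^i y^(r-i)]` and `[1, a c x^i y^n (y^(p-1) - x^(p-1))^N]`. -/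
theorem single_monomial_sub_deltaForm_mem_negl {i M : ℕ} (hM : M ≤ p - 1)
    (hiM : i + (i + M) * p ≤ r) {c : PadicAlgCl p} (hc : c ≠ 0)
    (h1 : 0 < slopeVal p c + i + M) :
    cIndRep (kzHom p) (symRep p (baseHom p (PadicAlgCl p)) r) (heckeElt p none)
      (single p r ((c * (p : PadicAlgCl p) ^ i) • symLift p (baseHom p (PadicAlgCl p)) r
        (X 0 ^ i * X 1 ^ (r - i)))) -
    single p r ((a * c) • symLift p (baseHom p (PadicAlgCl p)) r
      (deltaForm p ℤ_[p] i (r - i - (i + M) * (p - 1)) (i + M))) ∈ negl p r a := by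
  have hp := (Fact.out : p.Prime).one_le
  have e1 : (i + M) * p = (i + M) * (p - 1) + (i + M) := by
    rw [← Nat.mul_succ]; congr 1; omega
  have e2 : r - i - (i + M) * (p - 1) + (i + M) * (p - 1) = r - i := by omega
  -- The exponent of y in δ must be at least that of y^(p-1) - x^(p-1); `hM` serves to make the
  -- error p^(i+p-1) a multiple of p^(i+M).
  have hle : i + M ≤ r - i - (i + M) * (p - 1) := by omega
  generalize r - i - (i + M) * (p - 1) = n at *
  refine single_sub_mem_negl p (k := i + M) (norm_lt_one_of_slopeVal_pos ?_) ?_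
    (monomial_isHomogeneous (by omega)) (polyAct_heckeMat_zero_monomial _ _)
    (fun A h0 h1 => ?_) fun A hA h0 => ?_
  · rw [slopeVal_mul hc (pow_ne_zero _ prime_cast_ne_zero), slopeVal_prime_pow]
    push_cast
    linarith
  · have := deltaForm_isHomogeneous (p := p) ℤ_[p] i n (i + M)
    rwa [show i + n + (i + M) * (p - 1) = r by omega] at this
  · rw [C_prime_pow_eq, ← e2]
    exact (pow_dvd_pow _ (by omega)).trans (prime_pow_dvd_polyAct_deltaForm_sub A
      ((prime_dvd_polyAct_X0_iff A).2 ⟨h0, h1⟩) i n (i + M))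
  · rw [C_prime_pow_eq]
    exact prime_pow_dvd_polyAct_deltaForm A hA
      (fun h => h0 ((prime_dvd_polyAct_X0_iff A).1 h)) i hle

/-- With c p^(-i) in place of c, the translate by α of [1, c x^i y^(r-i)] is equivalent to [1, a c
p^(-i) δ], which is small by `h2`. Translating back by α⁻¹ concludes. -/
theorem single_smul_monomial_mem_negl {i M : ℕ} (ha : a ≠ 0) (hM : M ≤ p - 1)
    (hiM : i + (i + M) * p ≤ r) {c : PadicAlgCl p} (hc : c ≠ 0) (h1 : 0 < slopeVal p c + M)
    (h2 : 0 < slopeVal p c + slopeVal p a - i) :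
    single p r (c • symLift p (baseHom p (PadicAlgCl p)) r (X 0 ^ i * X 1 ^ (r - i))) ∈
      negl p r a := by
  have hp := (Fact.out : p.Prime).one_le
  have hpi : (p : PadicAlgCl p) ^ i ≠ 0 := pow_ne_zero _ prime_cast_ne_zero
  have hc' : c * ((p : PadicAlgCl p) ^ i)⁻¹ ≠ 0 := mul_ne_zero hc (inv_ne_zero hpi)
  have hval : slopeVal p (c * ((p : PadicAlgCl p) ^ i)⁻¹) = slopeVal p c - i := by
    rw [slopeVal_mul hc (inv_ne_zero hpi), slopeVal_inv, slopeVal_prime_pow]; ring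
  have h := single_monomial_sub_deltaForm_mem_negl (a := a) hM hiM hc' (by rw [hval]; linarith)
  rw [inv_mul_cancel_right₀ hpi] at h
  have e1 : (i + M) * p = (i + M) * (p - 1) + (i + M) := by
    rw [← Nat.mul_succ]; congr 1; omega
  have hsmall : single p r ((a * (c * ((p : PadicAlgCl p) ^ i)⁻¹)) •
      symLift p (baseHom p (PadicAlgCl p)) r
        (deltaForm p ℤ_[p] i (r - i - (i + M) * (p - 1)) (i + M))) ∈ negl p r a := by
    refine Submodule.mem_sup_right (single_mem_smallInd p r
      (smul_symLift_mem_smallPoly p (k := 0) (norm_lt_one_of_slopeVal_pos ?_) ?_ ?_))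
    · rw [pow_zero, mul_one, slopeVal_mul ha hc', hval]
      linarith
    · have := deltaForm_isHomogeneous (p := p) ℤ_[p] i (r - i - (i + M) * (p - 1)) (i + M)
      rwa [show i + (r - i - (i + M) * (p - 1)) + (i + M) * (p - 1) = r by omega] at this
    · rw [pow_zero, map_one]; exact one_dvd _
  have h3 := cIndRep_mem_negl p r a (heckeElt p none)⁻¹ ((Submodule.sub_mem_iff_left _ hsmall).1 h)
  rwa [← Module.End.mul_apply, ← map_mul, inv_mul_cancel, map_one, Module.End.one_apply] at h3

/-- Transports `monoSpan` from degree s to degree r. For each generator p^f x^i y^(s-i), the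
conditions ask that δ fits in degree r, that the monomial in degree r is negligible, and that the
error made by multiplying with E is negligible. -/
theorem single_smul_unitForm_mul_mem_negl {C M : ℕ} (ha : a ≠ 0) (hM : M ≤ p - 1)
    (hr : r = s + p * (p - 1) * (p ^ e * d)) {c : PadicAlgCl p} (hc : c ≠ 0)
    (h : ∀ f i, f ≤ 1 → i + 1 ≤ C + f → i ≤ s → i + (i + M) * p ≤ r ∧
      0 < slopeVal p c + f + M ∧ 0 < slopeVal p c + f + slopeVal p a - i ∧
      0 < slopeVal p c + f - slopeVal p a + (min (e + 1) (s - i) : ℕ))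
    {q : MvPolynomial (Fin 2) ℤ_[p]} (hq : q ∈ monoSpan p s C) :
    single p r (c • symLift p (baseHom p (PadicAlgCl p)) r
      (unitForm p ℤ_[p] ^ (p ^ e * d) * q)) ∈ negl p r a := by
  induction hq using Submodule.span_induction with
  | mem q hq =>
    obtain ⟨g, f, i, hf, hiC, his, rfl⟩ := hq
    obtain ⟨h1, h2, h3, h4⟩ := h f i hf hiC his
    have hpf : (p : PadicAlgCl p) ^ f ≠ 0 := pow_ne_zero _ prime_cast_ne_zero
    have hcf : c * (p : PadicAlgCl p) ^ f ≠ 0 := mul_ne_zero hc hpf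
    have hval : slopeVal p (c * (p : PadicAlgCl p) ^ f) = slopeVal p c + f := by
      rw [slopeVal_mul hc hpf, slopeVal_prime_pow]
    rw [smul_eq_C_mul, mul_left_comm, symLift_C_mul, smul_smul, map_pow, map_natCast]
    refine (Submodule.sub_mem_iff_left _ ?_).1
      (single_smul_unitForm_mul_sub_mem_negl ha hr his hcf (by rwa [hval]) _)
    have h5 := single_symRep_mem_negl p r a (g, 1)
      (single_smul_monomial_mem_negl ha hM h1 hcf (by rwa [hval]) (by rwa [hval]))
    rwa [symRep_apply, map_smul, symAct_symLift _ _ (monomial_isHomogeneous (by omega))] at h5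
  | zero => rw [mul_zero, map_zero, smul_zero, single, map_zero]; exact Submodule.zero_mem _
  | add q q' _ _ hq hq' =>
    rw [mul_add, map_add, smul_add, single, map_add]
    exact Submodule.add_mem _ hq hq'
  | smul z q _ hq =>
    rw [smul_eq_C_mul, mul_left_comm, symLift_C_mul, smul_comm, single, map_smul]
    exact Submodule.smul_mem _ (zpToZBar p z) hq

end Negligible

/-! ### The filtration and the kernel of the natural surjection -/

section Kernel

open MvPolynomial

variable {p : ℕ} [Fact p.Prime] {r s e d : ℕ} {a : PadicAlgCl p}

/-- The cofactor of θ^m is 1 at (0, 1) and vanishes at the other points of P¹(F_p): n ≠ 0 handles (1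
: 0), and N ≠ 0 the rest. -/
theorem filtV_le_killed_sup {m n N x : ℕ} (hn : n ≠ 0) (hN : N ≠ 0)
    (hr : r = (p + 1) * m + (p * (p - 1) * x + (n + N * (p - 1))))
    (hmem : symLift p (baseHom p (FBar p)) r (dickson p ℤ_[p] ^ m *
      (unitForm p ℤ_[p] ^ x * deltaForm p ℤ_[p] 0 n N)) ∈ killed p r a) :
    filtV p (FBar p) r m ≤ killed p r a ⊔ filtV p (FBar p) r (m + 1) := by
  refine filtV_le_sup (baseHom p (FBar p)) _ (fun g v hv => symRep_mem_killed p r a g hv)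
    (((unitForm_isHomogeneous ℤ_[p]).pow x).mul (deltaForm_isHomogeneous ℤ_[p] 0 n N))
    (by rw [zero_add]; exact hr) hmem ?_ ?_ ?_
  · rw [map_mul, map_mul, map_pow, map_pow, eval_unitForm_zero_one, eval_deltaForm_zero_one,
      one_pow, one_mul]
  · intro z
    rw [map_mul, map_mul, eval_deltaForm_one_hom _ hn hN, mul_zero]
  · intro z hz
    rw [map_mul, map_mul, eval_deltaForm_hom_one _ hN hz, mul_zero]

/-- A matrix with determinant divisible by p makes θ^m divisible by p^m, which has smaller norm than
`a`. -/
theorem filtV_le_killed_of_slopeVal_lt (ha : a ≠ 0) {m : ℕ} (hm : slopeVal p a < m) :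
    filtV p (FBar p) r m ≤ killed p r a := by
  refine filtV_le_of_symLift_mem (baseHom p (FBar p)) _ fun hr u hu => ?_
  have hhom : (dickson p ℤ_[p] ^ m * u).IsHomogeneous r := by
    have := ((dickson_isHomogeneous p ℤ_[p]).pow m).mul hu
    rwa [Nat.add_sub_cancel' hr] at this
  refine symLift_mem_killed p r a hhom ?_
  rw [← one_smul (PadicAlgCl p) (symLift p (baseHom p (PadicAlgCl p)) r _)]
  refine single_mem_negl p ha (k := m) (norm_lt_one_of_slopeVal_pos ?_) hhom fun M hM => ?_
  · rw [one_mul, slopeVal_mul (inv_ne_zero ha) (pow_ne_zero _ prime_cast_ne_zero), slopeVal_inv,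
      slopeVal_prime_pow]
    linarith
  · rw [C_prime_pow_eq, map_mul, map_pow]
    exact Dvd.dvd.mul_right (pow_dvd_pow_of_dvd (prime_dvd_polyAct_dickson M hM) m) _

/-- r - s is at least p · p^e ≥ p (e + 1), which leaves room for the powers of y^(p-1) - x^(p-1) in
δ. -/
theorem add_mul_le_of_le (hr : r = s + p * (p - 1) * (p ^ e * d)) (hd : d ≠ 0) {i N : ℕ}
    (hi : i ≤ s) (hN : N ≤ e + 1) : i + N * p ≤ r := by
  have hp := (Fact.out : p.Prime).one_lt
  have h1 : e + 1 ≤ p ^ e := Nat.lt_pow_self hp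
  have h2 : N ≤ (p - 1) * (p ^ e * d) := by
    calc N ≤ 1 * (p ^ e * 1) := by omega
      _ ≤ (p - 1) * (p ^ e * d) := Nat.mul_le_mul (by omega)
        (Nat.mul_le_mul_left _ (Nat.one_le_iff_ne_zero.2 hd))
  have h3 := Nat.mul_le_mul_left p h2
  rw [← mul_assoc] at h3
  rw [hr, mul_comm N]
  omega

/-- M is the number of factors y^(p-1) - x^(p-1) in δ beyond the exponent of x. Slope less than p -
1 is what keeps M ≤ p - 1. -/
theorem exists_ceil_slopeVal (hv : 0 < slopeVal p a) (hvp : slopeVal p a < p - 1) :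
    ∃ M : ℕ, M ≠ 0 ∧ M ≤ p - 1 ∧ slopeVal p a ≤ M ∧ (M : ℝ) < slopeVal p a + 1 := by
  have hp := (Fact.out : p.Prime).one_le
  refine ⟨⌈slopeVal p a⌉₊, (Nat.ceil_pos.2 hv).ne', Nat.ceil_le.2 ?_, Nat.le_ceil _,
    Nat.ceil_lt_add_one hv.le⟩
  rw [Nat.cast_sub hp, Nat.cast_one]
  exact hvp.le

theorem prime_smul_mem_monoSpan {C : ℕ} (hL : ∀ J ≤ s, (p : ℤ_[p]) •
      (X 0 ^ J * X 1 ^ (s - J) : MvPolynomial (Fin 2) ℤ_[p]) ∈ monoSpan p s C)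
    {q : MvPolynomial (Fin 2) ℤ_[p]} (hq : q.IsHomogeneous s) :
    (p : ℤ_[p]) • q ∈ monoSpan p s C := by
  rw [q.as_sum, Finset.smul_sum]
  refine Submodule.sum_mem _ fun f hf => ?_
  have h1 : f.degree = s := by
    rw [Finsupp.degree_eq_weight_one]
    exact hq (mem_support_iff.1 hf)
  have h2 : f 0 + f 1 = s := by
    rw [← h1, Finsupp.degree_eq_sum, Fin.sum_univ_two]
  have h3 : monomial f (coeff f q) = coeff f q • (X 0 ^ f 0 * X 1 ^ (s - f 0)) := by
    rw [monomial_eq, Finsupp.prod_fintype _ _ (fun _ => pow_zero _), Fin.prod_univ_two,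
      smul_eq_C_mul, show s - f 0 = f 1 by omega]
  rw [h3, smul_comm]
  exact Submodule.smul_mem _ _ (hL _ (by omega))

theorem unitForm_mul_mem_killed (ha : a ≠ 0) (hr : r = s + p * (p - 1) * (p ^ e * d)) (hd : d ≠ 0)
    (hv : 0 < slopeVal p a) (hvp : slopeVal p a < p - 1) (hs : 2 * slopeVal p a < s)
    (ht : 2 * slopeVal p a ≤ (e + 1 : ℕ)) {C : ℕ} (hC : C < slopeVal p a)
    {q : MvPolynomial (Fin 2) ℤ_[p]} (hq : q.IsHomogeneous s)
    (hqC : (p : ℤ_[p]) • q ∈ monoSpan p s C) :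
    symLift p (baseHom p (FBar p)) r (unitForm p ℤ_[p] ^ (p ^ e * d) * q) ∈ killed p r a := by
  obtain ⟨M, hM0, hMp, hvM, hMv⟩ := exists_ceil_slopeVal hv hvp
  refine symLift_mem_killed p r a (unitForm_pow_mul_isHomogeneous hr hq) ?_
  have hp0 : (p : PadicAlgCl p) ≠ 0 := prime_cast_ne_zero
  have hval : slopeVal p (p : PadicAlgCl p)⁻¹ = -1 := by rw [slopeVal_inv, slopeVal_p]
  have h := single_smul_unitForm_mul_mem_negl ha hMp hr (inv_ne_zero hp0) (C := C) ?_ hqC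
  · rwa [smul_eq_C_mul, mul_left_comm, symLift_C_mul, smul_smul, map_natCast, inv_mul_cancel₀ hp0,
      one_smul] at h
  · intro f i hf hi his
    have hiC : (i : ℝ) + 1 ≤ C + f := by exact_mod_cast hi
    have hf' : (f : ℝ) ≤ 1 := by exact_mod_cast hf
    have hi0 : (0 : ℝ) ≤ i := Nat.cast_nonneg i
    have hM1 : (1 : ℝ) ≤ M := by exact_mod_cast Nat.one_le_iff_ne_zero.2 hM0
    have hf0 : (0 : ℝ) ≤ f := Nat.cast_nonneg f
    -- Generators without the factor p occur only for C ≥ 1; the slope then exceeds 1, which makes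
    -- up for the constant p⁻¹.
    have hfC : (1 : ℝ) ≤ f ∨ (1 : ℝ) ≤ C ∧ (f : ℝ) = 0 := by
      rcases Nat.eq_zero_or_pos f with rfl | h
      · right
        exact ⟨by exact_mod_cast (by omega : 1 ≤ C), Nat.cast_zero⟩
      · left; exact_mod_cast h
    rw [hval]
    refine ⟨add_mul_le_of_le hr hd his ?_, ?_, by linarith, ?_⟩
    · have : (i : ℝ) + M < (e + 1 : ℕ) + 1 := by linarith
      have h' : i + M < e + 1 + 1 := by exact_mod_cast this
      omega
    · rcases hfC with h1 | ⟨h1, h2⟩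
      · linarith
      · linarith
    · rw [Nat.cast_min, ← sub_lt_iff_lt_add', lt_min_iff, Nat.cast_sub his]
      constructor
      · rcases hfC with h1 | ⟨h1, h2⟩ <;> linarith
      · linarith

/-- Multiplying `hL` by a⁻¹ p^(m-1) shows that [1, a⁻¹ p^m x^m y^(r-m)] is negligible. Its translate
by α is equivalent to [1, δ], the relation being taken with c = a⁻¹ so that `a` cancels. -/
theorem deltaForm_mem_killed (ha : a ≠ 0) (hr : r = s + p * (p - 1) * (p ^ e * d)) (hd : d ≠ 0)
    (hs : 2 * slopeVal p a < s) (ht : 2 * slopeVal p a ≤ (e + 1 : ℕ)) {m M : ℕ} (hm : m ≠ 0)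
    (hmv : m ≤ slopeVal p a) (hMp : M ≤ p - 1) (hvM : slopeVal p a ≤ M)
    (hMv : (M : ℝ) < slopeVal p a + 1)
    (hL : (p : ℤ_[p]) • (X 0 ^ m * X 1 ^ (s - m) : MvPolynomial (Fin 2) ℤ_[p]) ∈
      monoSpan p s (m - 1)) :
    symLift p (baseHom p (FBar p)) r
      (deltaForm p ℤ_[p] m (r - m - (m + M) * (p - 1)) (m + M)) ∈ killed p r a := by
  have hp0 : (p : PadicAlgCl p) ≠ 0 := prime_cast_ne_zero
  have hm1 : (1 : ℝ) ≤ m := by exact_mod_cast Nat.one_le_iff_ne_zero.2 hm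
  have hms : m ≤ s := by
    have : (m : ℝ) < s := by linarith
    exact_mod_cast this.le
  have hmM : m + (m + M) * p ≤ r := by
    refine add_mul_le_of_le hr hd hms ?_
    have : (m : ℝ) + M < (e + 1 : ℕ) + 1 := by linarith
    have h' : m + M < e + 1 + 1 := by exact_mod_cast this
    omega
  have hcast : ((m - 1 : ℕ) : ℝ) = m - 1 := by
    rw [Nat.cast_sub (Nat.one_le_iff_ne_zero.2 hm), Nat.cast_one]
  have hc0 : a⁻¹ * (p : PadicAlgCl p) ^ (m - 1) ≠ 0 :=
    mul_ne_zero (inv_ne_zero ha) (pow_ne_zero _ hp0)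
  have hval : slopeVal p (a⁻¹ * (p : PadicAlgCl p) ^ (m - 1)) = m - 1 - slopeVal p a := by
    rw [slopeVal_mul (inv_ne_zero ha) (pow_ne_zero _ hp0), slopeVal_inv, slopeVal_prime_pow, hcast]
    ring
  have h1 := single_smul_unitForm_mul_mem_negl ha hMp hr hc0 (C := m - 1) (fun f i hf hi his => by
    have hiC : (i : ℝ) + 1 ≤ m - 1 + f := by rw [← hcast]; exact_mod_cast hi
    have hf' : (f : ℝ) ≤ 1 := by exact_mod_cast hf
    have hi0 : (0 : ℝ) ≤ i := Nat.cast_nonneg i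
    rw [hval]
    refine ⟨add_mul_le_of_le hr hd his ?_, by linarith, by linarith, ?_⟩
    · have : (i : ℝ) + M < (e + 1 : ℕ) + 1 := by linarith
      have h' : i + M < e + 1 + 1 := by exact_mod_cast this
      omega
    · rw [Nat.cast_min, ← sub_lt_iff_lt_add', lt_min_iff, Nat.cast_sub his]
      constructor <;> linarith) hL
  have hcm : a⁻¹ * (p : PadicAlgCl p) ^ (m - 1) * p = a⁻¹ * (p : PadicAlgCl p) ^ m := by
    rw [mul_assoc, ← pow_succ, Nat.sub_add_cancel (Nat.one_le_iff_ne_zero.2 hm)]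
  have hvalm : slopeVal p (a⁻¹ * (p : PadicAlgCl p) ^ m) = m - slopeVal p a := by
    rw [slopeVal_mul (inv_ne_zero ha) (pow_ne_zero _ hp0), slopeVal_inv, slopeVal_prime_pow]
    ring
  rw [smul_eq_C_mul, mul_left_comm, symLift_C_mul, smul_smul, map_natCast, hcm] at h1
  have h2 := single_smul_unitForm_mul_sub_mem_negl ha hr hms
    (mul_ne_zero (inv_ne_zero ha) (pow_ne_zero m hp0)) (by
      rw [hvalm, Nat.cast_min, ← sub_lt_iff_lt_add', lt_min_iff, Nat.cast_sub hms]
      constructor <;> linarith) 1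
  rw [polyAct_one, AlgHom.id_apply, AlgHom.id_apply] at h2
  have h3 := cIndRep_mem_negl p r a (heckeElt p none) ((Submodule.sub_mem_iff_right _ h1).1 h2)
  have h4 := single_monomial_sub_deltaForm_mem_negl (a := a) hMp hmM (inv_ne_zero ha) (by
    rw [slopeVal_inv]; linarith)
  have h5 := (Submodule.sub_mem_iff_right _ h3).1 h4
  rw [mul_inv_cancel₀ ha, one_smul] at h5
  refine symLift_mem_killed p r a ?_ h5
  have hp1 := (Fact.out : p.Prime).one_le
  have e1 : (m + M) * p = (m + M) * (p - 1) + (m + M) := by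
    rw [← Nat.mul_succ]; congr 1; omega
  have := deltaForm_isHomogeneous (p := p) ℤ_[p] m (r - m - (m + M) * (p - 1)) (m + M)
  rwa [show m + (r - m - (m + M) * (p - 1)) + (m + M) * (p - 1) = r by omega] at this

/-- A criterion for the natural surjection to factor through the `n`-th graded piece. -/
theorem factorsThrough_of_monoSpan (ha : a ≠ 0) (hr : r = s + p * (p - 1) * (p ^ e * d))
    (hd : d ≠ 0) (hv : 0 < slopeVal p a) (hvp : slopeVal p a < p - 1) (hs : 2 * slopeVal p a < s)
    (ht : 2 * slopeVal p a ≤ (e + 1 : ℕ)) {C n : ℕ} (hC : C < slopeVal p a)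
    (hn : (p + 1) * n ≤ s + 1)
    (hL : ∀ J ≤ s, (p : ℤ_[p]) •
      (X 0 ^ J * X 1 ^ (s - J) : MvPolynomial (Fin 2) ℤ_[p]) ∈ monoSpan p s C)
    (hLm : ∀ m, n < m → m ≤ C → (p : ℤ_[p]) •
      (X 0 ^ m * X 1 ^ (s - m) : MvPolynomial (Fin 2) ℤ_[p]) ∈ monoSpan p s (m - 1)) :
    FactorsThrough p r a n := by
  have hp := (Fact.out : p.Prime).two_le
  -- Above n: beyond the slope V_r^(m) is entirely killed; up to the slope, the killed form δ = ±
  -- θ^m (...) generates the graded piece.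
  have hstep : ∀ m, n < m → filtV p (FBar p) r m ≤ killed p r a ⊔ filtV p (FBar p) r (m + 1) := by
    intro m hm
    rcases lt_or_ge (slopeVal p a) m with hmv | hmv
    · exact (filtV_le_killed_of_slopeVal_lt ha hmv).trans le_sup_left
    obtain ⟨M, hM0, hMp, hvM, hMv⟩ := exists_ceil_slopeVal hv hvp
    have hms : m ≤ s := by
      have : (m : ℝ) < s := by linarith
      exact_mod_cast this.le
    have hmM : m + (m + M) * p ≤ r := by
      refine add_mul_le_of_le hr hd hms ?_
      have : (m : ℝ) + M < (e + 1 : ℕ) + 1 := by linarith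
      have h' : m + M < e + 1 + 1 := by exact_mod_cast this
      omega
    have e1 : (m + M) * p = (m + M) * (p - 1) + (m + M) := by
      rw [← Nat.mul_succ]; congr 1; omega
    have e2 : (m + M) * (p - 1) = m * (p - 1) + M * (p - 1) := Nat.add_mul _ _ _
    have e3 : (p + 1) * m = m * (p - 1) + 2 * m := by
      rw [mul_comm 2 m, ← Nat.mul_add, mul_comm]; congr 1; omega
    have hmem : (p : ℤ_[p]) • (X 0 ^ m * X 1 ^ (s - m) : MvPolynomial (Fin 2) ℤ_[p]) ∈
        monoSpan p s (m - 1) := by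
      by_cases hmC : m ≤ C
      · exact hLm m hm hmC
      · exact monoSpan_mono (by omega) (hL m hms)
    have h1 := deltaForm_mem_killed ha hr hd hs ht (by omega) hmv hMp hvM hMv hmem
    obtain ⟨k, hk⟩ : ∃ k, r - m - (m + M) * (p - 1) = k + m :=
      ⟨r - m - (m + M) * (p - 1) - m, by omega⟩
    rw [hk, add_comm m M, deltaForm_eq_dickson_pow_mul, ← map_one MvPolynomial.C, ← map_neg, ← map_pow,
      symLift_C_mul] at h1
    have h2 := (killed p r a).smul_mem (baseHom p (FBar p) ((-1) ^ m)) h1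
    rw [smul_smul, ← map_mul, ← mul_pow, neg_one_mul, neg_neg, one_pow, map_one, one_smul] at h2
    refine filtV_le_killed_sup (n := k) (N := M) (x := 0) (by omega) hM0 (by omega) ?_
    rwa [pow_zero, one_mul]
  -- Below n: `hn` leaves degree at least p next to θ^m, enough for y^(k+1) (y^(p-1) - x^(p-1)) with
  -- a positive power of y.
  have hlow : ∀ m, m < n → filtV p (FBar p) r m ≤ killed p r a ⊔ filtV p (FBar p) r (m + 1) := by
    intro m hm
    have h1 : (p + 1) * (m + 1) ≤ s + 1 := (Nat.mul_le_mul_left _ hm).trans hn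
    rw [Nat.mul_succ] at h1
    obtain ⟨k, hk⟩ : ∃ k, s = (p + 1) * m + (k + 1 + 1 * (p - 1)) :=
      ⟨s - (p + 1) * m - p, by omega⟩
    refine filtV_le_killed_sup (n := k + 1) (N := 1) (x := p ^ e * d) (by omega) one_ne_zero
      (by rw [hr]; omega) ?_
    have hq : (dickson p ℤ_[p] ^ m * deltaForm p ℤ_[p] 0 (k + 1) 1).IsHomogeneous s := by
      rw [hk]
      have := ((dickson_isHomogeneous p ℤ_[p]).pow m).mul
        (deltaForm_isHomogeneous (p := p) ℤ_[p] 0 (k + 1) 1)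
      rwa [zero_add] at this
    rw [mul_left_comm]
    exact unitForm_mul_mem_killed ha hr hd hv hvp hs ht hC hq (prime_smul_mem_monoSpan hL hq)
  -- Descending induction from a step beyond the slope: the term V_r^(m+1) in `hstep` is already
  -- killed.
  have hhigh : ∀ j m, n < m → slopeVal p a < (m + j : ℕ) →
      filtV p (FBar p) r m ≤ killed p r a := by
    intro j
    induction j with
    | zero => exact fun m _ h => filtV_le_killed_of_slopeVal_lt ha h
    | succ j ih =>
      intro m hm h
      refine (hstep m hm).trans (sup_le le_rfl (ih (m + 1) (by omega) ?_))
      rwa [show m + 1 + j = m + (j + 1) by omega]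
  have htop : ∀ m ≤ n, ⊤ ≤ killed p r a ⊔ filtV p (FBar p) r m := by
    intro m
    induction m with
    | zero =>
      intro _ f _
      refine Submodule.mem_sup_right ?_
      change dickson p (FBar p) ^ 0 ∣ f.poly
      rw [pow_zero]
      exact one_dvd _
    | succ m ih => exact fun hm => (ih (by omega)).trans (sup_le le_sup_left (hlow m (by omega)))
  obtain ⟨j, hj⟩ := exists_nat_gt (slopeVal p a)
  refine factorsThrough_of_killed p r a n (hhigh j (n + 1) (by omega) ?_)
    (top_le_iff.1 (htop n le_rfl))
  refine hj.trans_le ?_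
  exact_mod_cast (by omega : j ≤ n + 1 + j)

end Kernel

end

theorem mainTheorem2 (p : ℕ) [Fact p.Prime] (hp : 7 ≤ p) (b c t d r s : ℕ)
    (hb : 2 ≤ b) (hbp : b ≤ p) (hc : c ≤ p - 2) (hd : ¬ p ∣ d)
    (hs : s = b + c * (p - 1)) (hr : r = s + p ^ t * (p - 1) * d)
    (a : PadicAlgCl p) (ha : a ≠ 0)
    (hsa : 2 * slopeVal p a < s) (hca : (c : ℝ) < slopeVal p a)
    (hav : slopeVal p a < min ((p : ℝ) / 2 + c - epsBC p b c) ((p : ℝ) - 1))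
    (ht₁ : 2 * (c : ℤ) - 1 ≤ b → 2 * slopeVal p a ≤ t)
    (ht₂ : (b : ℤ) ≤ 2 * (c : ℤ) - 2 → 2 * slopeVal p a + epsBC p b c - 1 < t) :
    ((b, c) ≠ (p, 0) → FactorsThrough p r a (c - epsBC p b c)) ∧
    ((b, c) = (p, 0) → 1 < slopeVal p a → FactorsThrough p r a 1) := by
  have hv : 0 < slopeVal p a := (Nat.cast_nonneg c).trans_lt hca
  have hvp : slopeVal p a < p - 1 := hav.trans_le (min_le_right _ _)
  have hd0 : d ≠ 0 := fun h => hd (h ▸ dvd_zero p)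
  -- For b ≤ 2c - 2 one has ε ≥ 1, so the second bound on t implies this one.
  have ht : 2 * slopeVal p a ≤ t := by
    by_cases h : 2 * (c : ℤ) - 1 ≤ b
    · exact ht₁ h
    · have h1 := ht₂ (by omega)
      have h2 : 1 ≤ epsBC p b c := by
        rw [epsBC, if_neg h]
        split_ifs <;> norm_num
      have h3 : (1 : ℝ) ≤ epsBC p b c := by exact_mod_cast h2
      linarith
  -- The form E has degree p (p - 1), so it uses up one factor of p^t.
  obtain ⟨e, rfl⟩ : ∃ e, t = e + 1 := by
    refine Nat.exists_eq_succ_of_ne_zero ?_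
    rintro rfl
    rw [Nat.cast_zero] at ht
    linarith
  have hr' : r = s + p * (p - 1) * (p ^ e * d) := by rw [hr, pow_succ]; ring
  have hcp : c * (p - 1) + 2 * c = (p + 1) * c := by
    rw [mul_comm 2 c, ← Nat.mul_add, mul_comm]; congr 1; omega
  refine ⟨fun hbc => ?_, fun hbc hv1 => ?_⟩
  · refine factorsThrough_of_monoSpan ha hr' hd0 hv hvp hsa ht hca ?_
      (fun J hJ => prime_mul_monomial_mem_monoSpan_of_ne (by omega) hb hbp hc hs hbc hJ)
      fun m hm hmc => ?_
    -- (p + 1)(c - ε) ≤ s + 1: the case distinction defining ε selects the least value for which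
    -- this holds.
    · rw [Nat.mul_sub]
      rw [epsBC]
      split_ifs <;> omega
    · rw [epsBC] at hm
      split_ifs at hm with h1 h2
      · omega
      · have : m = c := by omega
        rw [this]
        exact prime_mul_monomial_mem_monoSpan_pred (by omega) hb hbp hc hs (by omega)
      · rcases (by omega : m = c ∨ m = c - 1) with h | h
        · rw [h]
          exact prime_mul_monomial_mem_monoSpan_pred (by omega) hb hbp hc hs (by omega)
        · rw [h, Nat.sub_sub]
          exact prime_mul_monomial_mem_monoSpan_pred_pred (by omega) hb hc hs (by omega)
  · obtain ⟨rfl, rfl⟩ := Prod.mk.inj hbc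
    have hsp : s = b := by rw [hs]; simp
    subst hsp
    -- Here s = p and (p + 1) · 1 = s + 1. Taking C = 1 instead of c = 0 makes y^p available without
    -- the factor p, at the price of slope > 1.
    refine factorsThrough_of_monoSpan (C := 1) ha hr' hd0 hv hvp hsa ht (by exact_mod_cast hv1)
      (by omega) (fun J hJ => prime_mul_monomial_mem_monoSpan_self (by omega) hJ) fun m h1 h2 => ?_
    omega
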